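/- **Setting.** There are $n$ players. Player $i$ has a compact convex action set $\mathcal X_i\subseteq\mathbb R^d$ ($d\ge 1$) with nonempty interior and diameter at most $B$, and a continuous cost $c_i:\prod_j\mathcal X_j\to[0,1]$ which, in the player's own action $x_i$, is differentiable, convex and $\ell_i$-smooth (its gradient $\nabla_i c_i$ is $\ell_i$-Lipschitz in $x_i$), with $\|\nabla_i c_i\|\le G$. The operator $F=(\nabla_i c_i)_i$ is monotone: $\langle F(x)-F(y),x-y\rangle\ge 0$ for all $x,y$. Let $\mathrm{SW}(x)=\sum_i c_i(x)$ and $\mathrm{OPT}=\min_x \mathrm{SW}(x)$ over $\prod_j\mathcal X_j$. The game is $(C_1,C_2)$-smooth: $C_1>0$, $C_2<1$, and for some joint action $x'$, $\sum_i c_i(x_i',x_{-i})\le C_1\mathrm{OPT}+C_2\,\mathrm{SW}(x)$ for every joint action $x$. **Regularizers.** For each $i$, $h_i$ is a $\nu$-self-concordant barrier for $\mathcal X_i$: convex and $C^3$ on $\operatorname{int}\mathcal X_i$, tending to $\infty$ at the boundary, with $|\nabla^3h_i(x)[v,v,v]|\le 2(v^\top\nabla^2h_i(x)v)^{3/2}$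 and $|\nabla h_i(x)^\top v|\le\sqrt\nu\,(v^\top\nabla^2h_i(x)v)^{1/2}$. Further, $p_i$ is $C^2$ near $\mathcal X_i$ with $\mu I\preceq\nabla^2p_i\preceq\zeta I$ on $\mathcal X_i$ ($\mu\ge0$, $\zeta>0$), its Bregman divergence satisfies $D_{p_i}\le C_p<\infty$ on $\mathcal X_i$, and for some $\kappa>0$ the function $c_i(x_i,x_{-i})-\kappa p_i(x_i)$ is convex in $x_i$. Here $D_f(y,x)=f(y)-f(x)-\langle\nabla f(x),y-x\rangle$. **Algorithm.** Put $\eta_t=\frac1{2d\,t^{3/4}}$ and $\delta_t=t^{-1/4}$. Every player starts at $x_i^1=\arg\min_{\mathcal X_i}h_i$, and in rounds $t=1,2,\dots$ sets $A_i^t=(\nabla^2h_i(x_i^t)+\eta_t(t+1)\nabla^2p_i(x_i^t))^{-1/2}$, plays $\hat x_i^t=x_i^t+\delta_tA_i^tz_i^t$, where the $z_i^t$ are independent (over $i$ and $t$) and uniform on the unit sphere of $\mathbb R^d$, observes $c_i(\hat x^t)$, puts $\hat g_i^t=\frac d{\delta_t}c_i(\hat x^t)(A_i^t)^{-1}z_i^t$,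 and updates $$x_i^{t+1}=\arg\min_{y\in\mathcal X_i}\{\eta_t\langle y,\hat g_i^t\rangle+\eta_t\kappa(t+1)D_{p_i}(y,x_i^t)+D_{h_i}(y,x_i^t)\}$$ (both minimizations with $h_i=+\infty$ on the boundary of $\mathcal X_i$). **Claim.** All the expectations below exist, and $$\frac1T\sum_{t=1}^T\mathbb E[\mathrm{SW}(\hat x^t)]=O\Big(\frac{C_1\,\mathrm{OPT}}{1-C_2}+\frac{n\nu d\log T}{(1-C_2)T^{1/4}}+\frac{\sqrt n\,B\sum_i\ell_i}{(1-C_2)T^{1/4}}\Big)\qquad(T\to\infty)$$ with an absolute implied constant: there is a universal $K>0$ (independent of $n,d$, the game, the regularizers and every parameter above) such that, in every such setting, the left side is at most $K$ times the expression in parentheses for all sufficiently large $T$ (how large may depend on the setting). -/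

import Mathlib

open MeasureTheory ProbabilityTheory

noncomputable section

/-- The action space `ℝ^d` with its Euclidean norm. -/
abbrev Act (d : ℕ) : Type := EuclideanSpace ℝ (Fin d)

/-- An `n`-player game: action sets `X i ⊆ ℝ^d` and cost functions `c i`, of which only the values
on the product of the action sets are ever used. -/
structure Game (n d : ℕ) where
  X : Fin n → Set (Act d)
  c : Fin n → (Fin n → Act d) → ℝ

namespace Game

variable {n d : ℕ}

/-- The joint actions `∏ i, X i`. -/
def profiles (𝒢 : Game n d) : Set (Fin n → Act d) := {x | ∀ i, x i ∈ 𝒢.X i}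

/-- The cost `y ↦ c_i(y, x_{-i})` of player `i` as a function of her own action. -/
def ownCost (𝒢 : Game n d) (i : Fin n) (x : Fin n → Act d) (y : Act d) : ℝ :=
  𝒢.c i (Function.update x i y)

/-- The partial gradient `∇_i c_i(x)`, taken relative to the action set `X i` (so that it is the
usual gradient in the interior and also makes sense on the boundary). -/
def partialGrad (𝒢 : Game n d) (i : Fin n) (x : Fin n → Act d) : Act d :=
  gradientWithin (𝒢.ownCost i x) (𝒢.X i) (x i)

/-- The standing assumptions on the game: compact convex action sets with nonempty interior and
diameter at most `B`; costs in `[0, 1]`, continuous, and, in the player's own action,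
differentiable, convex and `ℓ i`-smooth; gradients bounded by `G`; monotone gradient operator. -/
structure IsMonotoneGame (𝒢 : Game n d) (B G : ℝ) (ℓ : Fin n → ℝ) : Prop where
  convex_set : ∀ i, Convex ℝ (𝒢.X i)
  compact_set : ∀ i, IsCompact (𝒢.X i)
  nonempty_interior : ∀ i, (interior (𝒢.X i)).Nonempty
  diameter : ∀ i, ∀ y ∈ 𝒢.X i, ∀ y' ∈ 𝒢.X i, ‖y - y'‖ ≤ B
  range : ∀ i, ∀ x ∈ 𝒢.profiles, 𝒢.c i x ∈ Set.Icc (0 : ℝ) 1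
  continuous : ∀ i, ContinuousOn (𝒢.c i) 𝒢.profiles
  differentiable : ∀ i, ∀ x ∈ 𝒢.profiles, DifferentiableOn ℝ (𝒢.ownCost i x) (𝒢.X i)
  convex : ∀ i, ∀ x ∈ 𝒢.profiles, ConvexOn ℝ (𝒢.X i) (𝒢.ownCost i x)
  smooth : ∀ i, ∀ x ∈ 𝒢.profiles, ∀ y ∈ 𝒢.X i,
    ‖𝒢.partialGrad i (Function.update x i y) - 𝒢.partialGrad i x‖ ≤ ℓ i * ‖y - x i‖
  bounded_grad : ∀ i, ∀ x ∈ 𝒢.profiles, ‖𝒢.partialGrad i x‖ ≤ G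
  monotone : ∀ x ∈ 𝒢.profiles, ∀ y ∈ 𝒢.profiles,
    0 ≤ ∑ i, inner ℝ (𝒢.partialGrad i x - 𝒢.partialGrad i y) (x i - y i)

/-- The social cost `SW(x) = ∑ i, c_i(x)`. -/
def SW (𝒢 : Game n d) (x : Fin n → Act d) : ℝ := ∑ i, 𝒢.c i x

/-- The optimal social cost `OPT = min_x SW(x)` over the joint actions. -/
def OPT (𝒢 : Game n d) : ℝ := sInf (𝒢.SW '' 𝒢.profiles)

/-- `(C₁, C₂)`-smoothness of a game. -/
def IsSmoothGame (𝒢 : Game n d) (C₁ C₂ : ℝ) : Prop :=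
  0 < C₁ ∧ C₂ < 1 ∧ ∃ x' ∈ 𝒢.profiles, ∀ x ∈ 𝒢.profiles,
    ∑ i, 𝒢.c i (Function.update x i (x' i)) ≤ C₁ * 𝒢.OPT + C₂ * 𝒢.SW x

end Game

section Regularizers

variable {d : ℕ}

/-- The Hessian `∇²f(x)` as a linear operator, `⟪∇²f(x) u, v⟫ = D²f(x)[u, v]`. -/
def hess (f : Act d → ℝ) (x : Act d) : Act d →L[ℝ] Act d := fderiv ℝ (gradient f) x

/-- The Bregman divergence `D_f(y, x) = f(y) - f(x) - ⟪∇f(x), y - x⟫`. -/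
def bregman (f : Act d → ℝ) (y x : Act d) : ℝ := f y - f x - inner ℝ (gradient f x) (y - x)

/-- `h` is a `ν`-self-concordant barrier for the closed convex set `X`. Only the values of `h` on
the interior of `X` matter; `h` is understood to be `+∞` on the boundary. -/
structure IsSelfConcordantBarrier (ν : ℝ) (X : Set (Act d)) (h : Act d → ℝ) : Prop where
  contDiffOn : ContDiffOn ℝ 3 h (interior X)
  barrier : ∀ b ∈ frontier X, Filter.Tendsto h (nhdsWithin b (interior X)) Filter.atTop
  hess_nonneg : ∀ x ∈ interior X, ∀ v, 0 ≤ inner ℝ (hess h x v) v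
  third_deriv : ∀ x ∈ interior X, ∀ v,
    |iteratedFDeriv ℝ 3 h x (fun _ => v)| ≤ 2 * (inner ℝ (hess h x v) v) ^ (3 / 2 : ℝ)
  first_deriv : ∀ x ∈ interior X, ∀ v,
    |inner ℝ (gradient h x) v| ≤ Real.sqrt ν * Real.sqrt (inner ℝ (hess h x v) v)

/-- The conditions on the second regularizer `p i` of every player: `p i` is twice continuously
differentiable with `μ I ≼ ∇²p ≼ ζ I` (hence convex) on `X i`, its Bregman divergence is bounded by
`Cp` on `X i`, and `c_i - κ p_i` is convex in the player's own action. -/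
structure IsRegularizer {n : ℕ} (𝒢 : Game n d) (κ μ ζ Cp : ℝ) (p : Fin n → Act d → ℝ) :
    Prop where
  κ_pos : 0 < κ
  μ_nonneg : 0 ≤ μ
  ζ_pos : 0 < ζ
  contDiffAt : ∀ i, ∀ x ∈ 𝒢.X i, ContDiffAt ℝ 2 (p i) x
  hess_lower : ∀ i, ∀ x ∈ 𝒢.X i, ∀ v, μ * ‖v‖ ^ 2 ≤ inner ℝ (hess (p i) x v) v
  hess_upper : ∀ i, ∀ x ∈ 𝒢.X i, ∀ v, inner ℝ (hess (p i) x v) v ≤ ζ * ‖v‖ ^ 2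
  bregman_le : ∀ i, ∀ y ∈ 𝒢.X i, ∀ x ∈ 𝒢.X i, bregman (p i) y x ≤ Cp
  convex_sub : ∀ i, ∀ x ∈ 𝒢.profiles,
    ConvexOn ℝ (𝒢.X i) (fun y => 𝒢.ownCost i x y - κ * p i y)

end Regularizers

section Algorithm

variable {n d : ℕ}

/-- The unit sphere of `ℝ^d`. -/
abbrev Sph (d : ℕ) : Type := Metric.sphere (0 : Act d) 1

/-- The uniform probability distribution on the unit sphere (normalized surface measure). -/
def uniformSphere (d : ℕ) : Measure (Sph d) :=
  ((volume : Measure (Act d)).toSphere Set.univ)⁻¹ • (volume : Measure (Act d)).toSphere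

variable {Ω : Type*}

/-- The action profile `x̂^t` with components `x̂_i^t = x_i^t + δ_t A_i^t z_i^t`, played in
round `t`. -/
def played (δ : ℕ → ℝ) (z : Fin n → ℕ → Ω → Sph d) (x : Fin n → ℕ → Ω → Act d)
    (A : Fin n → ℕ → Ω → Act d →L[ℝ] Act d) (t : ℕ) (ω : Ω) : Fin n → Act d :=
  fun i => x i t ω + δ t • A i t ω (z i t ω : Act d)

/-- The gradient estimator `ĝ_i^t = (d / δ_t) c_i(x̂^t) (A_i^t)⁻¹ z_i^t`. -/
def gradEst (𝒢 : Game n d) (δ : ℕ → ℝ) (z : Fin n → ℕ → Ω → Sph d)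
    (x : Fin n → ℕ → Ω → Act d) (A : Fin n → ℕ → Ω → Act d →L[ℝ] Act d)
    (i : Fin n) (t : ℕ) (ω : Ω) : Act d :=
  ((d : ℝ) / δ t * 𝒢.c i (played δ z x A t ω)) • (A i t ω).inverse (z i t ω : Act d)

/-- Every player runs the algorithm with learning rates `η`, sampling radii `δ`, regularizers `h i`
and `p i` and constant `κ`. Rounds are `t = 1, 2, …`; entries at `t = 0` are not used.
The minimizations over `X i` are over its interior, `h i` being `+∞` on the boundary. -/
structure IsAlgorithmRun (𝒢 : Game n d) (h p : Fin n → Act d → ℝ) (κ : ℝ) (η δ : ℕ → ℝ)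
    (z : Fin n → ℕ → Ω → Sph d) (x : Fin n → ℕ → Ω → Act d)
    (A : Fin n → ℕ → Ω → Act d →L[ℝ] Act d) : Prop where
  init_mem : ∀ i ω, x i 1 ω ∈ interior (𝒢.X i)
  init_min : ∀ i ω, IsMinOn (h i) (interior (𝒢.X i)) (x i 1 ω)
  /-- `A_i^t` is positive semidefinite. -/
  scaling_pos : ∀ i, ∀ t ≥ 1, ∀ ω, (A i t ω).IsPositive
  /-- `(A_i^t)² (∇²h(x_i^t) + η_t (t + 1) ∇²p(x_i^t)) = I`, i.e. `A_i^t` is the inverse square root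
  of that Hessian. -/
  scaling_eq : ∀ i, ∀ t ≥ 1, ∀ ω,
    A i t ω * A i t ω * (hess (h i) (x i t ω) + (η t * ((t : ℝ) + 1)) • hess (p i) (x i t ω)) = 1
  step_mem : ∀ i, ∀ t ≥ 1, ∀ ω, x i (t + 1) ω ∈ interior (𝒢.X i)
  step_min : ∀ i, ∀ t ≥ 1, ∀ ω,
    IsMinOn
      (fun y => η t * inner ℝ y (gradEst 𝒢 δ z x A i t ω)
        + η t * κ * ((t : ℝ) + 1) * bregman (p i) y (x i t ω)
        + bregman (h i) y (x i t ω))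
      (interior (𝒢.X i)) (x i (t + 1) ω)

/-- The sampled directions `z_i^t` are independent over players and rounds, and each of them is
uniformly distributed on the unit sphere. -/
structure IsUniformSampling [MeasurableSpace Ω] (P : Measure Ω) (z : Fin n → ℕ → Ω → Sph d) :
    Prop where
  measurable : ∀ i t, Measurable (z i t)
  law : ∀ i t, P.map (z i t) = uniformSphere d
  indep : iIndepFun (fun k : Fin n × ℕ => z k.1 k.2) P

end Algorithm

end

/-!
By the divergence theorem, the one-point estimator of a player is an unbiased estimator of the
gradient of the player's cost averaged over the sampled ellipsoid, and smoothness of the cost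
makes the bias due to this averaging `O(ℓ_i δ_t²)`. As `c_i - κ p_i` is convex, the bound of the
regret of round `t` against a fixed comparator by the linearized regret gains a term `κ D_p`,
which pays for the growing weight `η_t (t + 1)` of `p_i` in the mirror step. So the potential
`D_h + κ η_t t D_p` drops by `η_t` times the regret, up to the noise and the bias.

The noise of the estimator is proportional to `c_i² ≤ c_i`. With `η_t = 1 / (2 d t^{3/4})` and
`δ_t = t^{-1/4}` its coefficient becomes arbitrarily small relative to `η_t`, because continuity
of `∇²p_i` makes the change of the Hessian along a mirror step negligible. The noise is therefore
absorbed by half of the factor `1 - C₂` that smoothness of the game puts in front of the social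
welfare. As `ℓ_i δ_t² = o(δ_t)`, the bias is eventually dominated by `ν δ_t`, and `∑ η_t δ_t` is
of order `log T`.

The comparator is the action profile from the smoothness of the game, shrunk by the factor
`1 - 1 / T` towards interior points; this costs `ν log T` in the barrier and `1 / T` per round.
-/

noncomputable section

section BallDivergence

open Set Metric Filter Topology Module

theorem integral_eq_integral_Ioi_integral_sphere {E : Type*} [NormedAddCommGroup E]
    [NormedSpace ℝ E] [FiniteDimensional ℝ E] [Nontrivial E] [MeasurableSpace E] [BorelSpace E]
    (μ : Measure E) [μ.IsAddHaarMeasure] {F : E → ℝ} (hF : Integrable F μ) :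
    ∫ x, F x ∂μ = ∫ r in Ioi (0 : ℝ), r ^ (finrank ℝ E - 1) *
      ∫ z : sphere (0 : E) 1, F (r • (z : E)) ∂μ.toSphere := by
  let F' : sphere (0 : E) 1 × Ioi (0 : ℝ) → ℝ := fun q => F (q.2.1 • (q.1 : E))
  have hF' : F' ∘ homeomorphUnitSphereProd E = fun x : ({0}ᶜ : Set E) => F x := by
    funext x
    have hx : ‖(x : E)‖ ≠ 0 := norm_ne_zero_iff.2 x.2
    simp [F', smul_smul, hx]
  have hpolar := μ.measurePreserving_homeomorphUnitSphereProd
  have hemb := (homeomorphUnitSphereProd E).measurableEmbedding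
  have hint : Integrable F' (μ.toSphere.prod (.volumeIoiPow (finrank ℝ E - 1))) := by
    rw [← hpolar.integrable_comp_emb hemb, hF']
    exact (integrableOn_iff_comap_subtypeVal (measurableSet_singleton _).compl).1 hF.integrableOn
  calc ∫ x, F x ∂μ = ∫ x : ({0}ᶜ : Set E), F x ∂μ.comap (↑) := by
        rw [integral_subtype_comap (measurableSet_singleton _).compl, restrict_compl_singleton]
    _ = ∫ q, F' q ∂μ.toSphere.prod (.volumeIoiPow (finrank ℝ E - 1)) := by
        rw [← hpolar.integral_comp hemb]
        exact integral_congr_ae (.of_forall fun x => (congrFun hF' x).symm)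
    _ = ∫ r : Ioi (0 : ℝ), ∫ z : sphere (0 : E) 1, F (r.1 • (z : E)) ∂μ.toSphere
          ∂.volumeIoiPow (finrank ℝ E - 1) := integral_prod_symm F' hint
    _ = _ := by
        simp only [Measure.volumeIoiPow, ENNReal.ofReal]
        rw [integral_withDensity_eq_integral_smul
            ((measurable_subtype_coe.pow_const _).real_toNNReal),
          integral_subtype_comap measurableSet_Ioi fun r : ℝ =>
            Real.toNNReal (r ^ (finrank ℝ E - 1)) •
              ∫ z : sphere (0 : E) 1, F (r • (z : E)) ∂μ.toSphere]
        refine setIntegral_congr_fun measurableSet_Ioi fun r hr => ?_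
        simp only [NNReal.smul_def, smul_eq_mul]
        rw [Real.coe_toNNReal _ (pow_nonneg (mem_Ioi.1 hr).le _)]

theorem deriv_smoothTransition_nonneg (s : ℝ) : 0 ≤ deriv Real.smoothTransition s :=
  Real.smoothTransition.monotone.deriv_nonneg

theorem deriv_smoothTransition_eq_zero {s : ℝ} (hs : s ≤ 0 ∨ 1 ≤ s) :
    deriv Real.smoothTransition s = 0 := by
  rcases hs with hs | hs
  · refine IsLocalMin.deriv_eq_zero (.of_forall fun y => ?_)
    rw [Real.smoothTransition.zero_of_nonpos hs]
    exact Real.smoothTransition.nonneg y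
  · refine IsLocalMax.deriv_eq_zero (.of_forall fun y => ?_)
    rw [Real.smoothTransition.one_of_one_le hs]
    exact Real.smoothTransition.le_one y

theorem continuous_deriv_smoothTransition : Continuous (deriv Real.smoothTransition) :=
  (Real.smoothTransition.contDiff (n := 1)).continuous_deriv le_rfl

/-- A smooth cutoff of the unit ball: it is `1` where `‖x‖ ^ 2 ≤ 1 - ε` and `0` outside the ball.
The squared norm makes it smooth at the origin. -/
def ballCutoff {E : Type*} [Norm E] (ε : ℝ) (x : E) : ℝ :=
  Real.smoothTransition ((1 - ‖x‖ ^ 2) / ε)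

/-- Minus the radial derivative of `ballCutoff ε` at distance `r` from the origin; as `ε → 0` these
functions concentrate at `r = 1`. -/
def shellDensity (ε r : ℝ) : ℝ := deriv Real.smoothTransition ((1 - r ^ 2) / ε) * (2 * r / ε)

theorem shellDensity_eq_zero_of_one_le {ε r : ℝ} (hε : 0 < ε) (hr : 1 ≤ r) :
    shellDensity ε r = 0 := by
  rw [shellDensity, deriv_smoothTransition_eq_zero (.inl ?_), zero_mul]
  exact div_nonpos_of_nonpos_of_nonneg (by nlinarith) hε.le

theorem shellDensity_eq_zero_of_le {ε r : ℝ} (hε : 0 < ε) (hr : r ^ 2 ≤ 1 - ε) :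
    shellDensity ε r = 0 := by
  rw [shellDensity, deriv_smoothTransition_eq_zero (.inr ?_), zero_mul]
  rw [le_div_iff₀ hε]
  linarith

theorem continuous_shellDensity (ε : ℝ) : Continuous (shellDensity ε) :=
  (continuous_deriv_smoothTransition.comp (by fun_prop)).mul (by fun_prop)

theorem integral_shellDensity {ε : ℝ} (hε : 0 < ε) (hε₁ : ε ≤ 1) :
    ∫ r in Icc (0 : ℝ) 1, shellDensity ε r = 1 := by
  have hderiv : ∀ r ∈ uIcc (0 : ℝ) 1,
      HasDerivAt (fun r => -Real.smoothTransition ((1 - r ^ 2) / ε)) (shellDensity ε r) r := by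
    intro r _
    have houter := ((Real.smoothTransition.contDiff (n := 1)).differentiable one_ne_zero
      ((1 - r ^ 2) / ε)).hasDerivAt
    have hinner := (((hasDerivAt_id r).pow 2).const_sub 1).div_const ε
    refine (houter.comp r hinner).neg.congr_deriv ?_
    simp [shellDensity]
    ring
  rw [integral_Icc_eq_integral_Ioc, ← intervalIntegral.integral_of_le zero_le_one,
    intervalIntegral.integral_eq_sub_of_hasDerivAt hderiv
      ((continuous_shellDensity ε).intervalIntegrable _ _),
    Real.smoothTransition.zero_of_nonpos (by simp),
    Real.smoothTransition.one_of_one_le (by rw [le_div_iff₀ hε]; linarith)]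
  norm_num

theorem tendsto_integral_shellDensity_mul {g : ℝ → ℝ} (hg : ContinuousOn g (Icc 0 1)) :
    Tendsto (fun ε => ∫ r in Icc (0 : ℝ) 1, shellDensity ε r * g r) (𝓝[>] 0) (𝓝 (g 1)) := by
  have hpos : ∀ᶠ ε : ℝ in 𝓝[>] 0, 0 < ε := self_mem_nhdsWithin
  have hsmall : ∀ a : ℝ, 0 < a → ∀ᶠ ε : ℝ in 𝓝[>] 0, ε < a := fun a ha =>
    mem_nhdsWithin_of_mem_nhds (Iio_mem_nhds ha)
  refine tendsto_setIntegral_peak_smul_of_integrableOn_of_tendsto measurableSet_Icc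
    measurableSet_Icc Subset.rfl self_mem_nhdsWithin measure_Icc_lt_top.ne ?_ ?_ ?_
    (.of_forall fun ε => (continuous_shellDensity ε).aestronglyMeasurable)
    (hg.integrableOn_compact isCompact_Icc) (hg 1 (right_mem_Icc.2 zero_le_one))
  · filter_upwards [hpos] with ε hε r hr
    exact mul_nonneg (deriv_smoothTransition_nonneg _)
      (div_nonneg (mul_nonneg zero_le_two hr.1) hε.le)
  · intro u hu h1u
    obtain ⟨a, ha, hau⟩ := Metric.isOpen_iff.1 hu 1 h1u
    refine Metric.tendstoUniformlyOn_iff.2 fun b hb => ?_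
    filter_upwards [hpos, hsmall a ha] with ε hε hεa r ⟨hr, hru⟩
    have hra : r ≤ 1 - a := by
      by_contra! h
      exact hru (hau (by rw [mem_ball, Real.dist_eq, abs_lt]; constructor <;> linarith [hr.2]))
    rw [shellDensity_eq_zero_of_le hε (by nlinarith [hr.1])]
    simpa using hb
  · refine tendsto_const_nhds.congr' ?_
    filter_upwards [hpos, hsmall 1 one_pos] with ε hε hε₁
    exact (integral_shellDensity hε hε₁.le).symm

section Norm

variable {E : Type*} [SeminormedAddCommGroup E] {ε : ℝ} {x : E}

theorem ballCutoff_nonneg : 0 ≤ ballCutoff ε x := Real.smoothTransition.nonneg _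

theorem ballCutoff_le_one : ballCutoff ε x ≤ 1 := Real.smoothTransition.le_one _

theorem ballCutoff_eq_zero (hε : 0 < ε) (hx : 1 ≤ ‖x‖) : ballCutoff ε x = 0 :=
  Real.smoothTransition.zero_of_nonpos
    (div_nonpos_of_nonpos_of_nonneg (by nlinarith) hε.le)

theorem ballCutoff_eq_one (hε : 0 < ε) (hx : ‖x‖ ^ 2 ≤ 1 - ε) : ballCutoff ε x = 1 :=
  Real.smoothTransition.one_of_one_le (by rw [le_div_iff₀ hε]; linarith)

theorem continuous_ballCutoff : Continuous (ballCutoff ε : E → ℝ) :=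
  Real.smoothTransition.continuous.comp (by fun_prop)

theorem tsupport_ballCutoff_subset (hε : 0 < ε) :
    tsupport (ballCutoff ε : E → ℝ) ⊆ closedBall 0 1 := by
  refine closure_minimal (fun x hx => ?_) isClosed_closedBall
  rw [mem_closedBall_zero_iff]
  by_contra! h
  exact hx (ballCutoff_eq_zero hε h.le)

end Norm

theorem integrable_of_continuousOn_isCompact {α : Type*} [TopologicalSpace α] [T2Space α]
    [MeasurableSpace α] [OpensMeasurableSpace α] {μ : Measure α} [IsFiniteMeasureOnCompacts μ]
    {K : Set α} (hK : IsCompact K) {g : α → ℝ} (hg : ContinuousOn g K)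
    (hsupp : ∀ x ∉ K, g x = 0) : Integrable g μ := by
  rw [← integrableOn_iff_integrable_of_support_subset (s := K)
    fun x hx => by_contra fun h => hx (hsupp x h)]
  exact hg.integrableOn_compact hK

variable {E : Type*} [NormedAddCommGroup E] [InnerProductSpace ℝ E]

theorem hasFDerivAt_ballCutoff (ε : ℝ) (x : E) :
    HasFDerivAt (ballCutoff ε)
      (-(deriv Real.smoothTransition ((1 - ‖x‖ ^ 2) / ε) * (2 / ε)) • innerSL ℝ x) x := by
  have houter := ((Real.smoothTransition.contDiff (n := 1)).differentiable one_ne_zero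
    ((1 - ‖x‖ ^ 2) / ε)).hasDerivAt
  have hinner : HasFDerivAt (fun x : E => (1 - ‖x‖ ^ 2) / ε)
      (ε⁻¹ • -(2 • innerSL ℝ x : E →L[ℝ] ℝ)) x := by
    simpa only [div_eq_mul_inv] using
      ((hasStrictFDerivAt_norm_sq x).hasFDerivAt.const_sub 1).mul_const ε⁻¹
  refine (houter.comp_hasFDerivAt x hinner).congr_fderiv ?_
  ext y
  simp
  ring

variable [FiniteDimensional ℝ E] [MeasurableSpace E] [BorelSpace E]
  (μ : Measure E) [μ.IsAddHaarMeasure] {f : E → ℝ} {w : E}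

theorem tendsto_integral_ballCutoff_mul {g : E → ℝ} (hg : ContinuousOn g (closedBall 0 1)) :
    Tendsto (fun ε => ∫ x, ballCutoff ε x * g x ∂μ) (𝓝[>] 0)
      (𝓝 (∫ x in ball (0 : E) 1, g x ∂μ)) := by
  have hpos : ∀ᶠ ε : ℝ in 𝓝[>] 0, 0 < ε := self_mem_nhdsWithin
  rw [← integral_indicator measurableSet_ball]
  refine tendsto_integral_filter_of_dominated_convergence
    ((closedBall (0 : E) 1).indicator fun x => |g x|) ?_ ?_ ?_ (.of_forall fun x => ?_)
  · filter_upwards [hpos] with ε hε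
    refine (integrable_of_continuousOn_isCompact (isCompact_closedBall (0 : E) 1)
      (continuous_ballCutoff.continuousOn.mul hg) fun x hx => ?_).aestronglyMeasurable
    rw [mem_closedBall_zero_iff, not_le] at hx
    exact mul_eq_zero_of_left (ballCutoff_eq_zero hε hx.le) _
  · filter_upwards [hpos] with ε hε
    refine .of_forall fun x => ?_
    rw [norm_mul, Real.norm_of_nonneg ballCutoff_nonneg, Real.norm_eq_abs]
    by_cases hx : x ∈ closedBall (0 : E) 1
    · rw [indicator_of_mem hx]
      exact mul_le_of_le_one_left (abs_nonneg _) ballCutoff_le_one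
    · rw [indicator_of_notMem hx]
      rw [mem_closedBall_zero_iff, not_le] at hx
      rw [ballCutoff_eq_zero hε hx.le, zero_mul]
  · exact (integrable_indicator_iff measurableSet_closedBall).2
      (hg.abs.integrableOn_compact (isCompact_closedBall _ _))
  · refine tendsto_const_nhds.congr' ?_
    by_cases hx : x ∈ ball (0 : E) 1
    · have hx₁ : 0 < 1 - ‖x‖ ^ 2 := by nlinarith [mem_ball_zero_iff.1 hx, norm_nonneg x]
      filter_upwards [hpos, mem_nhdsWithin_of_mem_nhds (Iio_mem_nhds hx₁)] with ε hε hεx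
      rw [indicator_of_mem hx, ballCutoff_eq_one hε (by linarith [mem_Iio.1 hεx]), one_mul]
    · filter_upwards [hpos] with ε hε
      rw [indicator_of_notMem hx, ballCutoff_eq_zero hε (by simpa using hx), zero_mul]

theorem integral_ballCutoff_mul_fderiv {ε : ℝ} (hε : 0 < ε)
    (hf : ∀ x ∈ closedBall (0 : E) 1, DifferentiableAt ℝ f x)
    (hf' : ContinuousOn (fun x => fderiv ℝ f x w) (closedBall 0 1)) :
    ∫ x, ballCutoff ε x * fderiv ℝ f x w ∂μ
      = ∫ x, deriv Real.smoothTransition ((1 - ‖x‖ ^ 2) / ε) * (2 / ε) * inner ℝ x w * f x ∂μ := by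
  have hfc : ContinuousOn f (closedBall 0 1) :=
    fun x hx => (hf x hx).continuousAt.continuousWithinAt
  have hzero : ∀ x ∉ closedBall (0 : E) 1, ballCutoff ε x = 0 := fun x hx =>
    ballCutoff_eq_zero hε (by rw [mem_closedBall_zero_iff, not_le] at hx; exact hx.le)
  have hderiv : ∀ x, fderiv ℝ (ballCutoff ε) x w
      = -(deriv Real.smoothTransition ((1 - ‖x‖ ^ 2) / ε) * (2 / ε) * inner ℝ x w) := fun x => by
    simp [(hasFDerivAt_ballCutoff ε x).fderiv]
  have hderivc : Continuous fun x : E => fderiv ℝ (ballCutoff ε) x w := by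
    simp only [hderiv]
    exact (((continuous_deriv_smoothTransition.comp (by fun_prop)).mul_const _).mul
      (by fun_prop)).neg
  have hderiv0 : ∀ x ∉ closedBall (0 : E) 1, fderiv ℝ (ballCutoff ε) x w = 0 := fun x hx => by
    rw [fderiv_of_notMem_tsupport ℝ fun h => hx (tsupport_ballCutoff_subset hε h), zero_apply]
  rw [integral_mul_fderiv_eq_neg_fderiv_mul_of_integrable
    (integrable_of_continuousOn_isCompact (isCompact_closedBall (0 : E) 1)
      (hderivc.continuousOn.mul hfc) fun x hx => by rw [hderiv0 x hx, zero_mul])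
    (integrable_of_continuousOn_isCompact (isCompact_closedBall (0 : E) 1)
      (continuous_ballCutoff.continuousOn.mul hf') fun x hx => by rw [hzero x hx, zero_mul])
    (integrable_of_continuousOn_isCompact (isCompact_closedBall (0 : E) 1)
      (continuous_ballCutoff.continuousOn.mul hfc) fun x hx => by rw [hzero x hx, zero_mul])
    (fun x _ => (hasFDerivAt_ballCutoff ε x).differentiableAt)
    (fun x hx => hf x (tsupport_ballCutoff_subset hε hx)), ← integral_neg]
  exact integral_congr_ae (.of_forall fun x => by simp only [hderiv]; ring)

theorem continuousOn_integral_sphere_mul_inner (hf : ContinuousOn f (closedBall 0 1)) (w : E) :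
    ContinuousOn (fun r : ℝ => ∫ z : sphere (0 : E) 1, f (r • (z : E)) * inner ℝ (z : E) w
      ∂μ.toSphere) (Icc 0 1) := by
  obtain ⟨M, hM⟩ := (isCompact_closedBall (0 : E) 1).exists_bound_of_continuousOn hf
  have hmem : ∀ r ∈ Icc (0 : ℝ) 1, ∀ z : sphere (0 : E) 1, r • (z : E) ∈ closedBall (0 : E) 1 :=
    fun r hr z => by simpa [norm_smul, abs_of_nonneg hr.1] using hr.2
  refine continuousOn_of_dominated (bound := fun _ => M * ‖w‖) (fun r hr => ?_)
    (fun r hr => .of_forall fun z => ?_) (integrable_const _) (.of_forall fun z => ?_)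
  · exact ((hf.comp_continuous (by fun_prop) (hmem r hr)).mul (by fun_prop)).aestronglyMeasurable
  · have hz : ‖inner ℝ (z : E) w‖ ≤ ‖w‖ := by
      simpa using norm_inner_le_norm (𝕜 := ℝ) (z : E) w
    rw [norm_mul]
    exact mul_le_mul (hM _ (hmem r hr z)) hz (norm_nonneg _)
      ((norm_nonneg _).trans (hM _ (hmem r hr z)))
  · exact (hf.comp (by fun_prop) fun r hr => hmem r hr z).mul continuousOn_const

theorem integral_ballCutoff_mul_fderiv_eq_integral_shellDensity [Nontrivial E] {ε : ℝ}
    (hε : 0 < ε) (hf : ∀ x ∈ closedBall (0 : E) 1, DifferentiableAt ℝ f x)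
    (hf' : ContinuousOn (fun x => fderiv ℝ f x w) (closedBall 0 1)) :
    ∫ x, ballCutoff ε x * fderiv ℝ f x w ∂μ
      = ∫ r in Icc (0 : ℝ) 1, shellDensity ε r * (r ^ (finrank ℝ E - 1) *
        ∫ z : sphere (0 : E) 1, f (r • (z : E)) * inner ℝ (z : E) w ∂μ.toSphere) := by
  have hfc : ContinuousOn f (closedBall 0 1) :=
    fun x hx => (hf x hx).continuousAt.continuousWithinAt
  have hint : Integrable (fun x : E =>
      deriv Real.smoothTransition ((1 - ‖x‖ ^ 2) / ε) * (2 / ε) * inner ℝ x w * f x) μ := by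
    refine integrable_of_continuousOn_isCompact (isCompact_closedBall (0 : E) 1)
      ((((continuous_deriv_smoothTransition.comp (by fun_prop)).mul_const _).mul
        (by fun_prop)).continuousOn.mul hfc) fun x hx => ?_
    rw [mem_closedBall_zero_iff, not_le] at hx
    rw [deriv_smoothTransition_eq_zero (.inl (div_nonpos_of_nonpos_of_nonneg (by nlinarith) hε.le))]
    simp only [zero_mul]
  rw [integral_ballCutoff_mul_fderiv μ hε hf hf', integral_eq_integral_Ioi_integral_sphere μ hint,
    integral_Icc_eq_integral_Ioc]
  refine Eq.trans (setIntegral_congr_fun measurableSet_Ioi fun r (hr : 0 < r) => ?_)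
    (setIntegral_eq_of_subset_of_forall_sdiff_eq_zero measurableSet_Ioi Ioc_subset_Ioi_self
      fun r hr => ?_)
  · have hnorm : ∀ z : sphere (0 : E) 1, ‖r • (z : E)‖ = r := fun z => by
      simp [norm_smul, abs_of_pos hr]
    rw [mul_left_comm, ← integral_const_mul (shellDensity ε r)]
    congr 1
    refine integral_congr_ae (.of_forall fun z => ?_)
    simp only [hnorm, shellDensity, real_inner_smul_left]
    ring
  · rw [shellDensity_eq_zero_of_one_le hε (not_lt.1 fun h => hr.2 ⟨hr.1, h.le⟩), zero_mul]

/-- The divergence theorem on the unit ball for the vector field `f • w`. -/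
theorem integral_sphere_mul_inner [Nontrivial E]
    (hf : ∀ x ∈ closedBall (0 : E) 1, DifferentiableAt ℝ f x)
    (hf' : ContinuousOn (fun x => fderiv ℝ f x w) (closedBall 0 1)) :
    ∫ z : sphere (0 : E) 1, f z * inner ℝ (z : E) w ∂μ.toSphere
      = ∫ x in ball (0 : E) 1, fderiv ℝ f x w ∂μ := by
  have hfc : ContinuousOn f (closedBall 0 1) :=
    fun x hx => (hf x hx).continuousAt.continuousWithinAt
  have hshell := tendsto_integral_shellDensity_mul (g := fun r => r ^ (finrank ℝ E - 1) *
      ∫ z : sphere (0 : E) 1, f (r • (z : E)) * inner ℝ (z : E) w ∂μ.toSphere)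
    ((continuousOn_pow _).mul (continuousOn_integral_sphere_mul_inner μ hfc w))
  simp only [one_pow, one_mul, one_smul] at hshell
  refine tendsto_nhds_unique hshell ((tendsto_integral_ballCutoff_mul μ hf').congr' ?_)
  filter_upwards [self_mem_nhdsWithin] with ε (hε : 0 < ε)
  exact integral_ballCutoff_mul_fderiv_eq_integral_shellDensity μ hε hf hf'

end BallDivergence

section SecondOrder

open Set

theorem sub_le_sub_of_hasDerivAt_le {f f' g g' : ℝ → ℝ} {a b : ℝ} (hab : a ≤ b)
    (hf : ∀ u ∈ Icc a b, HasDerivAt f (f' u) u) (hg : ∀ u ∈ Icc a b, HasDerivAt g (g' u) u)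
    (hle : ∀ u ∈ Icc a b, f' u ≤ g' u) : f b - f a ≤ g b - g a := by
  have hmono : MonotoneOn (fun u => g u - f u) (Icc a b) :=
    monotoneOn_of_hasDerivWithinAt_nonneg (f' := fun u => g' u - f' u) (convex_Icc a b)
      (fun u hu => ((hg u hu).sub (hf u hu)).continuousAt.continuousWithinAt)
      (fun u hu => ((hg u (interior_subset hu)).sub (hf u (interior_subset hu))).hasDerivWithinAt)
      (fun u hu => sub_nonneg.2 (hle u (interior_subset hu)))
  have := hmono (left_mem_Icc.2 hab) (right_mem_Icc.2 hab) hab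
  linarith

theorem mul_sq_div_two_le_of_le_deriv_deriv {φ φ' φ'' : ℝ → ℝ} {s m : ℝ} (hs : 0 ≤ s)
    (hφ : ∀ u ∈ Icc 0 s, HasDerivAt φ (φ' u) u) (hφ' : ∀ u ∈ Icc 0 s, HasDerivAt φ' (φ'' u) u)
    (hm : ∀ u ∈ Icc 0 s, m ≤ φ'' u) : m * s ^ 2 / 2 ≤ φ s - φ 0 - φ' 0 * s := by
  have hslope : ∀ u ∈ Icc 0 s, φ' 0 + m * u ≤ φ' u := fun u hu => by
    have := sub_le_sub_of_hasDerivAt_le hu.1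
      (fun w _ => by simpa using (hasDerivAt_id w).const_mul m)
      (fun w hw => hφ' w ⟨hw.1, hw.2.trans hu.2⟩) (fun w hw => hm w ⟨hw.1, hw.2.trans hu.2⟩)
    simp only [mul_zero, sub_zero] at this
    linarith
  have := sub_le_sub_of_hasDerivAt_le (f := fun u => φ' 0 * u + m / 2 * u ^ 2)
    (f' := fun u => φ' 0 + m * u) hs
    (fun u _ => (((hasDerivAt_id u).const_mul _).add
      (((hasDerivAt_id u).pow 2).const_mul _)).congr_deriv (by simp; ring)) hφ hslope
  linarith

theorem hasDerivAt_const_add_smul {E : Type*} [NormedAddCommGroup E] [NormedSpace ℝ E] (x v : E)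
    (s : ℝ) : HasDerivAt (fun s : ℝ => x + s • v) v s := by
  simpa using ((hasDerivAt_id s).smul_const v).const_add x

variable {d : ℕ} {f : Act d → ℝ} {x y v : Act d} {s : ℝ}

theorem hasDerivAt_comp_line (h : DifferentiableAt ℝ f (x + s • v)) :
    HasDerivAt (fun s : ℝ => f (x + s • v)) (inner ℝ (gradient f (x + s • v)) v) s := by
  rw [inner_gradient_left]
  exact h.hasFDerivAt.comp_hasDerivAt s (hasDerivAt_const_add_smul x v s)

theorem contDiffAt_gradient (h : ContDiffAt ℝ 2 f y) : ContDiffAt ℝ 1 (gradient f) y :=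
  (InnerProductSpace.toDual ℝ (Act d)).symm.contDiff.contDiffAt.comp y
    (h.fderiv_right (m := 1) (by norm_num))

theorem hasFDerivAt_gradient (h : ContDiffAt ℝ 2 f y) : HasFDerivAt (gradient f) (hess f y) y :=
  ((contDiffAt_gradient h).differentiableAt one_ne_zero).hasFDerivAt

theorem hasDerivAt_inner_gradient_line (h : ContDiffAt ℝ 2 f (x + s • v)) :
    HasDerivAt (fun s : ℝ => inner ℝ (gradient f (x + s • v)) v)
      (inner ℝ (hess f (x + s • v) v) v) s := by
  simpa using ((hasFDerivAt_gradient h).comp_hasDerivAt s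
    (hasDerivAt_const_add_smul x v s)).inner ℝ (hasDerivAt_const s v)

theorem inner_hess_self_eq_iteratedFDeriv (h : ContDiffAt ℝ 2 f y) (v : Act d) :
    inner ℝ (hess f y v) v = iteratedFDeriv ℝ 2 f y (fun _ => v) := by
  have hgrad : HasFDerivAt (fun y => fderiv ℝ f y v) ((innerSL ℝ v) ∘L hess f y) y := by
    simpa [Function.comp_def, inner_gradient_right]
      using (innerSL ℝ v).hasFDerivAt.comp y (hasFDerivAt_gradient h)
  have hfderiv : HasFDerivAt (fun y => fderiv ℝ f y v) ((fderiv ℝ (fderiv ℝ f) y).flip v) y := by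
    simpa using ((h.fderiv_right (m := 1) (by norm_num)).differentiableAt
      one_ne_zero).hasFDerivAt.clm_apply (hasFDerivAt_const v y)
  rw [iteratedFDeriv_two_apply]
  simpa [real_inner_comm] using congrArg (· v) (hgrad.unique hfderiv)

theorem hasDerivAt_inner_hess_line (h : ContDiffAt ℝ 3 f (x + s • v)) :
    HasDerivAt (fun s : ℝ => inner ℝ (hess f (x + s • v) v) v)
      (iteratedFDeriv ℝ 3 f (x + s • v) (fun _ => v)) s := by
  have hline := hasDerivAt_const_add_smul x v s
  have hderiv := (ContinuousMultilinearMap.apply ℝ (fun _ : Fin 2 => Act d) ℝ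
    (fun _ => v)).hasFDerivAt.comp_hasDerivAt s
      ((h.differentiableAt_iteratedFDeriv (m := 2) (by norm_num)).hasFDerivAt.comp_hasDerivAt s
        hline)
  rw [iteratedFDeriv_succ_apply_left]
  refine HasDerivAt.congr_of_eventuallyEq hderiv ?_
  filter_upwards [hline.continuousAt.eventually (h.eventually (by norm_num))] with u hu
  exact inner_hess_self_eq_iteratedFDeriv (hu.of_le (by norm_num)) v

theorem inner_hess_smul_self (f : Act d → ℝ) (x v : Act d) (c : ℝ) :
    inner ℝ (hess f x (c • v)) (c • v) = c ^ 2 * inner ℝ (hess f x v) v := by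
  rw [map_smul, real_inner_smul_left, real_inner_smul_right]
  ring

theorem half_le_bregman_of_le_hess {m : ℝ}
    (hf : ∀ s ∈ Icc (0 : ℝ) 1, ContDiffAt ℝ 2 f (x + s • (y - x)))
    (hm : ∀ s ∈ Icc (0 : ℝ) 1, m ≤ inner ℝ (hess f (x + s • (y - x)) (y - x)) (y - x)) :
    m / 2 ≤ bregman f y x := by
  simpa [bregman] using mul_sq_div_two_le_of_le_deriv_deriv zero_le_one
    (fun u hu => hasDerivAt_comp_line ((hf u hu).differentiableAt (by norm_num)))
    (fun u hu => hasDerivAt_inner_gradient_line (hf u hu)) hm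

theorem bregman_nonneg_of_hess_nonneg {X : Set (Act d)} (hX : Convex ℝ X)
    (hf : ∀ x ∈ X, ContDiffAt ℝ 2 f x) (hH : ∀ x ∈ X, ∀ v, 0 ≤ inner ℝ (hess f x v) v)
    (hx : x ∈ X) (hy : y ∈ X) : 0 ≤ bregman f y x := by
  simpa using half_le_bregman_of_le_hess (fun s hs => hf _ (hX.add_smul_sub_mem hx hy hs))
    (fun s hs => hH _ (hX.add_smul_sub_mem hx hy hs) (y - x))

theorem inner_gradient_sub_gradient (f : Act d → ℝ) (x y : Act d) :
    inner ℝ (gradient f x - gradient f y) (x - y) = bregman f x y + bregman f y x := by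
  rw [bregman, bregman, ← neg_sub x y, inner_sub_left, inner_neg_right]
  ring

theorem bregman_self (f : Act d → ℝ) (x : Act d) : bregman f x x = 0 := by simp [bregman]

theorem bregman_segment_le {l : ℝ} (hl : l ∈ Icc (0 : ℝ) 1)
    (hy : 0 ≤ bregman f y (x + l • (y - x))) (hx : 0 ≤ bregman f x (x + l • (y - x))) :
    bregman f (x + l • (y - x)) x ≤ l * bregman f y x := by
  have hy' : y - (x + l • (y - x)) = (1 - l) • (y - x) := by module
  have hx' : x - (x + l • (y - x)) = (-l) • (y - x) := by module
  simp only [bregman, hy', hx', add_sub_cancel_left, inner_smul_right] at *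
  nlinarith [mul_nonneg hl.1 hy, mul_nonneg (sub_nonneg.2 hl.2) hx]

end SecondOrder

section RealSelfConcordance

open Set Filter Topology

theorem abs_inv_sqrt_add_sub_le {f f' : ℝ → ℝ} {I : Set ℝ} (hI : Convex ℝ I)
    (hf : ∀ u ∈ I, HasDerivAt f (f' u) u) (hf₀ : ∀ u ∈ I, 0 ≤ f u)
    (hf' : ∀ u ∈ I, |f' u| ≤ 2 * f u ^ (3 / 2 : ℝ)) {ε : ℝ} (hε : 0 < ε) {p q : ℝ} (hp : p ∈ I)
    (hq : q ∈ I) : |(√(f q + ε))⁻¹ - (√(f p + ε))⁻¹| ≤ |q - p| := by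
  have hderiv : ∀ u ∈ I, HasDerivWithinAt (fun u => (√(f u + ε))⁻¹)
      (-(f' u / (2 * √(f u + ε))) / √(f u + ε) ^ 2) I u := fun u hu => by
    have hpos : 0 < f u + ε := by linarith [hf₀ u hu]
    exact ((((hf u hu).add_const ε).sqrt hpos.ne').fun_inv
      (Real.sqrt_pos.2 hpos).ne').hasDerivWithinAt
  have hbound : ∀ u ∈ I, ‖-(f' u / (2 * √(f u + ε))) / √(f u + ε) ^ 2‖ ≤ 1 := fun u hu => by
    have hpos : 0 < f u + ε := by linarith [hf₀ u hu]
    have hcube : f u ^ (3 / 2 : ℝ) ≤ √(f u + ε) ^ 3 := by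
      rw [Real.sqrt_eq_rpow, ← Real.rpow_natCast, ← Real.rpow_mul hpos.le]
      norm_num
      exact Real.rpow_le_rpow (hf₀ u hu) (by linarith) (by norm_num)
    have : 0 < √(f u + ε) := Real.sqrt_pos.2 hpos
    rw [norm_div, norm_neg, norm_div, Real.norm_eq_abs, Real.norm_of_nonneg (by positivity),
      Real.norm_of_nonneg (by positivity), div_div, div_le_one (by positivity)]
    linarith [hf' u hu]
  simpa using hI.norm_image_sub_le_of_norm_hasDerivWithin_le hderiv hbound hp hq

theorem sqrt_le_sqrt_mul_one_add {f f' : ℝ → ℝ} {I : Set ℝ} (hI : Convex ℝ I)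
    (hf : ∀ u ∈ I, HasDerivAt f (f' u) u) (hf₀ : ∀ u ∈ I, 0 ≤ f u)
    (hf' : ∀ u ∈ I, |f' u| ≤ 2 * f u ^ (3 / 2 : ℝ)) {p q : ℝ} (hp : p ∈ I) (hq : q ∈ I) :
    √(f p) ≤ √(f q) * (1 + |q - p| * √(f p)) := by
  have hreg : ∀ ε : ℝ, 0 < ε → √(f p + ε) ≤ √(f q + ε) * (1 + |q - p| * √(f p + ε)) := by
    intro ε hε
    have hp₀ : 0 < √(f p + ε) := Real.sqrt_pos.2 (by linarith [hf₀ p hp])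
    have hq₀ : 0 < √(f q + ε) := Real.sqrt_pos.2 (by linarith [hf₀ q hq])
    have hinv : (√(f q + ε))⁻¹ ≤ (√(f p + ε))⁻¹ + |q - p| := by
      linarith [(abs_le.1 (abs_inv_sqrt_add_sub_le hI hf hf₀ hf' hε hp hq)).2]
    calc √(f p + ε) = √(f q + ε) * √(f p + ε) * (√(f q + ε))⁻¹ := by field_simp
      _ ≤ √(f q + ε) * √(f p + ε) * ((√(f p + ε))⁻¹ + |q - p|) := by gcongr
      _ = √(f q + ε) * (1 + |q - p| * √(f p + ε)) := by field_simp
  have hlim : ∀ a : ℝ, Tendsto (fun ε => √(a + ε)) (𝓝[>] 0) (𝓝 √a) := fun a => by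
    simpa using ((by fun_prop : Continuous fun ε => √(a + ε)).tendsto 0).mono_left
      nhdsWithin_le_nhds
  exact le_of_tendsto_of_tendsto (hlim _)
    ((hlim _).mul (((hlim _).const_mul _).const_add 1))
    (eventually_nhdsWithin_of_forall fun ε hε => hreg ε hε)

theorem le_div_sub_of_sq_le_mul_deriv {ψ ψ' : ℝ → ℝ} {a b ν : ℝ} (hab : a < b) (hν : 0 < ν)
    (hψ : ∀ u ∈ Ico a b, HasDerivAt ψ (ψ' u) u) (hψ' : ∀ u ∈ Ico a b, ψ u ^ 2 ≤ ν * ψ' u) :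
    ψ a ≤ ν / (b - a) := by
  by_contra! hlt
  have hψa : 0 < ψ a := (div_pos hν (sub_pos.2 hab)).trans hlt
  set c := a + ν / ψ a with hc
  have hac : a < c := lt_add_of_pos_right a (div_pos hν hψa)
  have hcb : c < b := by
    rw [div_lt_comm₀ (sub_pos.2 hab) hψa] at hlt
    linarith
  have hsub : Icc a c ⊆ Ico a b := fun u hu => ⟨hu.1, hu.2.trans_lt hcb⟩
  have hmono : ∀ u ∈ Icc a c, ψ a ≤ ψ u := fun u hu => by
    have := sub_le_sub_of_hasDerivAt_le hu.1 (fun w _ => hasDerivAt_const w (0 : ℝ))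
      (fun w hw => hψ w (hsub ⟨hw.1, hw.2.trans hu.2⟩)) fun w hw =>
        nonneg_of_mul_nonneg_right
          ((sq_nonneg _).trans (hψ' w (hsub ⟨hw.1, hw.2.trans hu.2⟩))) hν
    linarith
  have hpos : ∀ u ∈ Icc a c, 0 < ψ u := fun u hu => hψa.trans_le (hmono u hu)
  have := sub_le_sub_of_hasDerivAt_le hac.le (fun u _ => (hasDerivAt_id u).div_const ν)
    (fun u hu => ((hψ u (hsub hu)).fun_inv (hpos u hu).ne').neg) fun u hu => by
      rw [neg_div, neg_neg, div_le_div_iff₀ hν (pow_pos (hpos u hu) 2)]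
      linarith [hψ' u (hsub hu)]
  have hc' : c / ν - a / ν = (ψ a)⁻¹ := by rw [hc]; field_simp; ring
  simp only [Pi.neg_apply, id, hc'] at this
  linarith [inv_pos.2 (hpos c (right_mem_Icc.2 hac.le))]

theorem exists_first_exit {E : Type*} [NormedAddCommGroup E] [NormedSpace ℝ E] {U : Set E}
    (hU : IsOpen U) {x v : E} (hx : x ∈ U) (hv : x + v ∉ U) :
    ∃ t ∈ Ioc (0 : ℝ) 1, x + t • v ∉ U ∧ ∀ u ∈ Ico 0 t, x + u • v ∈ U := by
  set S : Set ℝ := Icc 0 1 ∩ (fun s : ℝ => x + s • v) ⁻¹' Uᶜ with hS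
  have hSclosed : IsClosed S := isClosed_Icc.inter (hU.isClosed_compl.preimage (by fun_prop))
  have hSbdd : BddBelow S := ⟨0, fun s hs => hs.1.1⟩
  have hmem : sInf S ∈ S := hSclosed.csInf_mem ⟨1, by simpa [hS] using hv⟩ hSbdd
  refine ⟨sInf S, ⟨hmem.1.1.lt_of_ne fun h => hmem.2 ?_, hmem.1.2⟩, hmem.2, fun u hu => ?_⟩
  · simpa [← h] using hx
  · by_contra hu'
    exact (csInf_le hSbdd ⟨⟨hu.1, hu.2.le.trans hmem.1.2⟩, hu'⟩).not_gt hu.2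

end RealSelfConcordance

namespace IsSelfConcordantBarrier

open Set Filter Topology

variable {d : ℕ} {ν B : ℝ} {X : Set (Act d)} {h : Act d → ℝ} {x y v : Act d}

theorem contDiffAt (hb : IsSelfConcordantBarrier ν X h) (hx : x ∈ interior X) :
    ContDiffAt ℝ 3 h x := hb.contDiffOn.contDiffAt (isOpen_interior.mem_nhds hx)

theorem contDiffAt_two (hb : IsSelfConcordantBarrier ν X h) (hx : x ∈ interior X) :
    ContDiffAt ℝ 2 h x := (hb.contDiffAt hx).of_le (by norm_num)

theorem isClosed_sublevel (hb : IsSelfConcordantBarrier ν X h) (M : ℝ) :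
    IsClosed {x | x ∈ interior X ∧ h x ≤ M} := by
  refine isClosed_of_closure_subset fun b hb_mem => ?_
  have := mem_closure_iff_nhdsWithin_neBot.1 hb_mem
  have hle : ∀ᶠ x in 𝓝[{x | x ∈ interior X ∧ h x ≤ M}] b, h x ≤ M :=
    eventually_nhdsWithin_of_forall fun x hx => hx.2
  by_cases hbi : b ∈ interior X
  · exact ⟨hbi, le_of_tendsto ((hb.contDiffAt hbi).continuousAt.tendsto.mono_left
      nhdsWithin_le_nhds) hle⟩
  · have hfr : b ∈ frontier X := ⟨closure_mono (fun x hx => interior_subset hx.1) hb_mem, hbi⟩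
    obtain ⟨x, hx_gt, hx_le⟩ := ((((hb.barrier b hfr).mono_left
      (nhdsWithin_mono _ fun x hx => hx.1)).eventually_gt_atTop M).and hle).exists
    exact absurd hx_le hx_gt.not_ge

theorem isCompact_sublevel (hb : IsSelfConcordantBarrier ν X h) (hX : IsCompact X) (M : ℝ) :
    IsCompact {x | x ∈ interior X ∧ h x ≤ M} :=
  hX.of_isClosed_subset (hb.isClosed_sublevel M) fun _ hx => interior_subset hx.1

theorem sqrt_inner_hess_le (hb : IsSelfConcordantBarrier ν X h) {I : Set ℝ} (hI : Convex ℝ I)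
    (hx : ∀ u ∈ I, x + u • v ∈ interior X) {p q : ℝ} (hp : p ∈ I) (hq : q ∈ I) :
    √(inner ℝ (hess h (x + p • v) v) v) ≤ √(inner ℝ (hess h (x + q • v) v) v) *
      (1 + |q - p| * √(inner ℝ (hess h (x + p • v) v) v)) :=
  sqrt_le_sqrt_mul_one_add (f := fun u => inner ℝ (hess h (x + u • v) v) v) hI
    (fun u hu => hasDerivAt_inner_hess_line (hb.contDiffAt (hx u hu)))
    (fun u hu => hb.hess_nonneg _ (hx u hu) v) (fun u hu => hb.third_deriv _ (hx u hu) v) hp hq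

theorem inner_hess_le_of_lt_one (hb : IsSelfConcordantBarrier ν X h) {s : ℝ}
    (hs : s ∈ Icc (0 : ℝ) 1) (hx : ∀ u ∈ Icc 0 s, x + u • v ∈ interior X)
    (hv : inner ℝ (hess h x v) v < 1) :
    inner ℝ (hess h (x + s • v) v) v
      ≤ (√(inner ℝ (hess h x v) v) / (1 - √(inner ℝ (hess h x v) v))) ^ 2 := by
  have hcomp := hb.sqrt_inner_hess_le (convex_Icc 0 s) hx (right_mem_Icc.2 hs.1)
    (left_mem_Icc.2 hs.1)
  rw [zero_smul, add_zero, zero_sub, abs_neg, abs_of_nonneg hs.1] at hcomp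
  have hr : √(inner ℝ (hess h x v) v) < 1 := by simpa [Real.sqrt_lt'] using hv
  set r := √(inner ℝ (hess h x v) v)
  set a := inner ℝ (hess h (x + s • v) v) v
  have ha₀ : 0 ≤ a := hb.hess_nonneg _ (hx s (right_mem_Icc.2 hs.1)) v
  have hle : √a ≤ r / (1 - r) := by
    rw [le_div_iff₀ (sub_pos.2 hr)]
    nlinarith [mul_le_of_le_one_left (Real.sqrt_nonneg a) hs.2, Real.sqrt_nonneg a,
      mul_le_mul_of_nonneg_left (mul_le_of_le_one_left (Real.sqrt_nonneg a) hs.2)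
        (Real.sqrt_nonneg (inner ℝ (hess h x v) v))]
  calc a = √a ^ 2 := (Real.sq_sqrt ha₀).symm
    _ ≤ (r / (1 - r)) ^ 2 := by gcongr

theorem le_add_of_inner_hess_lt_one (hb : IsSelfConcordantBarrier ν X h) {s : ℝ}
    (hs : s ∈ Icc (0 : ℝ) 1) (hx : ∀ u ∈ Icc 0 s, x + u • v ∈ interior X)
    (hv : inner ℝ (hess h x v) v < 1) :
    h (x + s • v) ≤ h x + |inner ℝ (gradient h x) v|
      + (√(inner ℝ (hess h x v) v) / (1 - √(inner ℝ (hess h x v) v))) ^ 2 := by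
  set C := (√(inner ℝ (hess h x v) v) / (1 - √(inner ℝ (hess h x v) v))) ^ 2
  have htaylor := mul_sq_div_two_le_of_le_deriv_deriv (φ := fun s : ℝ => -h (x + s • v))
    (m := -C) hs.1
    (fun u hu => (hasDerivAt_comp_line
      ((hb.contDiffAt (hx u hu)).differentiableAt (by norm_num))).neg)
    (fun u hu => (hasDerivAt_inner_gradient_line (hb.contDiffAt_two (hx u hu))).neg)
    (fun u hu => neg_le_neg (hb.inner_hess_le_of_lt_one ⟨hu.1, hu.2.trans hs.2⟩
      (fun w hw => hx w ⟨hw.1, hw.2.trans hu.2⟩) hv))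
  simp only [zero_smul, add_zero] at htaylor
  have hgrad : inner ℝ (gradient h x) v * s ≤ |inner ℝ (gradient h x) v| :=
    (mul_le_mul_of_nonneg_right (le_abs_self _) hs.1).trans
      (mul_le_of_le_one_right (abs_nonneg _) hs.2)
  have hC : 0 ≤ C := sq_nonneg _
  have hquad : C * s ^ 2 ≤ C := mul_le_of_le_one_right hC (pow_le_one₀ hs.1 hs.2)
  linarith

/-- Dikin's theorem on the unit ball of the local norm. -/
theorem add_mem_interior (hb : IsSelfConcordantBarrier ν X h) (hx : x ∈ interior X)
    (hv : inner ℝ (hess h x v) v < 1) : x + v ∈ interior X := by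
  by_contra hnot
  obtain ⟨t, ht, hexit, hin⟩ := exists_first_exit isOpen_interior hx hnot
  have hclosed := (hb.isClosed_sublevel (h x + |inner ℝ (gradient h x) v|
    + (√(inner ℝ (hess h x v) v) / (1 - √(inner ℝ (hess h x v) v))) ^ 2)).preimage
      (by fun_prop : Continuous fun s : ℝ => x + s • v)
  have hsub := hclosed.closure_subset_iff.2 fun s (hs : s ∈ Ico 0 t) =>
    ⟨hin s hs, hb.le_add_of_inner_hess_lt_one ⟨hs.1, hs.2.le.trans ht.2⟩
      (fun u hu => hin u ⟨hu.1, hu.2.trans_lt hs.2⟩) hv⟩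
  rw [closure_Ico ht.1.ne] at hsub
  exact hexit (hsub (right_mem_Icc.2 ht.1.le)).1

theorem add_mem_of_inner_hess_le_one (hb : IsSelfConcordantBarrier ν X h) (hX : IsClosed X)
    (hx : x ∈ interior X) (hv : inner ℝ (hess h x v) v ≤ 1) : x + v ∈ X := by
  have hsub := (hX.preimage (by fun_prop : Continuous fun s : ℝ => x + s • v)).closure_subset_iff.2
    fun l (hl : l ∈ Ico (0 : ℝ) 1) => show x + l • v ∈ X from
      interior_subset (hb.add_mem_interior hx (by
        rw [inner_hess_smul_self]; nlinarith [hl.1, hl.2, hb.hess_nonneg x hx v]))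
  rw [closure_Ico zero_ne_one] at hsub
  simpa using hsub (right_mem_Icc.2 zero_le_one)

theorem norm_sq_le (hb : IsSelfConcordantBarrier ν X h)
    (hB : ∀ y ∈ X, ∀ y' ∈ X, ‖y - y'‖ ≤ B) (hB₀ : 0 < B) (hx : x ∈ interior X) (v : Act d) :
    ‖v‖ ^ 2 ≤ B ^ 2 * inner ℝ (hess h x v) v := by
  by_contra! hlt
  obtain ⟨m, hm, hmv⟩ := exists_between hlt
  have hm₀ : 0 < m := (mul_nonneg (sq_nonneg B) (hb.hess_nonneg x hx v)).trans_lt hm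
  have hsq : (B / √m) ^ 2 = B ^ 2 / m := by rw [div_pow, Real.sq_sqrt hm₀.le]
  have hmem : x + (B / √m) • v ∈ interior X := by
    refine hb.add_mem_interior hx ?_
    rwa [inner_hess_smul_self, hsq, div_mul_eq_mul_div, div_lt_one hm₀]
  have hdiam := pow_le_pow_left₀ (norm_nonneg _)
    (hB _ (interior_subset hmem) _ (interior_subset hx)) 2
  rw [add_sub_cancel_left, norm_smul, mul_pow, Real.norm_eq_abs, sq_abs, hsq,
    div_mul_eq_mul_div, div_le_iff₀ hm₀] at hdiam
  exact hmv.not_ge (le_of_mul_le_mul_left hdiam (by positivity))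

theorem bregman_nonneg (hb : IsSelfConcordantBarrier ν X h) (hX : Convex ℝ X)
    (hx : x ∈ interior X) (hy : y ∈ interior X) : 0 ≤ bregman h y x :=
  bregman_nonneg_of_hess_nonneg hX.interior (fun _ => hb.contDiffAt_two) hb.hess_nonneg hx hy

theorem inner_hess_div_eight_le_bregman (hb : IsSelfConcordantBarrier ν X h) (hX : Convex ℝ X)
    (hx : x ∈ interior X) (hy : y ∈ interior X)
    (hr : inner ℝ (hess h x (y - x)) (y - x) ≤ 1) :
    inner ℝ (hess h x (y - x)) (y - x) / 8 ≤ bregman h y x := by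
  have hseg : ∀ s ∈ Icc (0 : ℝ) 1, x + s • (y - x) ∈ interior X :=
    fun s hs => hX.interior.add_smul_sub_mem hx hy hs
  have hquarter : ∀ s ∈ Icc (0 : ℝ) 1, inner ℝ (hess h x (y - x)) (y - x) / 4
      ≤ inner ℝ (hess h (x + s • (y - x)) (y - x)) (y - x) := fun s hs => by
    have hcomp := hb.sqrt_inner_hess_le (convex_Icc 0 1) hseg (left_mem_Icc.2 zero_le_one) hs
    rw [zero_smul, add_zero, sub_zero, abs_of_nonneg hs.1] at hcomp
    have hr' : √(inner ℝ (hess h x (y - x)) (y - x)) ≤ 1 := Real.sqrt_le_one.2 hr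
    have hfactor : 1 + s * √(inner ℝ (hess h x (y - x)) (y - x)) ≤ 2 := by
      linarith [mul_le_one₀ hs.2 (Real.sqrt_nonneg _) hr']
    have hhalf := hcomp.trans (mul_le_mul_of_nonneg_left hfactor (Real.sqrt_nonneg _))
    have := pow_le_pow_left₀ (Real.sqrt_nonneg _) hhalf 2
    rw [mul_pow, Real.sq_sqrt (hb.hess_nonneg x hx _),
      Real.sq_sqrt (hb.hess_nonneg _ (hseg s hs) _)] at this
    linarith
  linarith [half_le_bregman_of_le_hess (fun s hs => hb.contDiffAt_two (hseg s hs)) hquarter]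

theorem sqrt_inner_hess_div_eight_le_bregman (hb : IsSelfConcordantBarrier ν X h)
    (hX : Convex ℝ X) (hx : x ∈ interior X) (hy : y ∈ interior X)
    (hr : 1 ≤ inner ℝ (hess h x (y - x)) (y - x)) :
    √(inner ℝ (hess h x (y - x)) (y - x)) / 8 ≤ bregman h y x := by
  set r := √(inner ℝ (hess h x (y - x)) (y - x))
  have hr₁ : 1 ≤ r := Real.one_le_sqrt.2 hr
  have hl : r⁻¹ ∈ Icc (0 : ℝ) 1 := ⟨by positivity, inv_le_one_of_one_le₀ hr₁⟩
  have hmem := hX.interior.add_smul_sub_mem hx hy hl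
  have hunit : inner ℝ (hess h x (x + r⁻¹ • (y - x) - x)) (x + r⁻¹ • (y - x) - x) = 1 := by
    rw [add_sub_cancel_left, inner_hess_smul_self, ← Real.sq_sqrt (zero_le_one.trans hr),
      ← mul_pow, inv_mul_cancel₀ (by positivity), one_pow]
  have heighth : 1 / 8 ≤ r⁻¹ * bregman h y x := by
    rw [← hunit]
    exact (hb.inner_hess_div_eight_le_bregman hX hx hmem hunit.le).trans
      (bregman_segment_le hl (hb.bregman_nonneg hX hmem hy) (hb.bregman_nonneg hX hmem hx))
  rw [inv_mul_eq_div, le_div_iff₀ (by positivity)] at heighth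
  linarith

theorem bregman_pos (hb : IsSelfConcordantBarrier ν X h) (hX : Convex ℝ X)
    (hB : ∀ y ∈ X, ∀ y' ∈ X, ‖y - y'‖ ≤ B) (hB₀ : 0 < B) (hx : x ∈ interior X)
    (hy : y ∈ interior X) (hne : y ≠ x) : 0 < bregman h y x := by
  have hnorm : 0 < ‖y - x‖ := norm_pos_iff.2 (sub_ne_zero.2 hne)
  have hpos : 0 < inner ℝ (hess h x (y - x)) (y - x) := pos_of_mul_pos_right
    ((pow_pos hnorm 2).trans_le (hb.norm_sq_le hB hB₀ hx (y - x))) (sq_nonneg B)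
  rcases le_total (inner ℝ (hess h x (y - x)) (y - x)) 1 with hr | hr
  · exact lt_of_lt_of_le (by positivity) (hb.inner_hess_div_eight_le_bregman hX hx hy hr)
  · exact lt_of_lt_of_le (by positivity) (hb.sqrt_inner_hess_div_eight_le_bregman hX hx hy hr)

theorem nu_pos (hb : IsSelfConcordantBarrier ν X h) (hX : Convex ℝ X) (hXc : IsCompact X)
    (hd : 1 ≤ d) (hi : (interior X).Nonempty) : 0 < ν := by
  by_contra! hν
  obtain ⟨x, hx⟩ := hi
  have hgrad : ∀ y ∈ interior X, gradient h y = 0 := fun y hy => by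
    have := hb.first_deriv y hy (gradient h y)
    rw [Real.sqrt_eq_zero_of_nonpos hν, zero_mul, abs_nonpos_iff] at this
    exact inner_self_eq_zero.1 this
  have hle : ∀ y ∈ interior X, h y ≤ h x := fun y hy => by
    have := hb.bregman_nonneg hX hy hx
    rw [bregman, hgrad y hy, inner_zero_left] at this
    linarith
  obtain ⟨b, hb_mem⟩ : (frontier X).Nonempty := by
    have : Nonempty (Fin d) := ⟨⟨0, hd⟩⟩
    exact nonempty_frontier_iff.2 ⟨⟨x, interior_subset hx⟩, fun h => noncompact_univ _ (h ▸ hXc)⟩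
  have : (𝓝[interior X] b).NeBot := by
    rw [← mem_closure_iff_nhdsWithin_neBot,
      hX.closure_interior_eq_closure_of_nonempty_interior ⟨x, hx⟩]
    exact hb_mem.1
  obtain ⟨y, hy_gt, hy⟩ := (((hb.barrier b hb_mem).eventually_gt_atTop (h x)).and
    self_mem_nhdsWithin).exists
  exact (hle y hy).not_gt hy_gt

theorem add_smul_sub_mem_interior (hX : Convex ℝ X) (hx : x ∈ interior X) (hy : y ∈ X) {u : ℝ}
    (hu : u ∈ Ico (0 : ℝ) 1) : x + u • (y - x) ∈ interior X := by
  convert hX.combo_interior_self_mem_interior hx hy (sub_pos.2 hu.2) hu.1 (by ring) using 1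
  module

theorem inner_gradient_le (hb : IsSelfConcordantBarrier ν X h) (hX : Convex ℝ X) (hν : 0 < ν)
    (hx : x ∈ interior X) (hy : y ∈ X) : inner ℝ (gradient h x) (y - x) ≤ ν := by
  have hmem : ∀ u ∈ Ico (0 : ℝ) 1, x + u • (y - x) ∈ interior X :=
    fun u hu => add_smul_sub_mem_interior hX hx hy hu
  simpa using le_div_sub_of_sq_le_mul_deriv zero_lt_one hν
    (fun u hu => hasDerivAt_inner_gradient_line (hb.contDiffAt_two (hmem u hu))) fun u hu => by
      have := pow_le_pow_left₀ (abs_nonneg _) (hb.first_deriv _ (hmem u hu) (y - x)) 2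
      rwa [sq_abs, mul_pow, Real.sq_sqrt hν.le,
        Real.sq_sqrt (hb.hess_nonneg _ (hmem u hu) _)] at this

theorem le_sub_mul_log (hb : IsSelfConcordantBarrier ν X h) (hX : Convex ℝ X) (hν : 0 < ν)
    (hx : x ∈ interior X) (hy : y ∈ X) {s : ℝ} (hs : s ∈ Ico (0 : ℝ) 1) :
    h (x + s • (y - x)) ≤ h x - ν * Real.log (1 - s) := by
  have hlt : ∀ u ∈ Icc 0 s, 0 < 1 - u := fun u hu => sub_pos.2 (hu.2.trans_lt hs.2)
  have hmem : ∀ u ∈ Icc 0 s, x + u • (y - x) ∈ interior X :=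
    fun u hu => add_smul_sub_mem_interior hX hx hy ⟨hu.1, hu.2.trans_lt hs.2⟩
  have := sub_le_sub_of_hasDerivAt_le hs.1
    (fun u hu => hasDerivAt_comp_line ((hb.contDiffAt (hmem u hu)).differentiableAt (by norm_num)))
    (fun u hu => (((hasDerivAt_id u).const_sub 1).log (hlt u hu).ne').const_mul (-ν))
    fun u hu => by
      have hgrad := hb.inner_gradient_le hX hν (hmem u hu) hy
      rw [show y - (x + u • (y - x)) = (1 - u) • (y - x) by module, real_inner_smul_right] at hgrad
      rwa [mul_div_assoc', neg_mul_neg, mul_one, id, le_div_iff₀ (hlt u hu), mul_comm]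
  simp only [id, zero_smul, add_zero, sub_zero, Real.log_one, mul_zero] at this
  linarith

end IsSelfConcordantBarrier

section InverseSquareRoot

open Set

variable {E : Type*} [NormedAddCommGroup E] [InnerProductSpace ℝ E]
  {A M S T : E →L[ℝ] E}

theorem eigenvalue_sub_eq_zero_of_sq_eq (hS : S.IsPositive) (hT : T.IsPositive)
    (h : S * S = T * T) {v : E} {l : ℝ} (hv₀ : v ≠ 0) (hv : S v - T v = l • v) : l = 0 := by
  have hS₀ : 0 ≤ inner ℝ (S v) v := hS.inner_nonneg_left v
  have hT₀ : 0 ≤ inner ℝ (T v) v := hT.inner_nonneg_left v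
  have hsq : inner ℝ (S v) (S v) = inner ℝ (T v) (T v) := by
    rw [hS.isSymmetric.apply_clm, hT.isSymmetric.apply_clm]
    exact congr(inner ℝ v ($h v))
  have hprod : l * (inner ℝ (S v) v + inner ℝ (T v) v) = 0 := by
    have : inner ℝ (S v - T v) (S v + T v) = (0 : ℝ) := by
      rw [inner_sub_left, inner_add_right, inner_add_right, hsq, real_inner_comm (S v) (T v)]
      ring
    rwa [hv, real_inner_smul_left, inner_add_right, real_inner_comm, real_inner_comm (T v)] at this
  refine (mul_eq_zero.1 hprod).elim id fun hsum => ?_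
  have hdiff : l * ‖v‖ ^ 2 = inner ℝ (S v) v - inner ℝ (T v) v := by
    rw [← real_inner_self_eq_norm_sq, ← real_inner_smul_left, ← hv, inner_sub_left]
  exact (mul_eq_zero.1 (hdiff.trans (by linarith))).resolve_right (by simpa using hv₀)

/-- `A` is the inverse square root `M ^ (-1/2)` of the operator `M`, encoded without a functional
calculus: `A` is positive semidefinite and `A² M = 1`. -/
structure IsInvSqrt (A M : E →L[ℝ] E) : Prop where
  isPositive : A.IsPositive
  mul_mul_eq_one : A * A * M = 1

theorem IsInvSqrt.mul_eq_one (h : IsInvSqrt A M) : A * (A * M) = 1 := by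
  rw [← mul_assoc, h.mul_mul_eq_one]

variable [FiniteDimensional ℝ E]

theorem clm_mul_eq_one_comm : S * T = 1 ↔ T * S = 1 := by
  have := IsArtinianRing.of_finite ℝ (E →L[ℝ] E)
  exact mul_eq_one_comm

namespace IsInvSqrt

theorem mul_eq_one' (h : IsInvSqrt A M) : A * M * A = 1 := clm_mul_eq_one_comm.1 h.mul_eq_one

theorem isUnit (h : IsInvSqrt A M) : IsUnit A := (Units.mk A _ h.mul_eq_one h.mul_eq_one').isUnit

theorem inverse_eq (h : IsInvSqrt A M) : A.inverse = A * M :=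
  ContinuousLinearMap.inverse_eq h.mul_eq_one h.mul_eq_one'

theorem ringInverse_mul_self (h : IsInvSqrt A M) : Ring.inverse A * Ring.inverse A = M := by
  have hinv : Ring.inverse A = A * M := Ring.inverse_unit ⟨A, _, h.mul_eq_one, h.mul_eq_one'⟩
  rw [hinv, ← mul_assoc, h.mul_eq_one', one_mul]

theorem apply_inverse (h : IsInvSqrt A M) (v : E) : A (A.inverse v) = v := by
  rw [h.inverse_eq]
  exact congr($h.mul_eq_one v)

theorem inverse_apply (h : IsInvSqrt A M) (v : E) : A.inverse (A v) = v := by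
  rw [h.inverse_eq]
  exact congr($h.mul_eq_one' v)

theorem inner_inverse_left (h : IsInvSqrt A M) (z v : E) :
    inner ℝ (A.inverse z) v = inner ℝ z (A.inverse v) := by
  nth_rw 1 [← h.apply_inverse v]
  rw [← h.isPositive.isSymmetric.apply_clm, h.apply_inverse]

theorem norm_inverse_sq (h : IsInvSqrt A M) (v : E) : ‖A.inverse v‖ ^ 2 = inner ℝ (M v) v := by
  rw [← real_inner_self_eq_norm_sq, h.inner_inverse_left, real_inner_comm]
  nth_rw 2 [h.inverse_eq]
  exact congr(inner ℝ $(h.inverse_apply (M v)) v)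

theorem inner_apply_self (h : IsInvSqrt A M) (z : E) : inner ℝ (M (A z)) (A z) = ‖z‖ ^ 2 := by
  rw [← h.norm_inverse_sq, h.inverse_apply]

end IsInvSqrt

theorem eq_of_isPositive_of_sq_eq (hS : S.IsPositive) (hT : T.IsPositive) (h : S * S = T * T) :
    S = T := by
  have hsymm : ((S - T : E →L[ℝ] E) : E →ₗ[ℝ] E).IsSymmetric :=
    hS.isSymmetric.sub hT.isSymmetric
  refine sub_eq_zero.1 (ContinuousLinearMap.coe_injective
    ((hsymm.eigenvectorBasis rfl).toBasis.ext fun i => ?_))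
  have heigen := hsymm.apply_eigenvectorBasis rfl i
  rw [OrthonormalBasis.coe_toBasis, heigen, eigenvalue_sub_eq_zero_of_sq_eq hS hT h
    ((hsymm.eigenvectorBasis rfl).orthonormal.ne_zero i) heigen]
  simp

theorem isClosed_setOf_isPositive : IsClosed {T : E →L[ℝ] E | T.IsPositive} := by
  simp only [ContinuousLinearMap.isPositive_def', ContinuousLinearMap.isSelfAdjoint_iff',
    ofPred_and, ofPred_forall]
  exact (isClosed_eq (by fun_prop) (by fun_prop)).inter
    (isClosed_iInter fun x => isClosed_le (by fun_prop)
      (by simp only [ContinuousLinearMap.reApplyInnerSelf_apply, RCLike.re_to_real]; fun_prop))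

theorem injOn_ringInverse_mul_self :
    InjOn (fun T : E →L[ℝ] E => Ring.inverse T * Ring.inverse T)
      ({T | T.IsPositive} ∩ {T | IsUnit T}) := by
  rintro S ⟨hS, u, rfl⟩ T ⟨hT, w, rfl⟩ hST
  simp only [Ring.inverse_unit] at hST
  have hinv : u⁻¹ * u⁻¹ = w⁻¹ * w⁻¹ := Units.ext hST
  rw [← mul_inv_rev, ← mul_inv_rev, inv_inj] at hinv
  exact eq_of_isPositive_of_sq_eq hS hT congr(($hinv : E →L[ℝ] E))

/-- By the Lusin–Souslin theorem the inverse of `T ↦ T⁻²` on the invertible positive operators is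
measurable. -/
theorem IsInvSqrt.measurable {Ω : Type*} [MeasurableSpace Ω] {A M : Ω → E →L[ℝ] E}
    (h : ∀ ω, IsInvSqrt (A ω) (M ω)) (hM : Measurable M) : Measurable A := by
  have hcont : ContinuousOn (fun T : E →L[ℝ] E => Ring.inverse T * Ring.inverse T)
      ({T | T.IsPositive} ∩ {T | IsUnit T}) := by
    rintro T ⟨-, u, rfl⟩
    exact ((NormedRing.inverse_continuousAt u).mul
      (NormedRing.inverse_continuousAt u)).continuousWithinAt
  have hemb := hcont.measurableEmbedding
    (isClosed_setOf_isPositive.measurableSet.inter Units.isOpen.measurableSet)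
    injOn_ringInverse_mul_self
  suffices Measurable fun ω => (⟨A ω, (h ω).isPositive, (h ω).isUnit⟩ :
      ({T | T.IsPositive} ∩ {T | IsUnit T} : Set (E →L[ℝ] E))) from
    measurable_subtype_coe.comp this
  rw [← hemb.measurable_comp_iff]
  convert hM using 1
  ext1 ω
  exact (h ω).ringInverse_mul_self

end InverseSquareRoot

section SmoothConvex

open Set Filter Topology

variable {d : ℕ} {X : Set (Act d)} {p : Act d → ℝ} {x y : Act d}

theorem continuousOn_hess (hp : ∀ x ∈ X, ContDiffAt ℝ 2 p x) : ContinuousOn (hess p) X :=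
  fun x hx => ((contDiffAt_gradient (hp x hx)).fderiv_right (m := 0)
    (by norm_num)).continuousAt.continuousWithinAt

theorem continuousOn_gradient (hp : ∀ x ∈ X, ContDiffAt ℝ 2 p x) : ContinuousOn (gradient p) X :=
  fun x hx => (contDiffAt_gradient (hp x hx)).continuousAt.continuousWithinAt

theorem exists_norm_hess_sub_le (hXc : IsCompact X) (hp : ∀ x ∈ X, ContDiffAt ℝ 2 p x) {ε : ℝ}
    (hε : 0 < ε) : ∃ ρ > 0, ∀ x ∈ X, ∀ y ∈ X, ‖y - x‖ < ρ → ‖hess p y - hess p x‖ ≤ ε := by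
  obtain ⟨ρ, hρ, hu⟩ := Metric.uniformContinuousOn_iff.1
    (hXc.uniformContinuousOn_of_continuous (continuousOn_hess hp)) ε hε
  simp only [dist_eq_norm] at hu
  exact ⟨ρ, hρ, fun x hx y hy hxy => (hu y hy x hx hxy).le⟩

theorem norm_add_smul_sub_sub_lt {E : Type*} [NormedAddCommGroup E] [NormedSpace ℝ E] {x y : E}
    {ρ s : ℝ} (h : ‖y - x‖ < ρ) (hs : s ∈ Icc (0 : ℝ) 1) : ‖x + s • (y - x) - x‖ < ρ := by
  rw [add_sub_cancel_left, norm_smul, Real.norm_of_nonneg hs.1]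
  exact (mul_le_of_le_one_left (norm_nonneg _) hs.2).trans_lt h

theorem half_inner_hess_sub_le_bregman (hX : Convex ℝ X) (hp : ∀ x ∈ X, ContDiffAt ℝ 2 p x)
    {ε ρ : ℝ} (hρ : ∀ x ∈ X, ∀ y ∈ X, ‖y - x‖ < ρ → ‖hess p y - hess p x‖ ≤ ε) (hx : x ∈ X)
    (hy : y ∈ X) (hxy : ‖y - x‖ < ρ) :
    (inner ℝ (hess p x (y - x)) (y - x) - ε * ‖y - x‖ ^ 2) / 2 ≤ bregman p y x := by
  refine half_le_bregman_of_le_hess (fun s hs => hp _ (hX.add_smul_sub_mem hx hy hs))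
    fun s hs => ?_
  have hclose := hρ x hx _ (hX.add_smul_sub_mem hx hy hs) (norm_add_smul_sub_sub_lt hxy hs)
  set L := hess p (x + s • (y - x)) - hess p x with hL
  have hform : |inner ℝ (L (y - x)) (y - x)| ≤ ε * ‖y - x‖ ^ 2 :=
    calc |inner ℝ (L (y - x)) (y - x)| ≤ ‖L (y - x)‖ * ‖y - x‖ := abs_real_inner_le_norm _ _
      _ ≤ ε * ‖y - x‖ * ‖y - x‖ := by gcongr; exact L.le_of_opNorm_le hclose _
      _ = ε * ‖y - x‖ ^ 2 := by ring
  rw [hL, sub_apply, inner_sub_left] at hform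
  linarith [(abs_le.1 hform).1]

theorem norm_gradient_sub_sub_hess_le (hX : Convex ℝ X) (hp : ∀ x ∈ X, ContDiffAt ℝ 2 p x)
    {ε ρ : ℝ} (hρ : ∀ x ∈ X, ∀ y ∈ X, ‖y - x‖ < ρ → ‖hess p y - hess p x‖ ≤ ε) (hx : x ∈ X)
    (hy : y ∈ X) (hxy : ‖y - x‖ < ρ) :
    ‖gradient p y - gradient p x - hess p x (y - x)‖ ≤ ε * ‖y - x‖ := by
  refine (convex_segment x y).norm_image_sub_le_of_norm_hasFDerivWithin_le' (f' := hess p)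
    (fun w hw => (hasFDerivAt_gradient (hp w (hX.segment_subset hx hy hw))).hasFDerivWithinAt)
    (fun w hw => ?_) (left_mem_segment ℝ x y) (right_mem_segment ℝ x y)
  rw [segment_eq_image'] at hw
  obtain ⟨s, hs, rfl⟩ := hw
  exact hρ x hx _ (hX.add_smul_sub_mem hx hy hs) (norm_add_smul_sub_sub_lt hxy hs)

end SmoothConvex

section MirrorStep

open Set

variable {d : ℕ} {h p : Act d → ℝ} {x y g : Act d} {η σ : ℝ}

theorem hasGradientAt_bregman (hf : DifferentiableAt ℝ h y) (x : Act d) :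
    HasGradientAt (fun w => bregman h w x) (gradient h y - gradient h x) y := by
  rw [hasGradientAt_iff_hasFDerivAt, map_sub]
  exact (hf.hasGradientAt.hasFDerivAt.sub_const (h x)).sub
    ((InnerProductSpace.toDual ℝ (Act d) (gradient h x)).hasFDerivAt.comp y
      ((hasFDerivAt_id y).sub_const x))

theorem mirror_step_optimality {U : Set (Act d)} (hU : IsOpen U) (hy : y ∈ U)
    (hh : DifferentiableAt ℝ h y) (hp : DifferentiableAt ℝ p y)
    (hmin : IsMinOn (fun w => η * inner ℝ w g + σ * bregman p w x + bregman h w x) U y) :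
    η • g + σ • (gradient p y - gradient p x) + (gradient h y - gradient h x) = 0 := by
  have hlin : HasGradientAt (fun w : Act d => inner ℝ w g) g y := by
    simp only [real_inner_comm]
    exact (InnerProductSpace.toDual ℝ (Act d) g).hasFDerivAt
  have hfderiv := (hmin.isLocalMin (hU.mem_nhds hy)).hasFDerivAt_eq_zero
    (((hlin.hasFDerivAt.const_mul η).add
      ((hasGradientAt_bregman hp x).hasFDerivAt.const_mul σ)).add
        (hasGradientAt_bregman hh x).hasFDerivAt)
  rwa [← map_smul, ← map_smul, ← map_add, ← map_add, map_eq_zero_iff _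
    (InnerProductSpace.toDual ℝ (Act d)).injective] at hfderiv

theorem bregman_three_point
    (hopt : η • g + σ • (gradient p y - gradient p x) + (gradient h y - gradient h x) = 0)
    (u : Act d) :
    bregman h u y + σ * bregman p u y = bregman h u x + σ * bregman p u x
      - bregman h y x - σ * bregman p y x + η * inner ℝ g (u - y) := by
  have hzero := congr(inner ℝ $hopt (u - y))
  simp only [inner_add_left, inner_sub_left, real_inner_smul_left, inner_zero_left] at hzero
  simp only [bregman, show u - x = (u - y) + (y - x) by abel, inner_add_right]
  linarith

theorem bregman_le_neg_mul_inner
    (hopt : η • g + σ • (gradient p y - gradient p x) + (gradient h y - gradient h x) = 0)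
    (hσ : 0 ≤ σ) (hxy : 0 ≤ bregman h x y) (hpxy : 0 ≤ bregman p x y) (hpyx : 0 ≤ bregman p y x) :
    bregman h y x ≤ -(η * inner ℝ g (y - x)) := by
  have hthree := bregman_three_point hopt x
  rw [bregman_self, bregman_self, ← neg_sub y x, inner_neg_right] at hthree
  linarith [mul_nonneg hσ hpxy, mul_nonneg hσ hpyx]

end MirrorStep

theorem neg_mul_sub_le_of_abs_le_mul_sqrt {w β C D q η : ℝ} (hη : 0 ≤ η) (hβ : 0 ≤ β)
    (hC : 0 ≤ C) (hD : 0 ≤ D) (hq : q ≤ C * D) (hw : |w| ≤ β * √q) :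
    -(η * w) - D ≤ η ^ 2 * β ^ 2 * C / 4 := by
  have hbound : -w ≤ β * (√C * √D) := calc
    -w ≤ β * √q := (neg_le_abs w).trans hw
    _ ≤ β * √(C * D) := by gcongr
    _ = β * (√C * √D) := by rw [Real.sqrt_mul hC]
  have hsquare : (η * β * √C / 2 - √D) ^ 2
      = η ^ 2 * β ^ 2 * C / 4 - η * β * (√C * √D) + D := by
    linear_combination (η * β) ^ 2 / 4 * Real.sq_sqrt hC + Real.sq_sqrt hD
  linarith [sq_nonneg (η * β * √C / 2 - √D), mul_le_mul_of_nonneg_left hbound hη]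

namespace IsSelfConcordantBarrier

variable {d : ℕ} {ν B ζ ε ρ : ℝ} {X : Set (Act d)} {h p : Act d → ℝ} {x y g v : Act d}

theorem sqrt_inner_hess_le_of_bregman_le (hb : IsSelfConcordantBarrier ν X h) (hX : Convex ℝ X)
    (hx : x ∈ interior X) (hy : y ∈ interior X) {s : ℝ} (hs₀ : 0 ≤ s) (hs : s < 1 / 8)
    (hle : bregman h y x ≤ s * √(inner ℝ (hess h x (y - x)) (y - x))) :
    √(inner ℝ (hess h x (y - x)) (y - x)) ≤ 8 * s := by
  have hsq := Real.sq_sqrt (hb.hess_nonneg x hx (y - x))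
  rcases le_total (inner ℝ (hess h x (y - x)) (y - x)) 1 with hr | hr
  · have := (hb.inner_hess_div_eight_le_bregman hX hx hy hr).trans hle
    nlinarith [Real.sqrt_nonneg (inner ℝ (hess h x (y - x)) (y - x))]
  · have := (hb.sqrt_inner_hess_div_eight_le_bregman hX hx hy hr).trans hle
    nlinarith [Real.one_le_sqrt.2 hr]

theorem sqrt_inner_hess_add_le (hb : IsSelfConcordantBarrier ν X h)
    (hB : ∀ y ∈ X, ∀ y' ∈ X, ‖y - y'‖ ≤ B) (hB₀ : 0 < B) (hx : x ∈ interior X) (hζ₀ : 0 ≤ ζ)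
    {τ : ℝ} (hτ : 0 ≤ τ) (hζ : inner ℝ (hess p x v) v ≤ ζ * ‖v‖ ^ 2) :
    √(inner ℝ (hess h x v) v + τ * inner ℝ (hess p x v) v)
      ≤ √(1 + τ * ζ * B ^ 2) * √(inner ℝ (hess h x v) v) := by
  rw [← Real.sqrt_mul (by positivity)]
  refine Real.sqrt_le_sqrt ?_
  calc inner ℝ (hess h x v) v + τ * inner ℝ (hess p x v) v
      ≤ inner ℝ (hess h x v) v + τ * (ζ * (B ^ 2 * inner ℝ (hess h x v) v)) := by
        gcongr
        exact hζ.trans (by gcongr; exact hb.norm_sq_le hB hB₀ hx v)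
    _ = (1 + τ * ζ * B ^ 2) * inner ℝ (hess h x v) v := by ring

theorem inner_hess_add_le_mul_bregman (hb : IsSelfConcordantBarrier ν X h) (hX : Convex ℝ X)
    (hB : ∀ y ∈ X, ∀ y' ∈ X, ‖y - y'‖ ≤ B) (hB₀ : 0 < B) (hp : ∀ x ∈ X, ContDiffAt ℝ 2 p x)
    (hH : ∀ x ∈ X, ∀ v, 0 ≤ inner ℝ (hess p x v) v) (hε : 0 ≤ ε)
    (hρ : ∀ x ∈ X, ∀ y ∈ X, ‖y - x‖ < ρ → ‖hess p y - hess p x‖ ≤ ε) (hx : x ∈ interior X)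
    (hy : y ∈ interior X) (hr : inner ℝ (hess h x (y - x)) (y - x) ≤ 1) (hxy : ‖y - x‖ < ρ)
    {τ κ : ℝ} (hτ : 0 ≤ τ) (hκ : 0 < κ) :
    inner ℝ (hess h x (y - x)) (y - x) + τ * inner ℝ (hess p x (y - x)) (y - x)
      ≤ (8 * (1 + τ * ε * B ^ 2) + 2 / κ) * (bregman h y x + κ * τ * bregman p y x) := by
  have hyX := interior_subset hy
  have hxX := interior_subset hx
  have hDp := bregman_nonneg_of_hess_nonneg hX hp hH hxX hyX
  have hDh := hb.bregman_nonneg hX hx hy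
  have hforms : inner ℝ (hess p x (y - x)) (y - x)
      ≤ 2 * bregman p y x + ε * (B ^ 2 * inner ℝ (hess h x (y - x)) (y - x)) := by
    linarith [half_inner_hess_sub_le_bregman hX hp hρ hxX hyX hxy,
      mul_le_mul_of_nonneg_left (hb.norm_sq_le hB hB₀ hx (y - x)) hε]
  calc inner ℝ (hess h x (y - x)) (y - x) + τ * inner ℝ (hess p x (y - x)) (y - x)
      ≤ (1 + τ * ε * B ^ 2) * inner ℝ (hess h x (y - x)) (y - x) + 2 * τ * bregman p y x := by
        linarith [mul_le_mul_of_nonneg_left hforms hτ]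
    _ ≤ (1 + τ * ε * B ^ 2) * (8 * bregman h y x) + 2 * τ * bregman p y x := by
        gcongr
        linarith [hb.inner_hess_div_eight_le_bregman hX hx hy hr]
    _ = 8 * (1 + τ * ε * B ^ 2) * bregman h y x + 2 / κ * (κ * τ * bregman p y x) := by
        field_simp
    _ ≤ (8 * (1 + τ * ε * B ^ 2) + 2 / κ) * (bregman h y x + κ * τ * bregman p y x) := by
        have h₁ : 0 ≤ 8 * (1 + τ * ε * B ^ 2) * (κ * τ * bregman p y x) := by positivity
        have h₂ : 0 ≤ 2 / κ * bregman h y x := by positivity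
        linarith

theorem mirror_step_stability_le (hb : IsSelfConcordantBarrier ν X h) (hX : Convex ℝ X)
    (hB : ∀ y ∈ X, ∀ y' ∈ X, ‖y - y'‖ ≤ B) (hB₀ : 0 < B) (hp : ∀ x ∈ X, ContDiffAt ℝ 2 p x)
    (hH : ∀ x ∈ X, ∀ v, 0 ≤ inner ℝ (hess p x v) v)
    (hζ : ∀ x ∈ X, ∀ v, inner ℝ (hess p x v) v ≤ ζ * ‖v‖ ^ 2) (hζ₀ : 0 ≤ ζ) (hε : 0 ≤ ε)
    (hρ : ∀ x ∈ X, ∀ y ∈ X, ‖y - x‖ < ρ → ‖hess p y - hess p x‖ ≤ ε)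
    (hx : x ∈ interior X) (hy : y ∈ interior X) {η τ κ β : ℝ}
    (hη : 0 ≤ η) (hτ : 0 ≤ τ) (hκ : 0 < κ) (hβ : 0 ≤ β)
    (hopt : η • g + (κ * τ) • (gradient p y - gradient p x) + (gradient h y - gradient h x) = 0)
    (hg : |inner ℝ g (y - x)| ≤ β * √(inner ℝ (hess h x (y - x)) (y - x)
      + τ * inner ℝ (hess p x (y - x)) (y - x)))
    (hs : η * β * √(1 + τ * ζ * B ^ 2) < 1 / 8)
    (hsρ : 8 * (η * β * √(1 + τ * ζ * B ^ 2)) * B < ρ) :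
    -(η * inner ℝ g (y - x)) - bregman h y x - κ * τ * bregman p y x
      ≤ η ^ 2 * β ^ 2 * (8 * (1 + τ * ε * B ^ 2) + 2 / κ) / 4 := by
  have hxX := interior_subset hx
  have hyX := interior_subset hy
  have hDp := bregman_nonneg_of_hess_nonneg hX hp hH hxX hyX
  have hDh := hb.bregman_nonneg hX hx hy
  set r := √(inner ℝ (hess h x (y - x)) (y - x)) with hr
  have hshort : bregman h y x ≤ η * β * √(1 + τ * ζ * B ^ 2) * r :=
    calc bregman h y x ≤ -(η * inner ℝ g (y - x)) :=
          bregman_le_neg_mul_inner hopt (by positivity) (hb.bregman_nonneg hX hy hx)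
            (bregman_nonneg_of_hess_nonneg hX hp hH hyX hxX) hDp
      _ ≤ η * |inner ℝ g (y - x)| := by
          rw [← mul_neg]
          gcongr
          exact neg_le_abs _
      _ ≤ η * (β * (√(1 + τ * ζ * B ^ 2) * r)) := by
          gcongr
          exact hg.trans (by gcongr; exact hb.sqrt_inner_hess_add_le hB hB₀ hx hζ₀ hτ (hζ x hxX _))
      _ = η * β * √(1 + τ * ζ * B ^ 2) * r := by ring
  have hr₈ := hb.sqrt_inner_hess_le_of_bregman_le hX hx hy (by positivity) hs hshort
  have hr₁ : inner ℝ (hess h x (y - x)) (y - x) ≤ 1 := Real.sqrt_le_one.1 (by linarith)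
  have hnorm : ‖y - x‖ ≤ B * r := by
    rw [hr, ← Real.sqrt_sq hB₀.le, ← Real.sqrt_mul (sq_nonneg B)]
    exact Real.le_sqrt_of_sq_le (hb.norm_sq_le hB hB₀ hx (y - x))
  have hxy : ‖y - x‖ < ρ := by linarith [mul_le_mul_of_nonneg_left hr₈ hB₀.le]
  have := neg_mul_sub_le_of_abs_le_mul_sqrt hη hβ (by positivity) (by positivity)
    (hb.inner_hess_add_le_mul_bregman hX hB hB₀ hp hH hε hρ hx hy hr₁ hxy hτ hκ) hg
  linarith

end IsSelfConcordantBarrier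

section UniformSphere

open Metric Set

theorem setAverage_ball_clm {E : Type*} [NormedAddCommGroup E] [NormedSpace ℝ E]
    [MeasurableSpace E] [BorelSpace E] (μ : Measure E) [μ.IsNegInvariant] (r : ℝ)
    (L : E →L[ℝ] ℝ) : ⨍ z in ball (0 : E) r, L z ∂μ = 0 := by
  have hodd : ∫ z in ball (0 : E) r, L z ∂μ = -∫ z in ball (0 : E) r, L z ∂μ := by
    rw [← integral_neg, ← integral_indicator measurableSet_ball,
      ← integral_indicator measurableSet_ball, ← integral_neg_eq_self]
    refine integral_congr_ae (.of_forall fun z => ?_)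
    simp [indicator]
  rw [setAverage_eq, show ∫ z in ball (0 : E) r, L z ∂μ = 0 by linarith, smul_zero]

theorem setAverage_ball_le_of_le_add_clm {E : Type*} [NormedAddCommGroup E] [NormedSpace ℝ E]
    [FiniteDimensional ℝ E] [MeasurableSpace E] [BorelSpace E] (μ : Measure E) [μ.IsAddHaarMeasure]
    {r : ℝ} (hr : 0 < r) {F : E → ℝ} (hF : ContinuousOn F (closedBall 0 r)) {K : ℝ}
    (L : E →L[ℝ] ℝ) (hle : ∀ z ∈ closedBall (0 : E) r, F z ≤ K + L z) :
    ⨍ z in ball (0 : E) r, F z ∂μ ≤ K := by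
  have hint : ∀ {f : E → ℝ}, ContinuousOn f (closedBall 0 r) → IntegrableOn f (ball 0 r) μ :=
    fun hf => (hf.integrableOn_compact (isCompact_closedBall _ _)).mono_set ball_subset_closedBall
  have hL : IntegrableOn L (ball 0 r) μ := hint L.continuous.continuousOn
  have hK : IntegrableOn (fun _ => K) (ball (0 : E) r) μ := hint continuousOn_const
  calc ⨍ z in ball (0 : E) r, F z ∂μ ≤ ⨍ z in ball (0 : E) r, (K + L z) ∂μ := by
        rw [setAverage_eq, setAverage_eq, smul_eq_mul, smul_eq_mul]
        exact mul_le_mul_of_nonneg_left (setIntegral_mono_on (hint hF) (hK.add hL)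
          measurableSet_ball fun z hz => hle z (ball_subset_closedBall hz)) (by positivity)
    _ = K + ⨍ z in ball (0 : E) r, L z ∂μ := by
        rw [setAverage_eq, integral_add hK hL, smul_add, ← setAverage_eq, ← setAverage_eq,
          setAverage_const (measure_ball_pos μ _ hr).ne' measure_ball_lt_top.ne]
    _ = K := by rw [setAverage_ball_clm, add_zero]

variable {d : ℕ} [NeZero d]

instance : IsProbabilityMeasure (uniformSphere d) :=
  have := NeZero.mk (Measure.toSphere_ne_zero (volume : Measure (Act d)))
  isProbabilityMeasureSMul

theorem integrable_uniformSphere {F : Sph d → ℝ} (hF : Continuous F) :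
    Integrable F (uniformSphere d) :=
  hF.integrable_of_hasCompactSupport (HasCompactSupport.of_compactSpace F)

theorem integral_uniformSphere_mul_inner {F : Act d → ℝ} (w : Act d)
    (hF : ∀ z ∈ closedBall (0 : Act d) 1, DifferentiableAt ℝ F z)
    (hF' : ContinuousOn (fun z => fderiv ℝ F z w) (closedBall 0 1)) :
    (d : ℝ) * ∫ z, F z * inner ℝ (z : Act d) w ∂uniformSphere d
      = ⨍ z in ball (0 : Act d) 1, fderiv ℝ F z w := by
  have harea := Measure.toSphere_real_apply_univ (volume : Measure (Act d))
  rw [finrank_euclideanSpace_fin, Measure.real_def] at harea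
  rw [uniformSphere, integral_smul_measure, integral_sphere_mul_inner volume hF hF',
    setAverage_eq, ENNReal.toReal_inv, harea, smul_eq_mul, smul_eq_mul, mul_inv, ← mul_assoc,
    ← mul_assoc, mul_inv_cancel₀ (Nat.cast_ne_zero.2 (NeZero.ne d)), one_mul]

theorem integral_uniformSphere_comp_mul_inner {f : Act d → ℝ} {x : Act d}
    {T : Act d →L[ℝ] Act d} (hf : ∀ z ∈ closedBall 0 1, DifferentiableAt ℝ f (x + T z))
    (hf' : ContinuousOn (fun z => gradient f (x + T z)) (closedBall 0 1)) (w : Act d) :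
    (d : ℝ) * ∫ z, f (x + T z) * inner ℝ (z : Act d) w ∂uniformSphere d
      = ⨍ z in ball (0 : Act d) 1, inner ℝ (gradient f (x + T z)) (T w) := by
  have hderiv : ∀ z ∈ closedBall (0 : Act d) 1, HasFDerivAt (fun z => f (x + T z))
      (fderiv ℝ f (x + T z) ∘L T) z := fun z hz =>
    (hf z hz).hasFDerivAt.comp z (T.hasFDerivAt.const_add x)
  have happly : ∀ z ∈ closedBall (0 : Act d) 1, fderiv ℝ (fun z => f (x + T z)) z w
      = inner ℝ (gradient f (x + T z)) (T w) := fun z hz => by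
    rw [(hderiv z hz).fderiv, inner_gradient_left, ContinuousLinearMap.comp_apply]
  rw [integral_uniformSphere_mul_inner w (fun z hz => (hderiv z hz).differentiableAt)
    ((hf'.inner continuousOn_const).congr happly), setAverage_eq, setAverage_eq]
  exact congr(_ • $(setIntegral_congr_fun measurableSet_ball
    fun z hz => happly z (ball_subset_closedBall hz)))

theorem integral_uniformSphere_inner (w : Act d) :
    ∫ z, inner ℝ (z : Act d) w ∂uniformSphere d = 0 := by
  have := integral_uniformSphere_mul_inner (F := fun _ : Act d => (1 : ℝ)) w
    (fun _ _ => by fun_prop) (by simpa using continuousOn_const)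
  simpa [NeZero.ne d] using this

theorem integral_uniformSphere_le_of_le_add_inner {F : Sph d → ℝ} (hF : Continuous F) {K : ℝ}
    (w : Act d) (hle : ∀ z : Sph d, F z ≤ K + inner ℝ (z : Act d) w) :
    ∫ z, F z ∂uniformSphere d ≤ K := by
  have hw : Continuous fun z : Sph d => inner ℝ (z : Act d) w := by fun_prop
  calc ∫ z, F z ∂uniformSphere d
      ≤ ∫ z : Sph d, (K + inner ℝ (z : Act d) w) ∂uniformSphere d :=
        integral_mono (integrable_uniformSphere hF)
          (integrable_uniformSphere (continuous_const.add hw)) hle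
    _ = K := by
        rw [integral_add (integrable_const K) (integrable_uniformSphere hw),
          integral_uniformSphere_inner, add_zero, integral_const, probReal_univ, one_smul]

end UniformSphere

section FirstOrder

theorem add_fderiv_le_of_convexOn {E : Type*} [NormedAddCommGroup E] [NormedSpace ℝ E] {s : Set E}
    {f : E → ℝ} {f' : E →L[ℝ] ℝ} {x y : E} (hf : ConvexOn ℝ s f) (hf' : HasFDerivAt f f' x)
    (hx : x ∈ s) (hy : y ∈ s) : f x + f' (y - x) ≤ f y := by
  have hderiv : HasDerivAt (f ∘ AffineMap.lineMap x y) (f' (y - x)) (0 : ℝ) :=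
    HasFDerivAt.comp_hasDerivAt 0 (by rwa [AffineMap.lineMap_apply_zero])
      AffineMap.hasDerivAt_lineMap
  have := (hf.comp_affineMap (AffineMap.lineMap x y)).le_slope_of_hasDerivAt (x := 0) (y := 1)
    (by simpa) (by simpa) one_pos hderiv
  simp only [slope_def_field, Function.comp_apply, AffineMap.lineMap_apply_zero,
    AffineMap.lineMap_apply_one, sub_zero, div_one] at this
  linarith

theorem gradientWithin_of_mem_interior {E : Type*} [NormedAddCommGroup E] [InnerProductSpace ℝ E]
    [CompleteSpace E] {s : Set E} {x : E} (f : E → ℝ) (hx : x ∈ interior s) :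
    gradientWithin f s x = gradient f x := by
  rw [gradientWithin, gradient, fderivWithin_of_mem_nhds (mem_interior_iff_mem_nhds.1 hx)]

variable {d : ℕ} {κ ε ρ ℓ : ℝ} {X : Set (Act d)} {f p : Act d → ℝ} {x y u : Act d}

theorem add_inner_gradient_le_of_convexOn (hf : ConvexOn ℝ X f) (hfx : DifferentiableAt ℝ f x)
    (hx : x ∈ X) (hy : y ∈ X) : f x + inner ℝ (gradient f x) (y - x) ≤ f y := by
  rw [inner_gradient_left]
  exact add_fderiv_le_of_convexOn hf hfx.hasFDerivAt hx hy

theorem inner_gradient_sub_gradient_le (hℓ : ‖gradient f y - gradient f x‖ ≤ ℓ * ‖y - x‖) :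
    inner ℝ (gradient f y - gradient f x) (y - x) ≤ ℓ * ‖y - x‖ ^ 2 :=
  calc inner ℝ (gradient f y - gradient f x) (y - x)
      ≤ ‖gradient f y - gradient f x‖ * ‖y - x‖ := real_inner_le_norm _ _
    _ ≤ ℓ * ‖y - x‖ * ‖y - x‖ := by gcongr
    _ = ℓ * ‖y - x‖ ^ 2 := by ring

theorem inner_gradient_le_sub_bregman (hqc : ConvexOn ℝ X fun y => f y - κ * p y)
    (hf : DifferentiableAt ℝ f y) (hp : DifferentiableAt ℝ p y) (hy : y ∈ X) (hu : u ∈ X) :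
    inner ℝ (gradient f y) (u - y) ≤ f u - f y - κ * bregman p u y := by
  have := add_fderiv_le_of_convexOn hqc (hf.hasFDerivAt.sub (hp.hasFDerivAt.const_mul κ)) hy hu
  simp only [sub_apply, smul_apply, smul_eq_mul, ← inner_gradient_left] at this
  rw [bregman]
  linarith

theorem inner_gradient_sub_le (hX : Convex ℝ X) (hfc : ConvexOn ℝ X f) (hκ : 0 ≤ κ)
    (hqc : ConvexOn ℝ X fun y => f y - κ * p y) (hp : ∀ x ∈ X, ContDiffAt ℝ 2 p x)
    (hH : ∀ x ∈ X, ∀ v, 0 ≤ inner ℝ (hess p x v) v)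
    (hρ : ∀ x ∈ X, ∀ y ∈ X, ‖y - x‖ < ρ → ‖hess p y - hess p x‖ ≤ ε) (hx : x ∈ X) (hy : y ∈ X)
    (hu : u ∈ X) (hxy : ‖y - x‖ < ρ) (hfx : DifferentiableAt ℝ f x) (hfy : DifferentiableAt ℝ f y)
    (hℓ : ‖gradient f y - gradient f x‖ ≤ ℓ * ‖y - x‖) :
    inner ℝ (gradient f y) (u - x) ≤ f u - κ * bregman p u x - f x
      + (ℓ * ‖y - x‖ ^ 2 + κ * (ε * ‖y - x‖ * ‖u - x‖))
      + κ * inner ℝ (hess p x (y - x)) (u - x) := by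
  have hfu := inner_gradient_le_sub_bregman hqc hfy ((hp y hy).differentiableAt two_ne_zero) hy hu
  have hfirst := add_inner_gradient_le_of_convexOn hfc hfx hx hy
  have hlip := inner_gradient_sub_gradient_le hℓ
  have hbreg : bregman p u y = bregman p u x + bregman p x y
      - inner ℝ (gradient p y - gradient p x) (u - x) := by
    simp only [bregman, ← sub_add_sub_cancel u x y, inner_add_right, inner_sub_left]
    ring
  have hrem : inner ℝ (gradient p y - gradient p x - hess p x (y - x)) (u - x)
      ≤ ε * ‖y - x‖ * ‖u - x‖ := (real_inner_le_norm _ _).trans (by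
    gcongr
    exact norm_gradient_sub_sub_hess_le hX hp hρ hx hy hxy)
  have hnonneg := mul_nonneg hκ (bregman_nonneg_of_hess_nonneg hX hp hH hy hx)
  have hκrem := mul_le_mul_of_nonneg_left hrem hκ
  rw [← sub_add_sub_cancel u y x, inner_add_right (gradient f y), sub_add_sub_cancel]
  rw [hbreg] at hfu
  rw [inner_sub_left] at hlip hκrem
  linarith

theorem le_add_inner_gradient (hf : ConvexOn ℝ X f) (hfy : DifferentiableAt ℝ f y) (hy : y ∈ X)
    (hx : x ∈ X) (hℓ : ‖gradient f y - gradient f x‖ ≤ ℓ * ‖y - x‖) :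
    f y ≤ f x + inner ℝ (gradient f x) (y - x) + ℓ * ‖y - x‖ ^ 2 := by
  have hfirst := add_inner_gradient_le_of_convexOn hf hfy hy hx
  have hlip := inner_gradient_sub_gradient_le hℓ
  rw [← neg_sub y x, inner_neg_right] at hfirst
  rw [inner_sub_left] at hlip
  linarith

end FirstOrder

section Sampling

open Metric

variable {d : ℕ} {ν B τ δ : ℝ} {X : Set (Act d)} {h p f : Act d → ℝ} {x z : Act d}
  {A : Act d →L[ℝ] Act d}

theorem IsInvSqrt.inner_hess_apply_le (hA : IsInvSqrt A (hess h x + τ • hess p x)) (hτ : 0 ≤ τ)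
    (hH : ∀ v, 0 ≤ inner ℝ (hess p x v) v) (z : Act d) :
    inner ℝ (hess h x (A z)) (A z) ≤ ‖z‖ ^ 2 := by
  have hself := hA.inner_apply_self z
  rw [add_apply, inner_add_left, smul_apply, real_inner_smul_left] at hself
  linarith [mul_nonneg hτ (hH (A z))]

namespace IsSelfConcordantBarrier

theorem norm_apply_le (hb : IsSelfConcordantBarrier ν X h)
    (hB : ∀ y ∈ X, ∀ y' ∈ X, ‖y - y'‖ ≤ B) (hB₀ : 0 < B) (hx : x ∈ interior X)
    (hA : IsInvSqrt A (hess h x + τ • hess p x)) (hτ : 0 ≤ τ)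
    (hH : ∀ v, 0 ≤ inner ℝ (hess p x v) v) (z : Act d) : ‖A z‖ ≤ B * ‖z‖ := by
  refine le_of_sq_le_sq ?_ (by positivity)
  calc ‖A z‖ ^ 2 ≤ B ^ 2 * inner ℝ (hess h x (A z)) (A z) := hb.norm_sq_le hB hB₀ hx (A z)
    _ ≤ B ^ 2 * ‖z‖ ^ 2 := by gcongr; exact hA.inner_hess_apply_le hτ hH z
    _ = (B * ‖z‖) ^ 2 := by ring

theorem norm_smul_apply_le (hb : IsSelfConcordantBarrier ν X h)
    (hB : ∀ y ∈ X, ∀ y' ∈ X, ‖y - y'‖ ≤ B) (hB₀ : 0 < B) (hx : x ∈ interior X)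
    (hA : IsInvSqrt A (hess h x + τ • hess p x)) (hτ : 0 ≤ τ)
    (hH : ∀ v, 0 ≤ inner ℝ (hess p x v) v) (hδ : 0 ≤ δ) (hz : ‖z‖ ≤ 1) : ‖(δ • A) z‖ ≤ δ * B := by
  rw [smul_apply, norm_smul, Real.norm_of_nonneg hδ]
  gcongr
  exact (hb.norm_apply_le hB hB₀ hx hA hτ hH z).trans (mul_le_of_le_one_right hB₀.le hz)

theorem sample_mem_interior (hb : IsSelfConcordantBarrier ν X h) (hx : x ∈ interior X)
    (hA : IsInvSqrt A (hess h x + τ • hess p x)) (hτ : 0 ≤ τ)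
    (hH : ∀ v, 0 ≤ inner ℝ (hess p x v) v) (hδ₀ : 0 ≤ δ) (hδ₁ : δ < 1) (hz : ‖z‖ ≤ 1) :
    x + δ • A z ∈ interior X := by
  refine hb.add_mem_interior hx ?_
  rw [inner_hess_smul_self]
  calc δ ^ 2 * inner ℝ (hess h x (A z)) (A z) ≤ δ ^ 2 * 1 := by
        gcongr
        exact (hA.inner_hess_apply_le hτ hH z).trans (pow_le_one₀ (norm_nonneg _) hz)
    _ < 1 := by rw [mul_one]; exact pow_lt_one₀ hδ₀ hδ₁ two_ne_zero

theorem sample_mem (hb : IsSelfConcordantBarrier ν X h) (hX : IsClosed X) (hx : x ∈ interior X)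
    (hA : IsInvSqrt A (hess h x + τ • hess p x)) (hτ : 0 ≤ τ)
    (hH : ∀ v, 0 ≤ inner ℝ (hess p x v) v) (hδ₀ : 0 ≤ δ) (hδ₁ : δ ≤ 1) (hz : ‖z‖ ≤ 1) :
    x + δ • A z ∈ X := by
  refine hb.add_mem_of_inner_hess_le_one hX hx ?_
  rw [inner_hess_smul_self]
  exact mul_le_one₀ (pow_le_one₀ hδ₀ hδ₁) (hb.hess_nonneg x hx _)
    ((hA.inner_hess_apply_le hτ hH z).trans (pow_le_one₀ (norm_nonneg _) hz))

end IsSelfConcordantBarrier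

end Sampling

section Estimator

open Metric Set

variable {d : ℕ} {ν B ℓ κ τ ε ρ δ r : ℝ} {X : Set (Act d)} {h p f : Act d → ℝ}
  {x u : Act d} {A T : Act d →L[ℝ] Act d}

theorem continuousOn_gradient_comp
    (hlip : ∀ y ∈ interior X, ∀ y' ∈ interior X, ‖gradient f y - gradient f y'‖ ≤ ℓ * ‖y - y'‖)
    (hℓ : 0 ≤ ℓ) (hT : ∀ z ∈ closedBall (0 : Act d) 1, x + T z ∈ interior X) :
    ContinuousOn (fun z => gradient f (x + T z)) (closedBall 0 1) := by
  have hgrad : LipschitzOnWith ⟨ℓ, hℓ⟩ (gradient f) (interior X) :=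
    .of_dist_le_mul fun y hy y' hy' => by rw [dist_eq_norm, dist_eq_norm]; exact hlip y hy y' hy'
  exact hgrad.continuousOn.comp (by fun_prop) hT

theorem setAverage_inner_gradient_le (hX : Convex ℝ X) (hB : ∀ y ∈ X, ∀ y' ∈ X, ‖y - y'‖ ≤ B)
    (hfd : ∀ y ∈ interior X, DifferentiableAt ℝ f y) (hfc : ConvexOn ℝ X f)
    (hlip : ∀ y ∈ interior X, ∀ y' ∈ interior X, ‖gradient f y - gradient f y'‖ ≤ ℓ * ‖y - y'‖)
    (hℓ : 0 ≤ ℓ) (hκ : 0 ≤ κ) (hqc : ConvexOn ℝ X fun y => f y - κ * p y)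
    (hp : ∀ x ∈ X, ContDiffAt ℝ 2 p x) (hH : ∀ x ∈ X, ∀ v, 0 ≤ inner ℝ (hess p x v) v)
    (hε : 0 ≤ ε) (hρ : ∀ x ∈ X, ∀ y ∈ X, ‖y - x‖ < ρ → ‖hess p y - hess p x‖ ≤ ε)
    (hx : x ∈ interior X) (hT : ∀ z ∈ closedBall (0 : Act d) 1, x + T z ∈ interior X)
    (hTr : ∀ z ∈ closedBall (0 : Act d) 1, ‖T z‖ ≤ r) (hr : r < ρ) (hu : u ∈ X) :
    ⨍ z in ball (0 : Act d) 1, inner ℝ (gradient f (x + T z)) (u - x)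
      ≤ f u - κ * bregman p u x - f x + (ℓ * r ^ 2 + κ * (ε * r * B)) := by
  have hxX := interior_subset hx
  refine setAverage_ball_le_of_le_add_clm volume one_pos
    ((continuousOn_gradient_comp hlip hℓ hT).inner continuousOn_const)
    (κ • (innerSL ℝ (u - x) ∘L hess p x ∘L T)) fun z hz => ?_
  have hyx : x + T z - x = T z := add_sub_cancel_left _ _
  have hr₀ : 0 ≤ r := (norm_nonneg _).trans (hTr z hz)
  have hpoint := inner_gradient_sub_le (y := x + T z) hX hfc hκ hqc hp hH hρ hxX
    (interior_subset (hT z hz)) hu (by rw [hyx]; exact (hTr z hz).trans_lt hr) (hfd x hx)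
    (hfd _ (hT z hz)) (hlip _ (hT z hz) x hx)
  rw [hyx] at hpoint
  refine hpoint.trans (add_le_add ?_ ?_)
  · gcongr
    exacts [hTr z hz, hTr z hz, hB u hu x hxX]
  · rw [real_inner_comm]
    rfl

variable [NeZero d]

theorem integral_uniformSphere_comp_le (hfd : ∀ y ∈ interior X, DifferentiableAt ℝ f y)
    (hfc : ConvexOn ℝ X f)
    (hlip : ∀ y ∈ interior X, ∀ y' ∈ interior X, ‖gradient f y - gradient f y'‖ ≤ ℓ * ‖y - y'‖)
    (hℓ : 0 ≤ ℓ) (hx : x ∈ interior X)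
    (hT : ∀ z ∈ closedBall (0 : Act d) 1, x + T z ∈ interior X)
    (hTr : ∀ z ∈ closedBall (0 : Act d) 1, ‖T z‖ ≤ r)
    (hcont : Continuous fun z : Sph d => f (x + T z)) :
    ∫ z : Sph d, f (x + T z) ∂uniformSphere d ≤ f x + ℓ * r ^ 2 := by
  refine integral_uniformSphere_le_of_le_add_inner hcont (T.adjoint (gradient f x)) fun z => ?_
  have hz := sphere_subset_closedBall z.2
  have hpoint := le_add_inner_gradient hfc (hfd _ (hT z hz)) (interior_subset (hT z hz))
    (interior_subset hx) (hlip _ (hT z hz) x hx)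
  rw [add_sub_cancel_left] at hpoint
  rw [ContinuousLinearMap.adjoint_inner_right, real_inner_comm]
  have : ℓ * ‖T z‖ ^ 2 ≤ ℓ * r ^ 2 := by
    gcongr
    exact hTr z hz
  linarith

theorem integral_estimator_mul_inner {M : Act d →L[ℝ] Act d} (hA : IsInvSqrt A M) (hδ : δ ≠ 0)
    (hf : ∀ z ∈ closedBall 0 1, DifferentiableAt ℝ f (x + (δ • A) z))
    (hf' : ContinuousOn (fun z => gradient f (x + (δ • A) z)) (closedBall 0 1)) (v : Act d) :
    ∫ z : Sph d, (d : ℝ) / δ * f (x + δ • A z) * inner ℝ (A.inverse z) v ∂uniformSphere d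
      = ⨍ z in ball (0 : Act d) 1, inner ℝ (gradient f (x + (δ • A) z)) v := by
  have hstokes := integral_uniformSphere_comp_mul_inner hf hf' (δ⁻¹ • A.inverse v)
  rw [smul_apply, map_smul, smul_inv_smul₀ hδ, hA.apply_inverse, ← integral_const_mul] at hstokes
  rw [← hstokes]
  refine integral_congr_ae (.of_forall fun z => ?_)
  simp only [hA.inner_inverse_left, real_inner_smul_right, smul_apply]
  ring

theorem IsSelfConcordantBarrier.integral_estimator_le (hb : IsSelfConcordantBarrier ν X h)
    (hX : Convex ℝ X) (hB : ∀ y ∈ X, ∀ y' ∈ X, ‖y - y'‖ ≤ B) (hB₀ : 0 < B)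
    (hfd : ∀ y ∈ interior X, DifferentiableAt ℝ f y) (hfc : ConvexOn ℝ X f)
    (hlip : ∀ y ∈ interior X, ∀ y' ∈ interior X, ‖gradient f y - gradient f y'‖ ≤ ℓ * ‖y - y'‖)
    (hℓ : 0 ≤ ℓ) (hκ : 0 ≤ κ) (hqc : ConvexOn ℝ X fun y => f y - κ * p y)
    (hp : ∀ x ∈ X, ContDiffAt ℝ 2 p x) (hH : ∀ x ∈ X, ∀ v, 0 ≤ inner ℝ (hess p x v) v)
    (hε : 0 ≤ ε) (hρ : ∀ x ∈ X, ∀ y ∈ X, ‖y - x‖ < ρ → ‖hess p y - hess p x‖ ≤ ε)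
    (hx : x ∈ interior X) (hA : IsInvSqrt A (hess h x + τ • hess p x)) (hτ : 0 ≤ τ)
    (hδ₀ : 0 < δ) (hδ₁ : δ < 1) (hδρ : δ * B < ρ) (hu : u ∈ X) :
    ∫ z : Sph d, ((d : ℝ) / δ * f (x + δ • A z) * inner ℝ (A.inverse z) (u - x)
        + f (x + δ • A z)) ∂uniformSphere d
      ≤ f u - κ * bregman p u x + (2 * ℓ * δ ^ 2 * B ^ 2 + κ * ε * δ * B ^ 2) := by
  have hHx := hH x (interior_subset hx)
  have hT : ∀ z ∈ closedBall (0 : Act d) 1, x + (δ • A) z ∈ interior X := fun z hz =>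
    hb.sample_mem_interior hx hA hτ hHx hδ₀.le hδ₁ (mem_closedBall_zero_iff.1 hz)
  have hTr : ∀ z ∈ closedBall (0 : Act d) 1, ‖(δ • A) z‖ ≤ δ * B := fun z hz =>
    hb.norm_smul_apply_le hB hB₀ hx hA hτ hHx hδ₀.le (mem_closedBall_zero_iff.1 hz)
  have hcont : Continuous fun z : Sph d => f (x + δ • A z) :=
    ContinuousOn.comp_continuous (s := interior X)
      (fun y hy => (hfd y hy).continuousAt.continuousWithinAt) (by fun_prop)
      fun z => hT z (sphere_subset_closedBall z.2)
  have hval := integral_uniformSphere_comp_le hfd hfc hlip hℓ hx hT hTr hcont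
  have hgrad := setAverage_inner_gradient_le hX hB hfd hfc hlip hℓ hκ hqc hp hH hε hρ hx hT hTr
    hδρ hu
  rw [← integral_estimator_mul_inner hA hδ₀.ne' (fun z hz => hfd _ (hT z hz))
    (continuousOn_gradient_comp hlip hℓ hT)] at hgrad
  have hest : Continuous fun z : Sph d =>
      (d : ℝ) / δ * f (x + δ • A z) * inner ℝ (A.inverse z) (u - x) :=
    (continuous_const.mul hcont).mul (by fun_prop)
  rw [integral_add (integrable_uniformSphere hest) (integrable_uniformSphere hcont)]
  simp only [smul_apply] at hval
  linarith

end Estimator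

namespace Game

open Set

variable {n d : ℕ} {𝒢 : Game n d} {B G : ℝ} {ℓ : Fin n → ℝ} {i : Fin n} {x : Fin n → Act d}

/-- The conditions of `IsMonotoneGame` that concern each player separately, without the bound on
the gradients. -/
structure IsConvexGame (𝒢 : Game n d) (B : ℝ) (ℓ : Fin n → ℝ) : Prop where
  convex_set : ∀ i, Convex ℝ (𝒢.X i)
  compact_set : ∀ i, IsCompact (𝒢.X i)
  nonempty_interior : ∀ i, (interior (𝒢.X i)).Nonempty
  diameter : ∀ i, ∀ y ∈ 𝒢.X i, ∀ y' ∈ 𝒢.X i, ‖y - y'‖ ≤ B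
  range : ∀ i, ∀ x ∈ 𝒢.profiles, 𝒢.c i x ∈ Icc (0 : ℝ) 1
  continuous : ∀ i, ContinuousOn (𝒢.c i) 𝒢.profiles
  differentiable : ∀ i, ∀ x ∈ 𝒢.profiles, DifferentiableOn ℝ (𝒢.ownCost i x) (𝒢.X i)
  convex : ∀ i, ∀ x ∈ 𝒢.profiles, ConvexOn ℝ (𝒢.X i) (𝒢.ownCost i x)
  smooth : ∀ i, ∀ x ∈ 𝒢.profiles, ∀ y ∈ 𝒢.X i,
    ‖𝒢.partialGrad i (Function.update x i y) - 𝒢.partialGrad i x‖ ≤ ℓ i * ‖y - x i‖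

theorem IsMonotoneGame.isConvexGame (h𝒢 : 𝒢.IsMonotoneGame B G ℓ) : 𝒢.IsConvexGame B ℓ where
  __ := h𝒢

theorem update_mem_profiles (hx : x ∈ 𝒢.profiles) {y : Act d} (hy : y ∈ 𝒢.X i) :
    Function.update x i y ∈ 𝒢.profiles := fun j => by
  obtain rfl | hj := eq_or_ne j i
  · rwa [Function.update_self]
  · rw [Function.update_of_ne hj]
    exact hx j

theorem partialGrad_update (y : Act d) :
    𝒢.partialGrad i (Function.update x i y) = gradientWithin (𝒢.ownCost i x) (𝒢.X i) y := by
  have : 𝒢.ownCost i (Function.update x i y) = 𝒢.ownCost i x :=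
    funext fun b => by rw [ownCost, ownCost, Function.update_idem]
  rw [partialGrad, this, Function.update_self]

namespace IsConvexGame

theorem abs_cost_le (h𝒢 : 𝒢.IsConvexGame B ℓ) (hx : x ∈ 𝒢.profiles) : |𝒢.c i x| ≤ 1 :=
  (abs_of_nonneg (h𝒢.range i x hx).1).trans_le (h𝒢.range i x hx).2

theorem SW_nonneg (h𝒢 : 𝒢.IsConvexGame B ℓ) (hx : x ∈ 𝒢.profiles) : 0 ≤ 𝒢.SW x :=
  Finset.sum_nonneg fun i _ => (h𝒢.range i x hx).1

theorem SW_le (h𝒢 : 𝒢.IsConvexGame B ℓ) (hx : x ∈ 𝒢.profiles) : 𝒢.SW x ≤ n :=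
  (Finset.sum_le_card_nsmul _ _ 1 fun i _ => (h𝒢.range i x hx).2).trans_eq (by simp)

theorem OPT_nonneg (h𝒢 : 𝒢.IsConvexGame B ℓ) : 0 ≤ 𝒢.OPT :=
  Real.sInf_nonneg (forall_mem_image.2 fun _ => h𝒢.SW_nonneg)

theorem differentiableAt_ownCost (h𝒢 : 𝒢.IsConvexGame B ℓ) (hx : x ∈ 𝒢.profiles) {y : Act d}
    (hy : y ∈ interior (𝒢.X i)) : DifferentiableAt ℝ (𝒢.ownCost i x) y :=
  (h𝒢.differentiable i x hx).differentiableAt (mem_interior_iff_mem_nhds.1 hy)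

theorem norm_gradient_ownCost_sub_le (h𝒢 : 𝒢.IsConvexGame B ℓ) (hx : x ∈ 𝒢.profiles)
    {y y' : Act d} (hy : y ∈ interior (𝒢.X i)) (hy' : y' ∈ interior (𝒢.X i)) :
    ‖gradient (𝒢.ownCost i x) y - gradient (𝒢.ownCost i x) y'‖ ≤ ℓ i * ‖y - y'‖ := by
  have := h𝒢.smooth i _ (update_mem_profiles hx (interior_subset hy')) y (interior_subset hy)
  rwa [Function.update_idem, partialGrad_update, partialGrad_update, Function.update_self,
    gradientWithin_of_mem_interior _ hy, gradientWithin_of_mem_interior _ hy'] at this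

variable [NeZero d]

theorem exists_mem_ne (h𝒢 : 𝒢.IsConvexGame B ℓ) (i : Fin n) (a : Act d) : ∃ y ∈ 𝒢.X i, y ≠ a := by
  obtain ⟨y, hy⟩ := h𝒢.nonempty_interior i
  exact (infinite_of_mem_nhds y (mem_interior_iff_mem_nhds.1 hy)).nontrivial.exists_ne a

theorem diameter_pos (h𝒢 : 𝒢.IsConvexGame B ℓ) (i : Fin n) : 0 < B := by
  obtain ⟨a, ha⟩ := h𝒢.nonempty_interior i
  obtain ⟨y, hy, hne⟩ := h𝒢.exists_mem_ne i a
  exact (norm_pos_iff.2 (sub_ne_zero.2 hne)).trans_le (h𝒢.diameter i y hy a (interior_subset ha))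

theorem smooth_nonneg (h𝒢 : 𝒢.IsConvexGame B ℓ) (hx : x ∈ 𝒢.profiles) (i : Fin n) : 0 ≤ ℓ i := by
  obtain ⟨y, hy, hne⟩ := h𝒢.exists_mem_ne i (x i)
  exact nonneg_of_mul_nonneg_left ((norm_nonneg _).trans (h𝒢.smooth i x hx y hy))
    (norm_pos_iff.2 (sub_ne_zero.2 hne))

end IsConvexGame

end Game

section Mirror

open Set

variable {d : ℕ} {ν B σ : ℝ} {X : Set (Act d)} {h p : Act d → ℝ} {x y : Act d}

theorem IsInvSqrt.norm_inverse_sq_le {A M : Act d →L[ℝ] Act d} (hA : IsInvSqrt A M) (v : Act d) :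
    ‖A.inverse v‖ ^ 2 ≤ ‖M‖ * ‖v‖ ^ 2 :=
  calc ‖A.inverse v‖ ^ 2 = inner ℝ (M v) v := hA.norm_inverse_sq v
    _ ≤ ‖M v‖ * ‖v‖ := real_inner_le_norm _ _
    _ ≤ ‖M‖ * ‖v‖ * ‖v‖ := by gcongr; exact M.le_opNorm v
    _ = ‖M‖ * ‖v‖ ^ 2 := by ring

namespace IsSelfConcordantBarrier

theorem le_add_norm_gradient_mul (hb : IsSelfConcordantBarrier ν X h) (hX : Convex ℝ X)
    (hB : ∀ y ∈ X, ∀ y' ∈ X, ‖y - y'‖ ≤ B) (hx : x ∈ interior X) (hy : y ∈ interior X) :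
    h y ≤ h x + ‖gradient h y‖ * B := by
  have hbr := hb.bregman_nonneg hX hy hx
  have hinner : -inner ℝ (gradient h y) (x - y) ≤ ‖gradient h y‖ * B :=
    (neg_le_abs _).trans ((abs_real_inner_le_norm _ _).trans (by
      gcongr
      exact hB _ (interior_subset hx) _ (interior_subset hy)))
  rw [bregman] at hbr
  linarith

theorem eq_of_isMinOn (hb : IsSelfConcordantBarrier ν X h) (hX : Convex ℝ X)
    (hB : ∀ y ∈ X, ∀ y' ∈ X, ‖y - y'‖ ≤ B) (hB₀ : 0 < B) (hx : x ∈ interior X)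
    (hy : y ∈ interior X) (hxmin : IsMinOn h (interior X) x) (hymin : IsMinOn h (interior X) y) :
    x = y := by
  by_contra hne
  have hgrad : gradient h y = 0 := by
    rw [gradient, (hymin.isLocalMin (isOpen_interior.mem_nhds hy)).fderiv_eq_zero, map_zero]
  have hpos := hb.bregman_pos hX hB hB₀ hy hx hne
  rw [bregman, hgrad, inner_zero_left] at hpos
  linarith [isMinOn_iff.1 hxmin y hy]

theorem injOn_gradient_add_smul (hb : IsSelfConcordantBarrier ν X h) (hX : Convex ℝ X)
    (hB : ∀ y ∈ X, ∀ y' ∈ X, ‖y - y'‖ ≤ B) (hB₀ : 0 < B) (hp : ∀ y ∈ X, ContDiffAt ℝ 2 p y)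
    (hH : ∀ y ∈ X, ∀ v, 0 ≤ inner ℝ (hess p y v) v) (hσ : 0 ≤ σ) :
    InjOn (gradient h + σ • gradient p) (interior X) := by
  intro a ha b hb' hab
  by_contra hne
  have hh := add_pos (hb.bregman_pos hX hB hB₀ hb' ha hne)
    (hb.bregman_pos hX hB hB₀ ha hb' (Ne.symm hne))
  have hp := mul_nonneg hσ (add_nonneg
    (bregman_nonneg_of_hess_nonneg hX hp hH (interior_subset hb') (interior_subset ha))
    (bregman_nonneg_of_hess_nonneg hX hp hH (interior_subset ha) (interior_subset hb')))
  rw [← inner_gradient_sub_gradient] at hh hp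
  have hzero : (gradient h a - gradient h b) + σ • (gradient p a - gradient p b) = 0 := by
    rw [← sub_eq_zero.2 hab, Pi.add_apply, Pi.add_apply, Pi.smul_apply, Pi.smul_apply]
    module
  have hinner := congr(inner ℝ $hzero (a - b))
  rw [inner_add_left, real_inner_smul_left, inner_zero_left] at hinner
  linarith

end IsSelfConcordantBarrier

end Mirror

section Measurability

theorem measurable_comp_of_continuousOn {Ω α β : Type*} [MeasurableSpace Ω]
    [TopologicalSpace α] [MeasurableSpace α] [OpensMeasurableSpace α]
    [TopologicalSpace β] [MeasurableSpace β] [BorelSpace β]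
    {f : α → β} {s : Set α} (hf : ContinuousOn f s) {g : Ω → α} (hg : Measurable g)
    (hs : ∀ ω, g ω ∈ s) : Measurable fun ω => f (g ω) :=
  (continuousOn_iff_continuous_domRestrict.1 hf).measurable.comp (hg.subtype_mk (h := hs))

theorem measurable_clm_apply {Ω : Type*} [MeasurableSpace Ω] {d : ℕ} {A : Ω → Act d →L[ℝ] Act d}
    {v : Ω → Act d} (hA : Measurable A) (hv : Measurable v) : Measurable fun ω => A ω (v ω) :=
  (isBoundedBilinearMap_apply (𝕜 := ℝ) (E := Act d) (F := Act d)).continuous.measurable.comp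
    (hA.prodMk hv)

end Measurability

/-- A run of the algorithm with arbitrary nonnegative learning rates and sampling radii in `(0, 1]`
in a convex game, together with the assumptions on the regularizers. -/
structure AdmissibleRun {n d : ℕ} {Ω : Type*} (𝒢 : Game n d) (B : ℝ) (ℓ : Fin n → ℝ)
    (ν κ μ ζ Cp : ℝ) (h p : Fin n → Act d → ℝ) (η δ : ℕ → ℝ) (z : Fin n → ℕ → Ω → Sph d)
    (x : Fin n → ℕ → Ω → Act d) (A : Fin n → ℕ → Ω → Act d →L[ℝ] Act d) : Prop where
  dim_ne_zero : d ≠ 0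
  game : 𝒢.IsConvexGame B ℓ
  barrier : ∀ i, IsSelfConcordantBarrier ν (𝒢.X i) (h i)
  reg : IsRegularizer 𝒢 κ μ ζ Cp p
  η_nonneg : ∀ t, 0 ≤ η t
  δ_pos : ∀ t ≥ 1, 0 < δ t
  δ_le_one : ∀ t ≥ 1, δ t ≤ 1
  run : IsAlgorithmRun 𝒢 h p κ η δ z x A

namespace AdmissibleRun

open Set

variable {n d : ℕ} {Ω : Type*} {𝒢 : Game n d} {B : ℝ} {ℓ : Fin n → ℝ} {ν κ μ ζ Cp : ℝ}
  {h p : Fin n → Act d → ℝ} {η δ : ℕ → ℝ} {z : Fin n → ℕ → Ω → Sph d}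
  {x : Fin n → ℕ → Ω → Act d} {A : Fin n → ℕ → Ω → Act d →L[ℝ] Act d} {t : ℕ}
  (R : AdmissibleRun 𝒢 B ℓ ν κ μ ζ Cp h p η δ z x A)

include R

section Feasibility

theorem diameter_pos (i : Fin n) : 0 < B :=
  have := NeZero.mk R.dim_ne_zero
  R.game.diameter_pos i

theorem ν_pos (i : Fin n) : 0 < ν :=
  (R.barrier i).nu_pos (R.game.convex_set i) (R.game.compact_set i)
    (Nat.one_le_iff_ne_zero.2 R.dim_ne_zero) (R.game.nonempty_interior i)

theorem mem_interior (i : Fin n) (ht : 1 ≤ t) (ω : Ω) : x i t ω ∈ interior (𝒢.X i) := by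
  obtain _ | _ | s := t
  · omega
  · exact R.run.init_mem i ω
  · exact R.run.step_mem i (s + 1) s.succ_pos ω

theorem mem (i : Fin n) (ht : 1 ≤ t) (ω : Ω) : x i t ω ∈ 𝒢.X i :=
  interior_subset (R.mem_interior i ht ω)

theorem hess_nonneg (i : Fin n) : ∀ y ∈ 𝒢.X i, ∀ v, 0 ≤ inner ℝ (hess (p i) y v) v :=
  fun y hy v => (mul_nonneg R.reg.μ_nonneg (sq_nonneg _)).trans (R.reg.hess_lower i y hy v)

theorem rate_nonneg (t : ℕ) : 0 ≤ η t * ((t : ℝ) + 1) := mul_nonneg (R.η_nonneg t) (by positivity)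

theorem isInvSqrt (i : Fin n) (ht : 1 ≤ t) (ω : Ω) : IsInvSqrt (A i t ω)
    (hess (h i) (x i t ω) + (η t * ((t : ℝ) + 1)) • hess (p i) (x i t ω)) :=
  ⟨R.run.scaling_pos i t ht ω, R.run.scaling_eq i t ht ω⟩

theorem sample_mem (i : Fin n) (ht : 1 ≤ t) (ω : Ω) (w : Sph d) :
    x i t ω + δ t • A i t ω w ∈ 𝒢.X i :=
  (R.barrier i).sample_mem (R.game.compact_set i).isClosed (R.mem_interior i ht ω)
    (R.isInvSqrt i ht ω) (R.rate_nonneg t) (R.hess_nonneg i _ (R.mem i ht ω)) (R.δ_pos t ht).le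
    (R.δ_le_one t ht) (mem_sphere_zero_iff_norm.1 w.2).le

theorem played_mem (ht : 1 ≤ t) (ω : Ω) : played δ z x A t ω ∈ 𝒢.profiles :=
  fun i => R.sample_mem i ht ω (z i t ω)

end Feasibility

section Boundedness

theorem optimality (i : Fin n) (ht : 1 ≤ t) (ω : Ω) :
    η t • gradEst 𝒢 δ z x A i t ω
      + (κ * (η t * ((t : ℝ) + 1))) • (gradient (p i) (x i (t + 1) ω) - gradient (p i) (x i t ω))
      + (gradient (h i) (x i (t + 1) ω) - gradient (h i) (x i t ω)) = 0 := by
  have hy := R.run.step_mem i t ht ω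
  refine mirror_step_optimality isOpen_interior hy
    (((R.barrier i).contDiffAt hy).differentiableAt (by norm_num))
    ((R.reg.contDiffAt i _ (interior_subset hy)).differentiableAt two_ne_zero) ?_
  rw [← mul_left_comm, ← mul_assoc]
  exact R.run.step_min i t ht ω

theorem exists_norm_inverse_le_of_barrier_le (i : Fin n) (ht : 1 ≤ t) {M : ℝ}
    (hM : ∀ ω, h i (x i t ω) ≤ M) :
    ∃ K, 0 ≤ K ∧ ∀ ω, ∀ w : Sph d, ‖(A i t ω).inverse (w : Act d)‖ ≤ K := by
  obtain ⟨K, hK⟩ := ((R.barrier i).isCompact_sublevel (R.game.compact_set i) M)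
    |>.exists_bound_of_continuousOn ((continuousOn_hess fun y hy =>
      (R.barrier i).contDiffAt_two hy.1).add ((continuousOn_hess fun y hy =>
        R.reg.contDiffAt i y (interior_subset hy.1)).const_smul (η t * ((t : ℝ) + 1))))
  refine ⟨√K, Real.sqrt_nonneg _, fun ω w => Real.le_sqrt_of_sq_le ?_⟩
  refine ((R.isInvSqrt i ht ω).norm_inverse_sq_le w).trans ?_
  rw [mem_sphere_zero_iff_norm.1 w.2, one_pow, mul_one]
  exact hK _ ⟨R.mem_interior i ht ω, hM ω⟩

theorem norm_gradEst_le (i : Fin n) (ht : 1 ≤ t) {K : ℝ} (ω : Ω)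
    (hK : ‖(A i t ω).inverse (z i t ω : Act d)‖ ≤ K) :
    ‖gradEst 𝒢 δ z x A i t ω‖ ≤ d / δ t * K := by
  have hδ := R.δ_pos t ht
  rw [gradEst, norm_smul, norm_mul, Real.norm_of_nonneg (by positivity : 0 ≤ (d : ℝ) / δ t)]
  gcongr
  exact mul_le_of_le_one_right (by positivity) (R.game.abs_cost_le (R.played_mem ht ω))

theorem exists_norm_gradient_barrier_succ_le (i : Fin n) (ht : 1 ≤ t) {M : ℝ}
    (hM : ∀ ω, h i (x i t ω) ≤ M) : ∃ K, ∀ ω, ‖gradient (h i) (x i (t + 1) ω)‖ ≤ K := by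
  obtain ⟨KA, -, hKA⟩ := R.exists_norm_inverse_le_of_barrier_le i ht hM
  obtain ⟨Kh, hKh⟩ := ((R.barrier i).isCompact_sublevel (R.game.compact_set i) M)
    |>.exists_bound_of_continuousOn (continuousOn_gradient (p := h i) fun y hy =>
      (R.barrier i).contDiffAt_two hy.1)
  obtain ⟨Kp, hKp⟩ := (R.game.compact_set i).exists_bound_of_continuousOn
    (continuousOn_gradient (R.reg.contDiffAt i))
  set σ := κ * (η t * ((t : ℝ) + 1))
  have hσ : 0 ≤ σ := mul_nonneg R.reg.κ_pos.le (R.rate_nonneg t)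
  refine ⟨Kh + η t * (d / δ t * KA) + σ * (Kp + Kp), fun ω => ?_⟩
  have hgrad : gradient (h i) (x i (t + 1) ω)
      = gradient (h i) (x i t ω) - η t • gradEst 𝒢 δ z x A i t ω
        - σ • (gradient (p i) (x i (t + 1) ω) - gradient (p i) (x i t ω)) := by
    rw [← sub_eq_zero, ← R.optimality i ht ω]
    abel
  rw [hgrad]
  refine (norm_sub_le _ _).trans (add_le_add ((norm_sub_le _ _).trans (add_le_add ?_ ?_)) ?_)
  · exact hKh _ ⟨R.mem_interior i ht ω, hM ω⟩
  · rw [norm_smul, Real.norm_of_nonneg (R.η_nonneg t)]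
    exact mul_le_mul_of_nonneg_left (R.norm_gradEst_le i ht ω (hKA ω _)) (R.η_nonneg t)
  · rw [norm_smul, Real.norm_of_nonneg hσ]
    gcongr
    exact (norm_sub_le _ _).trans
      (add_le_add (hKp _ (R.mem i (by omega) ω)) (hKp _ (R.mem i ht ω)))

theorem exists_barrier_le (i : Fin n) (ht : 1 ≤ t) : ∃ M, ∀ ω, h i (x i t ω) ≤ M := by
  obtain ⟨x₀, hx₀⟩ := R.game.nonempty_interior i
  induction t, ht using Nat.le_induction with
  | base => exact ⟨h i x₀, fun ω => R.run.init_min i ω hx₀⟩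
  | succ t ht ih =>
    obtain ⟨M, hM⟩ := ih
    obtain ⟨K, hK⟩ := R.exists_norm_gradient_barrier_succ_le i ht hM
    refine ⟨h i x₀ + K * B, fun ω => ?_⟩
    have := R.diameter_pos i
    refine ((R.barrier i).le_add_norm_gradient_mul (R.game.convex_set i) (R.game.diameter i) hx₀
      (R.run.step_mem i t ht ω)).trans ?_
    gcongr
    exact hK ω

theorem exists_isCompact_mem (i : Fin n) (ht : 1 ≤ t) :
    ∃ K ⊆ interior (𝒢.X i), IsCompact K ∧ ∀ ω, x i t ω ∈ K := by
  obtain ⟨M, hM⟩ := R.exists_barrier_le i ht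
  exact ⟨_, fun _ hy => hy.1, (R.barrier i).isCompact_sublevel (R.game.compact_set i) M,
    fun ω => ⟨R.mem_interior i ht ω, hM ω⟩⟩

theorem exists_norm_inverse_le (i : Fin n) (ht : 1 ≤ t) :
    ∃ K, 0 ≤ K ∧ ∀ ω, ∀ w : Sph d, ‖(A i t ω).inverse (w : Act d)‖ ≤ K := by
  obtain ⟨M, hM⟩ := R.exists_barrier_le i ht
  exact R.exists_norm_inverse_le_of_barrier_le i ht hM

end Boundedness

section Measurability

theorem measurable_cost {Ω' : Type*} [MeasurableSpace Ω'] (i : Fin n) {y : Ω' → Fin n → Act d}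
    (hy : Measurable y) (hmem : ∀ ω, y ω ∈ 𝒢.profiles) : Measurable fun ω => 𝒢.c i (y ω) :=
  measurable_comp_of_continuousOn (R.game.continuous i) hy hmem

variable [MeasurableSpace Ω]

theorem measurable_hess (i : Fin n) (ht : 1 ≤ t) (hx : Measurable (x i t)) :
    Measurable fun ω => hess (h i) (x i t ω) + (η t * ((t : ℝ) + 1)) • hess (p i) (x i t ω) :=
  (measurable_comp_of_continuousOn (continuousOn_hess fun _ hy => (R.barrier i).contDiffAt_two hy)
    hx (R.mem_interior i ht)).add ((measurable_comp_of_continuousOn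
      (continuousOn_hess (R.reg.contDiffAt i)) hx (R.mem i ht)).fun_const_smul _)

theorem measurable_scaling (i : Fin n) (ht : 1 ≤ t) (hx : Measurable (x i t)) :
    Measurable (A i t) :=
  IsInvSqrt.measurable (R.isInvSqrt i ht) (R.measurable_hess i ht hx)

theorem measurable_inverse (i : Fin n) (ht : 1 ≤ t) (hx : Measurable (x i t)) :
    Measurable fun ω => (A i t ω).inverse := by
  simp only [(R.isInvSqrt i ht _).inverse_eq]
  exact continuous_mul.measurable.comp
    ((R.measurable_scaling i ht hx).prodMk (R.measurable_hess i ht hx))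

theorem measurable_played (ht : 1 ≤ t) (hx : ∀ i, Measurable (x i t))
    (hz : ∀ i, Measurable (z i t)) : Measurable (played δ z x A t) :=
  measurable_pi_iff.2 fun i => (hx i).add ((measurable_clm_apply
    (R.measurable_scaling i ht (hx i)) (measurable_subtype_coe.comp (hz i))).fun_const_smul _)

theorem measurable_gradEst (i : Fin n) (ht : 1 ≤ t) (hx : ∀ i, Measurable (x i t))
    (hz : ∀ i, Measurable (z i t)) : Measurable (gradEst 𝒢 δ z x A i t) :=
  ((R.measurable_cost i (R.measurable_played ht hx hz) (R.played_mem ht)).const_mul _).smul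
    (measurable_clm_apply (R.measurable_inverse i ht (hx i))
      (measurable_subtype_coe.comp (hz i)))

theorem measurable_step (i : Fin n) (ht : 1 ≤ t) (hx : ∀ i, Measurable (x i t))
    (hz : ∀ i, Measurable (z i t)) : Measurable (x i (t + 1)) := by
  set σ := κ * (η t * ((t : ℝ) + 1)) with hσ
  have hcont : ContinuousOn (gradient (h i) + σ • gradient (p i)) (interior (𝒢.X i)) :=
    (continuousOn_gradient fun y hy => (R.barrier i).contDiffAt_two hy).add
      (((continuousOn_gradient (R.reg.contDiffAt i)).mono interior_subset).const_smul σ)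
  have hinj := (R.barrier i).injOn_gradient_add_smul (R.game.convex_set i) (R.game.diameter i)
    (R.diameter_pos i) (R.reg.contDiffAt i) (R.hess_nonneg i)
    (mul_nonneg R.reg.κ_pos.le (R.rate_nonneg t))
  suffices Measurable fun ω => (⟨x i (t + 1) ω, R.run.step_mem i t ht ω⟩ : interior (𝒢.X i)) from
    measurable_subtype_coe.comp this
  rw [← (hcont.measurableEmbedding isOpen_interior.measurableSet hinj).measurable_comp_iff]
  convert (measurable_comp_of_continuousOn hcont (hx i) (R.mem_interior i ht)).sub
    ((R.measurable_gradEst i ht hx hz).fun_const_smul (η t)) using 1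
  ext1 ω
  have hopt := R.optimality i ht ω
  rw [← hσ] at hopt
  change gradient (h i) (x i (t + 1) ω) + σ • gradient (p i) (x i (t + 1) ω)
    = gradient (h i) (x i t ω) + σ • gradient (p i) (x i t ω) - η t • gradEst 𝒢 δ z x A i t ω
  rw [← sub_eq_zero, ← hopt]
  module

theorem measurable_init (i : Fin n) : Measurable (x i 1) := by
  rcases isEmpty_or_nonempty Ω with hΩ | ⟨⟨ω₀⟩⟩
  · exact measurable_of_empty _
  · have : x i 1 = fun _ => x i 1 ω₀ := funext fun ω =>
      (R.barrier i).eq_of_isMinOn (R.game.convex_set i) (R.game.diameter i) (R.diameter_pos i)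
        (R.run.init_mem i ω) (R.run.init_mem i ω₀) (R.run.init_min i ω) (R.run.init_min i ω₀)
    rw [this]
    exact measurable_const

theorem measurable_iterate (ht : 1 ≤ t) (hz : ∀ i, ∀ s < t, Measurable (z i s)) (i : Fin n) :
    Measurable (x i t) := by
  induction t, ht using Nat.le_induction generalizing i with
  | base => exact R.measurable_init i
  | succ t ht ih =>
    exact R.measurable_step i ht (ih fun i s hs => hz i s (hs.trans t.lt_succ_self))
      fun i => hz i t t.lt_succ_self

end Measurability

end AdmissibleRun

theorem integral_prodMk_of_indepFun {Ω β γ : Type*} {mΩ : MeasurableSpace Ω}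
    {mβ : MeasurableSpace β} {mγ : MeasurableSpace γ} {P : Measure Ω} [IsProbabilityMeasure P]
    {W : Ω → β} {Z : Ω → γ} (hW : Measurable W) (hZ : Measurable Z) (hWZ : IndepFun W Z P)
    {F : β × γ → ℝ} (hF : Integrable F ((P.map W).prod (P.map Z))) :
    ∫ ω, F (W ω, Z ω) ∂P = ∫ ω, (∫ c, F (W ω, c) ∂(P.map Z)) ∂P := by
  have := Measure.isProbabilityMeasure_map (μ := P) hZ.aemeasurable
  have := Measure.isProbabilityMeasure_map (μ := P) hW.aemeasurable
  have hmap := hWZ.map_prod_eq_prod_map_map hW.aemeasurable hZ.aemeasurable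
  calc ∫ ω, F (W ω, Z ω) ∂P = ∫ q, F q ∂(P.map fun ω => (W ω, Z ω)) :=
        (integral_map (hW.prodMk hZ).aemeasurable
          (hmap ▸ hF.aestronglyMeasurable)).symm
    _ = ∫ w, ∫ c, F (w, c) ∂(P.map Z) ∂(P.map W) := by rw [hmap, integral_prod _ hF]
    _ = ∫ ω, (∫ c, F (W ω, c) ∂(P.map Z)) ∂P :=
        integral_map hW.aemeasurable hF.integral_prod_left.aestronglyMeasurable

/-- The σ-algebra generated by all sampled directions except the one of player `i` in
round `t`. -/
abbrev otherDirections {n d : ℕ} {Ω : Type*} (z : Fin n → ℕ → Ω → Sph d) (i : Fin n) (t : ℕ) :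
    MeasurableSpace Ω :=
  ⨆ k ∈ ({(i, t)}ᶜ : Set (Fin n × ℕ)), MeasurableSpace.comap (z k.1 k.2) inferInstance

section OtherDirections

variable {n d : ℕ} {Ω : Type*} {z : Fin n → ℕ → Ω → Sph d} {i j : Fin n} {s t : ℕ}

theorem measurable_otherDirections (h : (j, s) ≠ (i, t)) :
    Measurable[otherDirections z i t] (z j s) :=
  measurable_iff_comap_le.2 <| le_iSup₂_of_le (f := fun (k : Fin n × ℕ)
    (_ : k ∈ ({(i, t)}ᶜ : Set (Fin n × ℕ))) => MeasurableSpace.comap (z k.1 k.2) inferInstance)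
    (j, s) h le_rfl

variable [mΩ : MeasurableSpace Ω] {P : Measure Ω}

theorem IsUniformSampling.otherDirections_le (hz : IsUniformSampling P z) :
    otherDirections z i t ≤ mΩ :=
  iSup₂_le fun k _ => (hz.measurable k.1 k.2).comap_le

theorem IsUniformSampling.indepFun_id (hz : IsUniformSampling P z) :
    @IndepFun Ω Ω (Sph d) mΩ (otherDirections z i t) inferInstance id (z i t) P := by
  rw [@IndepFun_iff_Indep Ω Ω (Sph d) mΩ (otherDirections z i t) inferInstance,
    MeasurableSpace.comap_id]
  have hindep := indep_iSup_of_disjoint (fun k => (hz.measurable k.1 k.2).comap_le)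
    hz.indep.iIndep (S := {(i, t)}ᶜ) (T := {(i, t)}) disjoint_compl_left
  rwa [iSup_singleton] at hindep

end OtherDirections

section Resampling

variable {n d : ℕ} {Ω : Type*} {𝒢 : Game n d} {δ : ℕ → ℝ} {z : Fin n → ℕ → Ω → Sph d}
  {x : Fin n → ℕ → Ω → Act d} {A : Fin n → ℕ → Ω → Act d →L[ℝ] Act d}

/-- The profile of round `t` when player `i` samples the direction `w` instead of `z i t ω`. -/
def resampled (δ : ℕ → ℝ) (z : Fin n → ℕ → Ω → Sph d) (x : Fin n → ℕ → Ω → Act d)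
    (A : Fin n → ℕ → Ω → Act d →L[ℝ] Act d) (i : Fin n) (t : ℕ) (ω : Ω) (w : Sph d) :
    Fin n → Act d :=
  Function.update (played δ z x A t ω) i (x i t ω + δ t • A i t ω w)

/-- The value of `⟪ĝ_i^t, u - x_i^t⟫ + c_i(x̂^t)`, the estimated regret plus the incurred cost, when
player `i` samples the direction `q.2` in the state `q.1`. Separating the direction from the state
makes it possible to integrate over it first. -/
def resampledValue (𝒢 : Game n d) (δ : ℕ → ℝ) (z : Fin n → ℕ → Ω → Sph d)
    (x : Fin n → ℕ → Ω → Act d) (A : Fin n → ℕ → Ω → Act d →L[ℝ] Act d) (i : Fin n) (t : ℕ)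
    (u : Act d) (q : Ω × Sph d) : ℝ :=
  (d : ℝ) / δ t * 𝒢.c i (resampled δ z x A i t q.1 q.2)
      * inner ℝ ((A i t q.1).inverse (q.2 : Act d)) (u - x i t q.1)
    + 𝒢.c i (resampled δ z x A i t q.1 q.2)

theorem resampled_self (i : Fin n) (t : ℕ) (ω : Ω) :
    resampled δ z x A i t ω (z i t ω) = played δ z x A t ω :=
  Function.update_eq_self i _

theorem resampledValue_self (i : Fin n) (t : ℕ) (u : Act d) (ω : Ω) :
    resampledValue 𝒢 δ z x A i t u (ω, z i t ω)
      = inner ℝ (gradEst 𝒢 δ z x A i t ω) (u - x i t ω) + 𝒢.c i (played δ z x A t ω) := by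
  rw [resampledValue, resampled_self, gradEst, real_inner_smul_left]

end Resampling

theorem integrable_bregman {d : ℕ} {Ω : Type*} [MeasurableSpace Ω] {P : Measure Ω}
    [IsFiniteMeasure P] {f : Act d → ℝ} {K : Set (Act d)} (hK : IsCompact K)
    (hf : ∀ y ∈ K, ContDiffAt ℝ 2 f y) {Y : Ω → Act d} (hY : Measurable Y) (hYK : ∀ ω, Y ω ∈ K)
    (u : Act d) : Integrable (fun ω => bregman f u (Y ω)) P := by
  have hcont : ContinuousOn (fun y => bregman f u y) K :=
    (continuousOn_const.sub fun y hy => (hf y hy).continuousAt.continuousWithinAt).sub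
      ((continuousOn_gradient hf).inner (continuousOn_const.sub continuousOn_id))
  obtain ⟨M, hM⟩ := hK.exists_bound_of_continuousOn hcont
  exact .of_bound (measurable_comp_of_continuousOn hcont hY hYK).aestronglyMeasurable M
    (.of_forall fun ω => hM _ (hYK ω))

namespace AdmissibleRun

open Set

variable {n d : ℕ} {Ω : Type*} {𝒢 : Game n d} {B : ℝ} {ℓ : Fin n → ℝ} {ν κ μ ζ Cp : ℝ}
  {h p : Fin n → Act d → ℝ} {η δ : ℕ → ℝ} {z : Fin n → ℕ → Ω → Sph d}
  {x : Fin n → ℕ → Ω → Act d} {A : Fin n → ℕ → Ω → Act d →L[ℝ] Act d} {t : ℕ} {u : Act d}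
  (R : AdmissibleRun 𝒢 B ℓ ν κ μ ζ Cp h p η δ z x A)

include R

theorem resampled_mem (i : Fin n) (ht : 1 ≤ t) (ω : Ω) (w : Sph d) :
    resampled δ z x A i t ω w ∈ 𝒢.profiles :=
  Game.update_mem_profiles (R.played_mem ht ω) (R.sample_mem i ht ω w)

theorem measurable_resampled [MeasurableSpace Ω] (i : Fin n) (ht : 1 ≤ t)
    (hx : ∀ j, Measurable (x j t)) (hz : ∀ j ≠ i, Measurable (z j t)) :
    Measurable fun q : Ω × Sph d => resampled δ z x A i t q.1 q.2 := by
  refine measurable_pi_iff.2 fun j => ?_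
  obtain rfl | hj := eq_or_ne j i
  · simp only [resampled, Function.update_self]
    exact ((hx j).comp measurable_fst).add ((measurable_clm_apply
      ((R.measurable_scaling j ht (hx j)).comp measurable_fst)
      (measurable_subtype_coe.comp measurable_snd)).fun_const_smul _)
  · simp only [resampled, Function.update_of_ne hj, played]
    exact ((hx j).add ((measurable_clm_apply (R.measurable_scaling j ht (hx j))
      (measurable_subtype_coe.comp (hz j hj))).fun_const_smul _)).comp measurable_fst

theorem measurable_resampledValue [MeasurableSpace Ω] (i : Fin n) (ht : 1 ≤ t)
    (hx : ∀ j, Measurable (x j t)) (hz : ∀ j ≠ i, Measurable (z j t)) (u : Act d) :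
    Measurable (resampledValue 𝒢 δ z x A i t u) := by
  have hcost : Measurable fun q : Ω × Sph d => 𝒢.c i (resampled δ z x A i t q.1 q.2) :=
    R.measurable_cost i (R.measurable_resampled i ht hx hz) fun q => R.resampled_mem i ht q.1 q.2
  exact ((hcost.const_mul _).mul ((measurable_clm_apply
    ((R.measurable_inverse i ht (hx i)).comp measurable_fst)
    (measurable_subtype_coe.comp measurable_snd)).inner
    (measurable_const.sub ((hx i).comp measurable_fst)))).add hcost

theorem exists_abs_resampledValue_le (i : Fin n) (ht : 1 ≤ t) (hu : u ∈ 𝒢.X i) :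
    ∃ K, ∀ q, |resampledValue 𝒢 δ z x A i t u q| ≤ K := by
  obtain ⟨K, hK₀, hK⟩ := R.exists_norm_inverse_le i ht
  have hδ := R.δ_pos t ht
  refine ⟨d / δ t * 1 * (K * B) + 1, fun q => ?_⟩
  have hcost := R.game.abs_cost_le (i := i) (R.resampled_mem i ht q.1 q.2)
  have hinner : |inner ℝ ((A i t q.1).inverse (q.2 : Act d)) (u - x i t q.1)| ≤ K * B :=
    (abs_real_inner_le_norm _ _).trans (mul_le_mul (hK q.1 q.2)
      (R.game.diameter i u hu _ (R.mem i ht q.1)) (norm_nonneg _) hK₀)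
  refine (abs_add_le _ _).trans (add_le_add ?_ hcost)
  rw [abs_mul, abs_mul, abs_of_nonneg (by positivity : 0 ≤ (d : ℝ) / δ t)]
  gcongr

theorem integral_resampledValue_le {ε ρ : ℝ} (hε : 0 ≤ ε) (i : Fin n)
    (hρ : ∀ y ∈ 𝒢.X i, ∀ y' ∈ 𝒢.X i, ‖y' - y‖ < ρ → ‖hess (p i) y' - hess (p i) y‖ ≤ ε)
    (ht : 1 ≤ t) (hδ₁ : δ t < 1) (hδρ : δ t * B < ρ) (hu : u ∈ 𝒢.X i) (ω : Ω) :
    ∫ w, resampledValue 𝒢 δ z x A i t u (ω, w) ∂uniformSphere d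
      ≤ 𝒢.c i (Function.update (played δ z x A t ω) i u) - κ * bregman (p i) u (x i t ω)
        + (2 * ℓ i * δ t ^ 2 * B ^ 2 + κ * ε * δ t * B ^ 2) := by
  have := NeZero.mk R.dim_ne_zero
  have hy := R.played_mem ht ω
  have hle := (R.barrier i).integral_estimator_le (f := 𝒢.ownCost i (played δ z x A t ω))
    (R.game.convex_set i) (R.game.diameter i) (R.diameter_pos i)
    (fun _ => R.game.differentiableAt_ownCost hy) (R.game.convex i _ hy)
    (fun _ ha _ hb => R.game.norm_gradient_ownCost_sub_le hy ha hb) (R.game.smooth_nonneg hy i)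
    R.reg.κ_pos.le (R.reg.convex_sub i _ hy) (R.reg.contDiffAt i) (R.hess_nonneg i) hε hρ
    (R.mem_interior i ht ω) (R.isInvSqrt i ht ω) (R.rate_nonneg t) (R.δ_pos t ht) hδ₁ hδρ hu
  simpa only [resampledValue, resampled, Game.ownCost] using hle

variable [mΩ : MeasurableSpace Ω] {P : Measure Ω}

theorem measurable_iterate_of_sampling (hz : IsUniformSampling P z) (ht : 1 ≤ t) (i : Fin n) :
    Measurable (x i t) :=
  R.measurable_iterate ht (fun i s _ => hz.measurable i s) i

theorem measurable_played_of_sampling (hz : IsUniformSampling P z) (ht : 1 ≤ t) :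
    Measurable (played δ z x A t) :=
  R.measurable_played ht (R.measurable_iterate_of_sampling hz ht) fun i => hz.measurable i t

variable [IsProbabilityMeasure P]

theorem integrable_bregman_barrier (hz : IsUniformSampling P z) (i : Fin n) (ht : 1 ≤ t)
    (u : Act d) : Integrable (fun ω => bregman (h i) u (x i t ω)) P := by
  obtain ⟨K, hKX, hK, hmem⟩ := R.exists_isCompact_mem i ht
  exact integrable_bregman hK (fun y hy => (R.barrier i).contDiffAt_two (hKX hy))
    (R.measurable_iterate_of_sampling hz ht i) hmem u

theorem integrable_bregman_reg (hz : IsUniformSampling P z) (i : Fin n) (ht : 1 ≤ t)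
    (u : Act d) : Integrable (fun ω => bregman (p i) u (x i t ω)) P :=
  integrable_bregman (R.game.compact_set i) (R.reg.contDiffAt i)
    (R.measurable_iterate_of_sampling hz ht i) (R.mem i ht) u

theorem integrable_cost (i : Fin n) {y : Ω → Fin n → Act d} (hy : Measurable y)
    (hmem : ∀ ω, y ω ∈ 𝒢.profiles) : Integrable (fun ω => 𝒢.c i (y ω)) P :=
  .of_bound (R.measurable_cost i hy hmem).aestronglyMeasurable 1
    (.of_forall fun ω => R.game.abs_cost_le (hmem ω))

theorem integrable_cost_played (hz : IsUniformSampling P z) (i : Fin n) (ht : 1 ≤ t) :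
    Integrable (fun ω => 𝒢.c i (played δ z x A t ω)) P :=
  R.integrable_cost i (R.measurable_played_of_sampling hz ht) (R.played_mem ht)

theorem integrable_cost_update (hz : IsUniformSampling P z) (i : Fin n) (ht : 1 ≤ t)
    (hu : u ∈ 𝒢.X i) :
    Integrable (fun ω => 𝒢.c i (Function.update (played δ z x A t ω) i u)) P :=
  R.integrable_cost i
    (measurable_update_left.comp (R.measurable_played_of_sampling hz ht))
    fun ω => Game.update_mem_profiles (R.played_mem ht ω) hu

theorem integrable_SW_played (hz : IsUniformSampling P z) (ht : 1 ≤ t) :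
    Integrable (fun ω => 𝒢.SW (played δ z x A t ω)) P :=
  integrable_finsetSum _ fun i _ => R.integrable_cost_played hz i ht

theorem integrable_estimated_regret (hz : IsUniformSampling P z) (i : Fin n) (ht : 1 ≤ t)
    (hu : u ∈ 𝒢.X i) :
    Integrable (fun ω => inner ℝ (gradEst 𝒢 δ z x A i t ω) (u - x i t ω)
      + 𝒢.c i (played δ z x A t ω)) P := by
  obtain ⟨K, hK⟩ := R.exists_abs_resampledValue_le i ht hu
  have hmeas := (R.measurable_resampledValue i ht (R.measurable_iterate_of_sampling hz ht)
    (fun j _ => hz.measurable j t) u).comp (measurable_id.prodMk (hz.measurable i t))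
  simp only [← resampledValue_self]
  exact .of_bound hmeas.aestronglyMeasurable K (.of_forall fun ω => hK (ω, z i t ω))

theorem integrable_integral_resampledValue (hz : IsUniformSampling P z) (i : Fin n) (ht : 1 ≤ t)
    (hu : u ∈ 𝒢.X i) :
    Integrable (fun ω => ∫ w, resampledValue 𝒢 δ z x A i t u (ω, w) ∂uniformSphere d) P := by
  obtain ⟨K, hK⟩ := R.exists_abs_resampledValue_le i ht hu
  have := NeZero.mk R.dim_ne_zero
  have hmeas := R.measurable_resampledValue i ht (R.measurable_iterate_of_sampling hz ht)
    (fun j _ => hz.measurable j t) u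
  exact (Integrable.of_bound (μ := P.prod (uniformSphere d)) hmeas.aestronglyMeasurable K
    (.of_forall hK)).integral_prod_left

theorem integral_resampledValue_self (hz : IsUniformSampling P z) (i : Fin n) (ht : 1 ≤ t)
    (hu : u ∈ 𝒢.X i) :
    ∫ ω, resampledValue 𝒢 δ z x A i t u (ω, z i t ω) ∂P
      = ∫ ω, (∫ w, resampledValue 𝒢 δ z x A i t u (ω, w) ∂uniformSphere d) ∂P := by
  obtain ⟨K, hK⟩ := R.exists_abs_resampledValue_le i ht hu
  have hmeas : @Measurable _ _ (@Prod.instMeasurableSpace _ _ (otherDirections z i t) _) _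
      (resampledValue 𝒢 δ z x A i t u) := by
    refine @measurable_resampledValue n d Ω 𝒢 B ℓ ν κ μ ζ Cp h p η δ z x A t R
      (otherDirections z i t) i ht (fun j => ?_) (fun j hj => ?_) u
    · exact @measurable_iterate n d Ω 𝒢 B ℓ ν κ μ ζ Cp h p η δ z x A t R
        (otherDirections z i t) ht
        (fun k s hs => measurable_otherDirections fun he => hs.ne (congr($he.2))) j
    · exact measurable_otherDirections fun he => hj congr($he.1)
  have := NeZero.mk R.dim_ne_zero
  have hid := measurable_id'' (hz.otherDirections_le (i := i) (t := t))
  have := @Measure.isProbabilityMeasure_map Ω Ω mΩ (otherDirections z i t) P _ id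
    (@Measurable.aemeasurable Ω Ω mΩ (otherDirections z i t) id P hid)
  have hswap := @integral_prodMk_of_indepFun Ω Ω (Sph d) mΩ (otherDirections z i t) _ P _ id
    (z i t) hid (hz.measurable i t) hz.indepFun_id
    (resampledValue 𝒢 δ z x A i t u)
  rw [hz.law i t] at hswap
  exact hswap (.of_bound hmeas.aestronglyMeasurable K (.of_forall hK))

theorem integral_estimated_regret_le (hz : IsUniformSampling P z) {ε ρ : ℝ} (hε : 0 ≤ ε)
    (i : Fin n)
    (hρ : ∀ y ∈ 𝒢.X i, ∀ y' ∈ 𝒢.X i, ‖y' - y‖ < ρ → ‖hess (p i) y' - hess (p i) y‖ ≤ ε)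
    (ht : 1 ≤ t) (hδ₁ : δ t < 1) (hδρ : δ t * B < ρ) (hu : u ∈ 𝒢.X i) :
    ∫ ω, (inner ℝ (gradEst 𝒢 δ z x A i t ω) (u - x i t ω) + 𝒢.c i (played δ z x A t ω)) ∂P
      ≤ ∫ ω, 𝒢.c i (Function.update (played δ z x A t ω) i u) ∂P
        - κ * ∫ ω, bregman (p i) u (x i t ω) ∂P
        + (2 * ℓ i * δ t ^ 2 * B ^ 2 + κ * ε * δ t * B ^ 2) := by
  have hcost := R.integrable_cost_update hz i ht hu
  have hreg := (R.integrable_bregman_reg hz i ht u).const_mul κ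
  simp only [← resampledValue_self]
  rw [R.integral_resampledValue_self hz i ht hu, ← integral_const_mul, ← integral_sub hcost hreg]
  refine (integral_mono (R.integrable_integral_resampledValue hz i ht hu)
    ((hcost.sub hreg).add (integrable_const _))
    (R.integral_resampledValue_le hε i hρ ht hδ₁ hδρ hu)).trans_eq ?_
  rw [integral_add' (hcost.sub hreg) (integrable_const _), integral_const, probReal_univ, one_smul]
  rfl

end AdmissibleRun

/-- The potential `D_{h_i}(u, x_i^t) + κ η_t t D_{p_i}(u, x_i^t)` of player `i` relative to the
comparator `u`, whose decrease pays for the regret of round `t`. -/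
def potential {n d : ℕ} {Ω : Type*} (h p : Fin n → Act d → ℝ) (κ : ℝ) (η : ℕ → ℝ)
    (x : Fin n → ℕ → Ω → Act d) (i : Fin n) (u : Act d) (t : ℕ) (ω : Ω) : ℝ :=
  bregman (h i) u (x i t ω) + κ * (η t * t) * bregman (p i) u (x i t ω)

/-- Round `t` is late enough for the one-round estimates: the learning rate does not increase, a
mirror step and a sampled perturbation have lengths less than `ρ`, and the variance of the gradient
estimator costs at most a fraction `θ` of the incurred cost. -/
structure IsSmallStep (d : ℕ) (B κ ζ ε ρ θ : ℝ) (η δ : ℕ → ℝ) (t : ℕ) : Prop where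
  rate_antitone : η (t + 1) ≤ η t
  length_lt : η t * (d / δ t) * √(1 + η t * ((t : ℝ) + 1) * ζ * B ^ 2) < 1 / 8
  length_mul_lt : 8 * (η t * (d / δ t) * √(1 + η t * ((t : ℝ) + 1) * ζ * B ^ 2)) * B < ρ
  noise_le :
    η t * (d / δ t) ^ 2 * (8 * (1 + η t * ((t : ℝ) + 1) * ε * B ^ 2) + 2 / κ) / 4 ≤ θ
  radius_lt_one : δ t < 1
  radius_mul_lt : δ t * B < ρ

namespace AdmissibleRun

variable {n d : ℕ} {Ω : Type*} {𝒢 : Game n d} {B : ℝ} {ℓ : Fin n → ℝ} {ν κ μ ζ Cp : ℝ}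
  {h p : Fin n → Act d → ℝ} {η δ : ℕ → ℝ} {z : Fin n → ℕ → Ω → Sph d}
  {x : Fin n → ℕ → Ω → Act d} {A : Fin n → ℕ → Ω → Act d →L[ℝ] Act d} {t : ℕ} {u : Act d}
  (R : AdmissibleRun 𝒢 B ℓ ν κ μ ζ Cp h p η δ z x A)

include R

section Potential

theorem bregman_reg_nonneg (i : Fin n) (ht : 1 ≤ t) (hu : u ∈ 𝒢.X i) (ω : Ω) :
    0 ≤ bregman (p i) u (x i t ω) :=
  bregman_nonneg_of_hess_nonneg (R.game.convex_set i) (R.reg.contDiffAt i) (R.hess_nonneg i)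
    (R.mem i ht ω) hu

theorem weight_nonneg (t : ℕ) : 0 ≤ κ * (η t * t) :=
  mul_nonneg R.reg.κ_pos.le (mul_nonneg (R.η_nonneg t) t.cast_nonneg)

theorem potential_nonneg (i : Fin n) (ht : 1 ≤ t) (hu : u ∈ interior (𝒢.X i)) (ω : Ω) :
    0 ≤ potential h p κ η x i u t ω :=
  add_nonneg ((R.barrier i).bregman_nonneg (R.game.convex_set i) (R.mem_interior i ht ω) hu)
    (mul_nonneg (R.weight_nonneg t) (R.bregman_reg_nonneg i ht (interior_subset hu) ω))

theorem exists_potential_le (i : Fin n) (ht : 1 ≤ t) :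
    ∃ M, ∀ u ∈ 𝒢.X i, ∀ ω, potential h p κ η x i u t ω ≤ h i u + M := by
  obtain ⟨K, hKX, hK, hmem⟩ := R.exists_isCompact_mem i ht
  have hsmooth : ∀ y ∈ K, ContDiffAt ℝ 2 (h i) y := fun y hy =>
    (R.barrier i).contDiffAt_two (hKX hy)
  obtain ⟨Kg, hKg⟩ := hK.exists_bound_of_continuousOn (continuousOn_gradient hsmooth)
  obtain ⟨Kh, hKh⟩ := hK.exists_bound_of_continuousOn (f := h i)
    fun y hy => (hsmooth y hy).continuousAt.continuousWithinAt
  refine ⟨Kh + Kg * B + κ * (η t * t) * Cp, fun u hu ω => ?_⟩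
  have hgrad := hKg _ (hmem ω)
  have hval := (neg_le_abs _).trans (hKh _ (hmem ω))
  have hinner : -inner ℝ (gradient (h i) (x i t ω)) (u - x i t ω) ≤ Kg * B :=
    (neg_le_abs _).trans ((abs_real_inner_le_norm _ _).trans (mul_le_mul hgrad
      (R.game.diameter i u hu _ (R.mem i ht ω)) (norm_nonneg _) ((norm_nonneg _).trans hgrad)))
  have hreg := mul_le_mul_of_nonneg_left (R.reg.bregman_le i u hu _ (R.mem i ht ω))
    (R.weight_nonneg t)
  rw [potential, bregman]
  linarith

theorem abs_inner_gradEst_le (i : Fin n) (ht : 1 ≤ t) (ω : Ω) (v : Act d) :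
    |inner ℝ (gradEst 𝒢 δ z x A i t ω) v| ≤ d / δ t * 𝒢.c i (played δ z x A t ω)
      * √(inner ℝ (hess (h i) (x i t ω) v) v
        + η t * ((t : ℝ) + 1) * inner ℝ (hess (p i) (x i t ω) v) v) := by
  have hδ := R.δ_pos t ht
  have hc := (R.game.range i _ (R.played_mem ht ω)).1
  have hA := R.isInvSqrt i ht ω
  have hnorm : ‖(A i t ω).inverse v‖ = √(inner ℝ (hess (h i) (x i t ω) v) v
      + η t * ((t : ℝ) + 1) * inner ℝ (hess (p i) (x i t ω) v) v) := by
    rw [← Real.sqrt_sq (norm_nonneg ((A i t ω).inverse v)), hA.norm_inverse_sq,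
      add_apply, smul_apply, inner_add_left,
      real_inner_smul_left]
  rw [gradEst, real_inner_smul_left, abs_mul,
    abs_of_nonneg (by positivity : 0 ≤ (d : ℝ) / δ t * 𝒢.c i (played δ z x A t ω)),
    hA.inner_inverse_left, ← hnorm]
  gcongr
  refine (abs_real_inner_le_norm _ _).trans_eq ?_
  rw [mem_sphere_zero_iff_norm.1 (z i t ω).2, one_mul]

variable {ε ρ θ : ℝ}

/- The estimator carries the cost as a factor, so its variance is proportional to `c² ≤ c`. -/
theorem step_noise_le (hε : 0 ≤ ε) (hst : IsSmallStep d B κ ζ ε ρ θ η δ t) {c : ℝ} (hc₀ : 0 ≤ c)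
    (hc₁ : c ≤ 1) :
    η t ^ 2 * (d / δ t * c) ^ 2 * (8 * (1 + η t * ((t : ℝ) + 1) * ε * B ^ 2) + 2 / κ) / 4
      ≤ η t * (θ * c) := by
  have hη := R.η_nonneg t
  have hκ := R.reg.κ_pos
  have hsq : c ^ 2 ≤ c := by nlinarith
  have hnoise : 0 ≤ η t * (d / δ t) ^ 2
      * (8 * (1 + η t * ((t : ℝ) + 1) * ε * B ^ 2) + 2 / κ) / 4 := by positivity
  calc _ = η t * (η t * (d / δ t) ^ 2
        * (8 * (1 + η t * ((t : ℝ) + 1) * ε * B ^ 2) + 2 / κ) / 4 * c ^ 2) := by ring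
    _ ≤ η t * (θ * c) := mul_le_mul_of_nonneg_left
        (mul_le_mul hst.noise_le hsq (sq_nonneg c) (hnoise.trans hst.noise_le)) hη

theorem potential_succ_le (hε : 0 ≤ ε) (i : Fin n)
    (hρ : ∀ y ∈ 𝒢.X i, ∀ y' ∈ 𝒢.X i, ‖y' - y‖ < ρ → ‖hess (p i) y' - hess (p i) y‖ ≤ ε)
    (ht : 1 ≤ t) (hst : IsSmallStep d B κ ζ ε ρ θ η δ t) (hu : u ∈ 𝒢.X i) (ω : Ω) :
    potential h p κ η x i u (t + 1) ω ≤ potential h p κ η x i u t ω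
      + η t * (κ * bregman (p i) u (x i t ω)
        + (inner ℝ (gradEst 𝒢 δ z x A i t ω) (u - x i t ω) + 𝒢.c i (played δ z x A t ω))
        + (θ - 1) * 𝒢.c i (played δ z x A t ω)) := by
  have hδ := R.δ_pos t ht
  have hη := R.η_nonneg t
  have hκ := R.reg.κ_pos
  obtain ⟨hc₀, hc₁⟩ := R.game.range i _ (R.played_mem ht ω)
  have hlength : η t * (d / δ t * 𝒢.c i (played δ z x A t ω))
      * √(1 + η t * ((t : ℝ) + 1) * ζ * B ^ 2)
      ≤ η t * (d / δ t) * √(1 + η t * ((t : ℝ) + 1) * ζ * B ^ 2) := by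
    gcongr
    exact mul_le_of_le_one_right (by positivity) hc₁
  have hB := R.diameter_pos i
  have hopt := R.optimality i ht ω
  have hstab := (R.barrier i).mirror_step_stability_le (R.game.convex_set i) (R.game.diameter i)
    hB (R.reg.contDiffAt i) (R.hess_nonneg i) (R.reg.hess_upper i)
    R.reg.ζ_pos.le hε hρ (R.mem_interior i ht ω) (R.run.step_mem i t ht ω) hη
    (R.rate_nonneg t) hκ (by positivity) hopt (R.abs_inner_gradEst_le i ht ω _)
    (hlength.trans_lt hst.length_lt) (lt_of_le_of_lt (by gcongr) hst.length_mul_lt)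
  have hnoise := R.step_noise_le hε hst hc₀ hc₁
  have hthree := bregman_three_point hopt u
  have hdecay : κ * (η (t + 1) * ((t + 1 : ℕ) : ℝ)) * bregman (p i) u (x i (t + 1) ω)
      ≤ κ * (η t * ((t : ℝ) + 1)) * bregman (p i) u (x i (t + 1) ω) := by
    have hreg := R.bregman_reg_nonneg i (ht.trans t.le_succ) hu ω
    push_cast
    gcongr
    exact hst.rate_antitone
  rw [← sub_sub_sub_cancel_right u _ (x i t ω), inner_sub_right] at hthree
  rw [potential, potential]
  linarith

end Potential

section Expectation

variable [MeasurableSpace Ω] {P : Measure Ω} [IsProbabilityMeasure P]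

theorem integrable_potential (hz : IsUniformSampling P z) (i : Fin n) (ht : 1 ≤ t) (u : Act d) :
    Integrable (fun ω => potential h p κ η x i u t ω) P :=
  (R.integrable_bregman_barrier hz i ht u).add ((R.integrable_bregman_reg hz i ht u).const_mul _)

theorem integral_potential_succ_le (hz : IsUniformSampling P z) {ε ρ θ e : ℝ} (hε : 0 ≤ ε)
    (i : Fin n)
    (hρ : ∀ y ∈ 𝒢.X i, ∀ y' ∈ 𝒢.X i, ‖y' - y‖ < ρ → ‖hess (p i) y' - hess (p i) y‖ ≤ ε)
    (ht : 1 ≤ t) (hst : IsSmallStep d B κ ζ ε ρ θ η δ t)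
    (he : 2 * ℓ i * δ t ^ 2 * B ^ 2 + κ * ε * δ t * B ^ 2 ≤ e) (hu : u ∈ 𝒢.X i) :
    ∫ ω, potential h p κ η x i u (t + 1) ω ∂P ≤ ∫ ω, potential h p κ η x i u t ω ∂P
      + η t * (∫ ω, 𝒢.c i (Function.update (played δ z x A t ω) i u) ∂P + e
        + (θ - 1) * ∫ ω, 𝒢.c i (played δ z x A t ω) ∂P) := by
  have hreg := (R.integrable_bregman_reg hz i ht u).const_mul κ
  have hest := R.integrable_estimated_regret hz i ht hu
  have hcost := (R.integrable_cost_played hz i ht).const_mul (θ - 1)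
  have hpot := R.integrable_potential hz i ht u
  have hregret := R.integral_estimated_regret_le hz hε i hρ ht hst.radius_lt_one
    hst.radius_mul_lt hu
  have hplay : Integrable (fun ω => κ * bregman (p i) u (x i t ω)
      + (inner ℝ (gradEst 𝒢 δ z x A i t ω) (u - x i t ω) + 𝒢.c i (played δ z x A t ω))) P :=
    hreg.add hest
  have hsum : Integrable (fun ω => κ * bregman (p i) u (x i t ω)
      + (inner ℝ (gradEst 𝒢 δ z x A i t ω) (u - x i t ω) + 𝒢.c i (played δ z x A t ω))
      + (θ - 1) * 𝒢.c i (played δ z x A t ω)) P := hplay.add hcost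
  calc _ ≤ ∫ ω, (potential h p κ η x i u t ω
        + η t * (κ * bregman (p i) u (x i t ω)
          + (inner ℝ (gradEst 𝒢 δ z x A i t ω) (u - x i t ω) + 𝒢.c i (played δ z x A t ω))
          + (θ - 1) * 𝒢.c i (played δ z x A t ω))) ∂P :=
        integral_mono (R.integrable_potential hz i (ht.trans t.le_succ) u)
          (hpot.add (hsum.const_mul (η t)))
          (R.potential_succ_le hε i hρ ht hst hu)
    _ = ∫ ω, potential h p κ η x i u t ω ∂P
        + η t * (κ * ∫ ω, bregman (p i) u (x i t ω) ∂P
          + ∫ ω, (inner ℝ (gradEst 𝒢 δ z x A i t ω) (u - x i t ω)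
            + 𝒢.c i (played δ z x A t ω)) ∂P
          + (θ - 1) * ∫ ω, 𝒢.c i (played δ z x A t ω) ∂P) := by
        rw [integral_add hpot (hsum.const_mul (η t)), integral_const_mul,
          integral_add hplay hcost, integral_add hreg hest, integral_const_mul,
          integral_const_mul]
    _ ≤ _ := by
        have hscaled := mul_le_mul_of_nonneg_left (hregret.trans (add_le_add_right he _))
          (R.η_nonneg t)
        linarith

variable {C₁ C₂ β θ e : ℝ} {x' : Fin n → Act d} {v : Fin n → Act d}

theorem sum_integral_cost_update_le (hz : IsUniformSampling P z)
    (hsmooth : ∀ y ∈ 𝒢.profiles,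
      ∑ i, 𝒢.c i (Function.update y i (x' i)) ≤ C₁ * 𝒢.OPT + C₂ * 𝒢.SW y)
    (hv : ∀ i, v i ∈ 𝒢.X i)
    (hβ : ∀ i, ∀ y ∈ 𝒢.profiles,
      𝒢.c i (Function.update y i (v i)) ≤ 𝒢.c i (Function.update y i (x' i)) + β)
    (ht : 1 ≤ t) :
    ∑ i, ∫ ω, 𝒢.c i (Function.update (played δ z x A t ω) i (v i)) ∂P
      ≤ C₁ * 𝒢.OPT + n * β + C₂ * ∫ ω, 𝒢.SW (played δ z x A t ω) ∂P := by
  have hcost := fun i => R.integrable_cost_update hz i ht (hv i)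
  have hSW := R.integrable_SW_played hz ht
  calc _ = ∫ ω, ∑ i, 𝒢.c i (Function.update (played δ z x A t ω) i (v i)) ∂P :=
        (integral_finsetSum _ fun i _ => hcost i).symm
    _ ≤ ∫ ω, (C₁ * 𝒢.OPT + n * β + C₂ * 𝒢.SW (played δ z x A t ω)) ∂P := by
        refine integral_mono (integrable_finsetSum _ fun i _ => hcost i)
          ((integrable_const _).add (hSW.const_mul _)) fun ω => ?_
        have hy := R.played_mem ht ω
        calc _ ≤ ∑ i, (𝒢.c i (Function.update (played δ z x A t ω) i (x' i)) + β) :=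
              Finset.sum_le_sum fun i _ => hβ i _ hy
          _ = ∑ i, 𝒢.c i (Function.update (played δ z x A t ω) i (x' i)) + n * β := by
              rw [Finset.sum_add_distrib, Finset.sum_const, Finset.card_univ, Fintype.card_fin,
                nsmul_eq_mul]
          _ ≤ _ := by linarith [hsmooth _ hy]
    _ = _ := by
        rw [integral_add (integrable_const _) (hSW.const_mul _), integral_const_mul,
          integral_const, probReal_univ, one_smul]

theorem integral_SW_le (hz : IsUniformSampling P z)
    (hsmooth : ∀ y ∈ 𝒢.profiles,
      ∑ i, 𝒢.c i (Function.update y i (x' i)) ≤ C₁ * 𝒢.OPT + C₂ * 𝒢.SW y)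
    (hv : ∀ i, v i ∈ 𝒢.X i)
    (hβ : ∀ i, ∀ y ∈ 𝒢.profiles,
      𝒢.c i (Function.update y i (v i)) ≤ 𝒢.c i (Function.update y i (x' i)) + β)
    (ht : 1 ≤ t)
    (hround : ∀ i, ∫ ω, potential h p κ η x i (v i) (t + 1) ω ∂P
      ≤ ∫ ω, potential h p κ η x i (v i) t ω ∂P
        + η t * (∫ ω, 𝒢.c i (Function.update (played δ z x A t ω) i (v i)) ∂P + e
          + (θ - 1) * ∫ ω, 𝒢.c i (played δ z x A t ω) ∂P)) :
    η t * (1 - C₂ - θ) * ∫ ω, 𝒢.SW (played δ z x A t ω) ∂P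
      ≤ ∑ i, ∫ ω, potential h p κ η x i (v i) t ω ∂P
        - ∑ i, ∫ ω, potential h p κ η x i (v i) (t + 1) ω ∂P
        + η t * (C₁ * 𝒢.OPT + n * β + n * e) := by
  have hSW : ∫ ω, 𝒢.SW (played δ z x A t ω) ∂P = ∑ i, ∫ ω, 𝒢.c i (played δ z x A t ω) ∂P :=
    integral_finsetSum _ fun i _ => R.integrable_cost_played hz i ht
  have hsum := Finset.sum_le_sum fun i (_ : i ∈ Finset.univ) => hround i
  rw [Finset.sum_add_distrib, ← Finset.mul_sum, Finset.sum_add_distrib, Finset.sum_add_distrib,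
    ← Finset.mul_sum, ← hSW, Finset.sum_const, Finset.card_univ, Fintype.card_fin,
    nsmul_eq_mul] at hsum
  have hupdate := mul_le_mul_of_nonneg_left
    (R.sum_integral_cost_update_le hz hsmooth hv hβ ht) (R.η_nonneg t)
  linarith

end Expectation

end AdmissibleRun

section Averaging

open Filter Finset

theorem rpow_one_quarter_pow_four {s : ℝ} (hs : 0 ≤ s) : (s ^ (1 / 4 : ℝ)) ^ 4 = s := by
  rw [← Real.rpow_natCast, ← Real.rpow_mul hs, Nat.cast_ofNat, one_div_mul_cancel four_ne_zero,
    Real.rpow_one]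

theorem rpow_three_quarters {s : ℝ} (hs : 0 ≤ s) :
    s ^ (3 / 4 : ℝ) = (s ^ (1 / 4 : ℝ)) ^ 3 := by
  rw [← Real.rpow_natCast, ← Real.rpow_mul hs, Nat.cast_ofNat, one_div_mul_eq_div]

theorem rpow_three_quarters_mul_rpow_one_quarter {s : ℝ} (hs : 0 ≤ s) :
    s ^ (3 / 4 : ℝ) * s ^ (1 / 4 : ℝ) = s := by
  rw [rpow_three_quarters hs, ← pow_succ, rpow_one_quarter_pow_four hs]

theorem pow_four_sub_pow_four_le (a b : ℝ) : a ^ 4 - b ^ 4 ≤ 4 * (a - b) * a ^ 3 := by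
  have : 0 ≤ (a - b) ^ 2 * (2 * a ^ 2 + (a + b) ^ 2) := by positivity
  linarith

theorem sum_inv_rpow_three_quarters_le (T : ℕ) :
    ∑ t ∈ Icc 1 T, 1 / (t : ℝ) ^ (3 / 4 : ℝ) ≤ 4 * (T : ℝ) ^ (1 / 4 : ℝ) := by
  induction T with
  | zero => simp
  | succ T ih =>
    have hgap := pow_four_sub_pow_four_le (((T + 1 : ℕ) : ℝ) ^ (1 / 4 : ℝ)) ((T : ℝ) ^ (1 / 4 : ℝ))
    rw [rpow_one_quarter_pow_four (Nat.cast_nonneg _), rpow_one_quarter_pow_four T.cast_nonneg,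
      Nat.cast_succ, add_sub_cancel_left, ← Nat.cast_succ,
      ← rpow_three_quarters (Nat.cast_nonneg _), ← div_le_iff₀ (by positivity)] at hgap
    rw [sum_Icc_succ_top (by simp)]
    linarith

theorem sum_inv_le_one_add_log (T : ℕ) : ∑ t ∈ Icc 1 T, 1 / (t : ℝ) ≤ 1 + Real.log T := by
  simpa only [harmonic_eq_sum_Icc, Rat.cast_sum, Rat.cast_inv, Rat.cast_natCast, one_div]
    using harmonic_le_one_add_log T

theorem mul_sum_Icc_le_of_potential {S E V η : ℕ → ℝ} {c η₀ : ℝ} {a b : ℕ} (hab : a ≤ b)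
    (hc : 0 ≤ c) (hη : ∀ t ∈ Icc a b, η₀ ≤ η t) (hS : ∀ t ∈ Icc a b, 0 ≤ S t) (hV : 0 ≤ V (b + 1))
    (hstep : ∀ t ∈ Icc a b, η t * c * S t ≤ V t - V (t + 1) + E t) :
    η₀ * c * ∑ t ∈ Icc a b, S t ≤ V a + ∑ t ∈ Icc a b, E t :=
  calc η₀ * c * ∑ t ∈ Icc a b, S t ≤ ∑ t ∈ Icc a b, (E t - (V (t + 1) - V t)) := by
        rw [mul_sum]
        refine sum_le_sum fun t ht => ?_
        have := mul_le_mul_of_nonneg_right (mul_le_mul_of_nonneg_right (hη t ht) hc) (hS t ht)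
        linarith [hstep t ht]
    _ = ∑ t ∈ Icc a b, E t - (V (b + 1) - V a) := by rw [sum_sub_distrib, sum_Icc_sub hab V]
    _ ≤ _ := by linarith

variable {S V η δ : ℕ → ℝ} {α D N ν d M M' : ℝ} {t₀ T : ℕ}

theorem sum_rate_le (hd : 0 < d) (hη : ∀ t : ℕ, η t = 1 / (2 * d * (t : ℝ) ^ (3 / 4 : ℝ)))
    (ht₀ : 1 ≤ t₀) : ∑ t ∈ Icc t₀ T, η t ≤ 2 / d * (T : ℝ) ^ (1 / 4 : ℝ) :=
  calc ∑ t ∈ Icc t₀ T, η t ≤ ∑ t ∈ Icc 1 T, η t :=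
        sum_le_sum_of_subset_of_nonneg (Icc_subset_Icc_left ht₀) fun t _ _ => by
          rw [hη]; positivity
    _ = 1 / (2 * d) * ∑ t ∈ Icc 1 T, 1 / (t : ℝ) ^ (3 / 4 : ℝ) := by
        rw [mul_sum]
        exact sum_congr rfl fun t _ => by rw [hη, one_div_mul_one_div]
    _ ≤ 1 / (2 * d) * (4 * (T : ℝ) ^ (1 / 4 : ℝ)) := by
        gcongr
        exact sum_inv_rpow_three_quarters_le T
    _ = _ := by ring

theorem sum_rate_mul_radius_le (hd : 0 < d)
    (hη : ∀ t : ℕ, η t = 1 / (2 * d * (t : ℝ) ^ (3 / 4 : ℝ)))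
    (hδ : ∀ t : ℕ, δ t = 1 / (t : ℝ) ^ (1 / 4 : ℝ)) (ht₀ : 1 ≤ t₀) :
    ∑ t ∈ Icc t₀ T, η t * δ t ≤ 1 / (2 * d) * (1 + Real.log T) :=
  calc ∑ t ∈ Icc t₀ T, η t * δ t ≤ ∑ t ∈ Icc 1 T, η t * δ t :=
        sum_le_sum_of_subset_of_nonneg (Icc_subset_Icc_left ht₀) fun t _ _ => by
          rw [hη, hδ]; positivity
    _ = 1 / (2 * d) * ∑ t ∈ Icc 1 T, 1 / (t : ℝ) := by
        rw [mul_sum]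
        refine sum_congr rfl fun t _ => ?_
        rw [hη, hδ, one_div_mul_one_div, one_div_mul_one_div, mul_assoc,
          rpow_three_quarters_mul_rpow_one_quarter t.cast_nonneg]
    _ ≤ _ := by
        gcongr
        exact sum_inv_le_one_add_log T

theorem sum_rate_mul_error_le {a b : ℝ} (ha : 0 ≤ a) (hb : 0 ≤ b) (hd : 0 < d)
    (hη : ∀ t : ℕ, η t = 1 / (2 * d * (t : ℝ) ^ (3 / 4 : ℝ)))
    (hδ : ∀ t : ℕ, δ t = 1 / (t : ℝ) ^ (1 / 4 : ℝ)) (ht₀ : 1 ≤ t₀) :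
    ∑ t ∈ Icc t₀ T, η t * (a + b * δ t)
      ≤ a * (2 / d * (T : ℝ) ^ (1 / 4 : ℝ)) + b * (1 / (2 * d) * (1 + Real.log T)) :=
  calc ∑ t ∈ Icc t₀ T, η t * (a + b * δ t)
      = a * ∑ t ∈ Icc t₀ T, η t + b * ∑ t ∈ Icc t₀ T, η t * δ t := by
        rw [mul_sum, mul_sum, ← sum_add_distrib]
        exact sum_congr rfl fun t _ => by ring
    _ ≤ _ := by
        gcongr
        · exact sum_rate_le hd hη ht₀
        · exact sum_rate_mul_radius_le hd hη hδ ht₀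

theorem mul_sum_Icc_le (hα : 0 < α) (hD : 0 ≤ D) (hN : 0 ≤ N) (hν : 0 ≤ ν) (hd : 0 < d)
    (ht₀ : 1 ≤ t₀) (hT : t₀ ≤ T) (hη : ∀ t : ℕ, η t = 1 / (2 * d * (t : ℝ) ^ (3 / 4 : ℝ)))
    (hδ : ∀ t : ℕ, δ t = 1 / (t : ℝ) ^ (1 / 4 : ℝ)) (hS : ∀ t ≥ 1, 0 ≤ S t)
    (hV : 0 ≤ V (T + 1)) (hM : V t₀ ≤ M')
    (hstep : ∀ t ≥ t₀, η t * (α / 2) * S t ≤ V t - V (t + 1)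
      + η t * (D + N * (1 / (T : ℝ)) + N * ν * δ t)) :
    α * ∑ t ∈ Icc t₀ T, S t ≤ 8 * D * T + 8 * N
      + (4 * d * M' + 2 * N * ν * (1 + Real.log T)) * (T : ℝ) ^ (3 / 4 : ℝ) := by
  have hT₀ : (0 : ℝ) < T := Nat.cast_pos.2 (ht₀.trans hT)
  have hmono : ∀ t ∈ Icc t₀ T, η T ≤ η t := fun t ht => by
    obtain ⟨ht, htT⟩ := mem_Icc.1 ht
    have : (0 : ℝ) < t := Nat.cast_pos.2 (ht₀.trans ht)
    rw [hη, hη]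
    gcongr
  have hpot := mul_sum_Icc_le_of_potential hT (half_pos hα).le hmono
    (fun t ht => hS t (ht₀.trans (mem_Icc.1 ht).1)) hV fun t ht => hstep t (mem_Icc.1 ht).1
  have herr := sum_rate_mul_error_le (T := T) (by positivity : 0 ≤ D + N * (1 / (T : ℝ)))
    (mul_nonneg hN hν) hd hη hδ ht₀
  have hprod := rpow_three_quarters_mul_rpow_one_quarter hT₀.le
  have hpow : 0 < (T : ℝ) ^ (3 / 4 : ℝ) := by positivity
  rw [hη] at hpot
  generalize (T : ℝ) ^ (3 / 4 : ℝ) = q, (T : ℝ) ^ (1 / 4 : ℝ) = r at *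
  calc α * ∑ t ∈ Icc t₀ T, S t = 4 * d * q * (1 / (2 * d * q) * (α / 2) * ∑ t ∈ Icc t₀ T, S t) := by
        field_simp
        norm_num
    _ ≤ 4 * d * q * (M' + ((D + N * (1 / (T : ℝ))) * (2 / d * r)
        + N * ν * (1 / (2 * d) * (1 + Real.log T)))) := by
        gcongr
        exact hpot.trans (add_le_add hM herr)
    _ = 8 * (D + N * (1 / (T : ℝ))) * (q * r)
        + (4 * d * M' + 2 * N * ν * (1 + Real.log T)) * q := by
        field_simp
        ring
    _ = _ := by
        rw [hprod]
        field_simp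

theorem sum_Icc_one_le (hN : 0 ≤ N) (ht₀ : 1 ≤ t₀) (hT : t₀ ≤ T) (hS : ∀ t ≥ 1, S t ≤ N) :
    ∑ t ∈ Icc 1 T, S t ≤ t₀ * N + ∑ t ∈ Icc t₀ T, S t := by
  have hhead : ∑ t ∈ Ico 1 t₀, S t ≤ t₀ * N := by
    refine (sum_le_card_nsmul _ _ N fun t ht => hS t (mem_Ico.1 ht).1).trans ?_
    rw [Nat.card_Ico, nsmul_eq_mul]
    gcongr
    exact t₀.sub_le 1
  rw [← Ico_add_one_right_eq_Icc, ← Ico_add_one_right_eq_Icc,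
    ← sum_Ico_consecutive _ ht₀ (hT.trans (Nat.le_add_right T 1))]
  gcongr

theorem average_le_of_mul_sum_le {X Y : ℝ} (hα : 0 < α) (hT : 0 < T)
    (h : α * Y ≤ 8 * (D * T + X * (T : ℝ) ^ (3 / 4 : ℝ))) :
    1 / (T : ℝ) * Y ≤ 8 * (D / α + X / (α * (T : ℝ) ^ (1 / 4 : ℝ))) := by
  have hT₀ : (0 : ℝ) < T := Nat.cast_pos.2 hT
  have hroot : 0 < (T : ℝ) ^ (1 / 4 : ℝ) := by positivity
  have hprod := rpow_three_quarters_mul_rpow_one_quarter hT₀.le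
  generalize (T : ℝ) ^ (3 / 4 : ℝ) = q, (T : ℝ) ^ (1 / 4 : ℝ) = r at *
  calc 1 / (T : ℝ) * Y = 1 / (α * T) * (α * Y) := by field_simp
    _ ≤ 1 / (α * T) * (8 * (D * T + X * q)) := by gcongr
    _ = 8 * (D / α + X * (q * r) / (α * r * T)) := by field_simp
    _ = _ := by rw [hprod, mul_div_mul_right _ _ hT₀.ne']

theorem eventually_average_le (hα : 0 < α) (hD : 0 ≤ D) (hN : 0 < N) (hν : 0 < ν) (hd : 1 ≤ d)
    (ht₀ : 1 ≤ t₀) (hη : ∀ t : ℕ, η t = 1 / (2 * d * (t : ℝ) ^ (3 / 4 : ℝ)))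
    (hδ : ∀ t : ℕ, δ t = 1 / (t : ℝ) ^ (1 / 4 : ℝ)) (hS : ∀ t ≥ 1, S t ∈ Set.Icc 0 N) :
    ∀ᶠ T : ℕ in atTop, ∀ V : ℕ → ℝ, 0 ≤ V (T + 1) → V t₀ ≤ N * ν * Real.log T + M →
      (∀ t ≥ t₀, η t * (α / 2) * S t ≤ V t - V (t + 1)
        + η t * (D + N * (1 / (T : ℝ)) + N * ν * δ t)) →
      (1 / (T : ℝ)) * ∑ t ∈ Icc 1 T, S t
        ≤ 8 * (D / α + N * ν * d * Real.log T / (α * (T : ℝ) ^ (1 / 4 : ℝ))) := by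
  have hd₀ : 0 < d := one_pos.trans_le hd
  have hlog : ∀ᶠ T : ℕ in atTop,
      (4 * d * M + 2 * N * ν + 8 * N + α * (t₀ * N)) / (2 * d * N * ν) ≤ Real.log T :=
    (Real.tendsto_log_atTop.comp tendsto_natCast_atTop_atTop).eventually_ge_atTop _
  filter_upwards [hlog, eventually_ge_atTop t₀] with T hlog hT V hV hM hstep
  rw [div_le_iff₀ (by positivity)] at hlog
  have hT₁ : (1 : ℝ) ≤ T := Nat.one_le_cast.2 (ht₀.trans hT)
  have hsplit := sum_Icc_one_le hN.le ht₀ hT fun t ht => (hS t ht).2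
  have htail := mul_sum_Icc_le hα hD hN.le hν.le hd₀ ht₀ hT hη hδ (fun t ht => (hS t ht).1) hV hM
    hstep
  have hpow : 1 ≤ (T : ℝ) ^ (3 / 4 : ℝ) := Real.one_le_rpow hT₁ (by norm_num)
  refine average_le_of_mul_sum_le hα (ht₀.trans hT) ?_
  generalize (T : ℝ) ^ (3 / 4 : ℝ) = q at *
  calc _ ≤ α * (t₀ * N) + α * ∑ t ∈ Icc t₀ T, S t := by
        rw [← mul_add]
        gcongr
    _ ≤ 8 * D * T + (4 * d * M + 2 * N * ν + 8 * N + α * (t₀ * N)) * q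
        + (4 * d + 2) * (N * ν * Real.log T * q) := by
        linarith [le_mul_of_one_le_right hN.le hpow,
          le_mul_of_one_le_right (by positivity : 0 ≤ α * (t₀ * N)) hpow]
    _ ≤ 8 * D * T + Real.log T * (2 * d * N * ν) * q
        + (4 * d + 2 * d) * (N * ν * Real.log T * q) := by
        have := Real.log_nonneg hT₁
        gcongr
        linarith
    _ = _ := by ring

end Averaging

section Schedule

open Filter Topology

variable {η δ : ℕ → ℝ} {d t : ℕ} {B ζ κ ε ρ θ : ℝ}

variable (hδ : ∀ t : ℕ, δ t = 1 / (t : ℝ) ^ (1 / 4 : ℝ))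

include hδ

theorem radius_pos (ht : 1 ≤ t) : 0 < δ t := by
  have : (0 : ℝ) < t := Nat.cast_pos.2 ht
  rw [hδ]
  positivity

theorem radius_le_one (ht : 1 ≤ t) : δ t ≤ 1 := by
  rw [hδ]
  exact div_le_one_of_le₀ (Real.one_le_rpow (Nat.one_le_cast.2 ht) (by norm_num)) (by positivity)

theorem radius_pow_four_mul (ht : 1 ≤ t) : δ t ^ 4 * t = 1 := by
  rw [hδ, div_pow, one_pow, rpow_one_quarter_pow_four t.cast_nonneg]
  exact one_div_mul_cancel (Nat.cast_ne_zero.2 (by lia))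

theorem tendsto_radius : Tendsto δ atTop (𝓝 0) := by
  simpa only [funext hδ, one_div, Function.comp_def, Pi.inv_def] using
    ((tendsto_rpow_atTop (by norm_num : (0 : ℝ) < 1 / 4)).comp
      tendsto_natCast_atTop_atTop).inv_tendsto_atTop

variable (hη : ∀ t : ℕ, η t = 1 / (2 * (d : ℝ) * (t : ℝ) ^ (3 / 4 : ℝ)))

include hη

theorem rate_eq (t : ℕ) : η t = δ t ^ 3 / (2 * d) := by
  rw [hη, hδ, rpow_three_quarters t.cast_nonneg]
  ring

theorem rate_mul_succ_mul_le_one (hd : d ≠ 0) (ht : 1 ≤ t) :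
    η t * ((t : ℝ) + 1) * d * δ t ≤ 1 :=
  calc η t * ((t : ℝ) + 1) * d * δ t = (δ t ^ 4 * t + δ t ^ 4) / 2 := by
        rw [rate_eq hδ hη]
        field_simp
    _ ≤ (1 + 1) / 2 := by
        rw [radius_pow_four_mul hδ ht]
        gcongr
        exact pow_le_one₀ (radius_pos hδ ht).le (radius_le_one hδ ht)
    _ = 1 := by norm_num

theorem rate_mul_div_radius_mul_sqrt_le (hd : d ≠ 0) (hζ : 0 ≤ ζ) (ht : 1 ≤ t) :
    η t * (d / δ t) * √(1 + η t * ((t : ℝ) + 1) * ζ * B ^ 2) ≤ δ t * (1 + ζ * B ^ 2) := by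
  have hδ₀ := radius_pos hδ ht
  have hδ₁ := radius_le_one hδ ht
  have hη₀ : 0 ≤ η t := by rw [hη]; positivity
  have hweight : η t * ((t : ℝ) + 1) * δ t ≤ 1 :=
    (le_mul_of_one_le_right (by positivity) (Nat.one_le_cast.2 (Nat.one_le_iff_ne_zero.2 hd))).trans
      ((mul_right_comm _ _ _).trans_le (rate_mul_succ_mul_le_one hδ hη hd ht))
  have hsqrt : √(1 + η t * ((t : ℝ) + 1) * ζ * B ^ 2) ≤ 1 + η t * ((t : ℝ) + 1) * ζ * B ^ 2 :=
    Real.sqrt_le_self_iff.2 (Or.inr (le_add_of_nonneg_right (by positivity)))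
  calc η t * (d / δ t) * √(1 + η t * ((t : ℝ) + 1) * ζ * B ^ 2)
      ≤ η t * (d / δ t) * (1 + η t * ((t : ℝ) + 1) * ζ * B ^ 2) := by gcongr
    _ = δ t / 2 * (δ t + η t * ((t : ℝ) + 1) * δ t * (ζ * B ^ 2)) := by
        nth_rw 1 [rate_eq hδ hη]
        field_simp
    _ ≤ δ t / 2 * (1 + 1 * (ζ * B ^ 2)) := by gcongr
    _ ≤ δ t * (1 + ζ * B ^ 2) := by
        have : 0 ≤ δ t * (1 + ζ * B ^ 2) := by positivity
        linarith

theorem rate_mul_sq_mul_le (hd : d ≠ 0) (hε : 0 ≤ ε) (ht : 1 ≤ t) :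
    η t * (d / δ t) ^ 2 * (8 * (1 + η t * ((t : ℝ) + 1) * ε * B ^ 2) + 2 / κ) / 4
      ≤ δ t * (d / 8 * (8 + 2 / κ)) + ε * B ^ 2 := by
  have hδ₀ := radius_pos hδ ht
  have hweight := mul_le_mul_of_nonneg_right (rate_mul_succ_mul_le_one hδ hη hd ht)
    (by positivity : 0 ≤ ε * B ^ 2)
  calc _ = δ t * (d / 8 * (8 + 2 / κ))
        + η t * ((t : ℝ) + 1) * d * δ t * (ε * B ^ 2) := by
        nth_rw 1 [rate_eq hδ hη]
        field_simp
        ring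
    _ ≤ _ := by linarith

theorem eventually_isSmallStep (hd : d ≠ 0) (hζ : 0 ≤ ζ) (hB : 0 ≤ B) (hε : 0 ≤ ε) (hρ : 0 < ρ)
    (hεθ : ε * B ^ 2 < θ) : ∀ᶠ t in atTop, IsSmallStep d B κ ζ ε ρ θ η δ t := by
  have hsmall : ∀ a b : ℝ, 0 < b → ∀ᶠ t in atTop, δ t * a < b := fun a b hb => by
    have := (tendsto_radius hδ).mul_const a
    rw [zero_mul] at this
    exact this.eventually_lt_const hb
  filter_upwards [eventually_ge_atTop 1, hsmall 1 1 one_pos, hsmall B ρ hρ,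
    hsmall (1 + ζ * B ^ 2) (1 / 8) (by norm_num), hsmall (8 * (1 + ζ * B ^ 2) * B) ρ hρ,
    hsmall (d / 8 * (8 + 2 / κ)) (θ - ε * B ^ 2) (sub_pos.2 hεθ)] with t ht hone hradius hlength
    hlength_mul hnoise
  have hle := rate_mul_div_radius_mul_sqrt_le (B := B) hδ hη hd hζ ht
  refine ⟨?_, hle.trans_lt hlength, lt_of_le_of_lt ?_ hlength_mul, ?_, mul_one (δ t) ▸ hone,
    hradius⟩
  · have : (0 : ℝ) < t := Nat.cast_pos.2 ht
    rw [hη, hη, Nat.cast_succ]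
    gcongr
    linarith
  · calc _ ≤ 8 * (δ t * (1 + ζ * B ^ 2)) * B := by gcongr
      _ = _ := by ring
  · exact (rate_mul_sq_mul_le hδ hη hd hε ht).trans (lt_sub_iff_add_lt.1 hnoise).le

end Schedule

theorem Game.IsConvexGame.exists_comparator {n d : ℕ} {𝒢 : Game n d} {B ν a : ℝ} {ℓ : Fin n → ℝ}
    (h𝒢 : 𝒢.IsConvexGame B ℓ) {i : Fin n} {h : Act d → ℝ}
    (hb : IsSelfConcordantBarrier ν (𝒢.X i) h) (hν : 0 < ν) {y₀ y₁ : Act d}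
    (hy₀ : y₀ ∈ interior (𝒢.X i)) (hy₁ : y₁ ∈ 𝒢.X i) (ha : a ∈ Set.Ioc (0 : ℝ) 1) :
    ∃ u ∈ interior (𝒢.X i), h u ≤ h y₀ - ν * Real.log a ∧
      ∀ y ∈ 𝒢.profiles, 𝒢.c i (Function.update y i u) ≤ 𝒢.c i (Function.update y i y₁) + a := by
  have hs : 1 - a ∈ Set.Ico (0 : ℝ) 1 := ⟨sub_nonneg.2 ha.2, sub_lt_self 1 ha.1⟩
  have hlog := hb.le_sub_mul_log (h𝒢.convex_set i) hν hy₀ hy₁ hs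
  rw [sub_sub_cancel] at hlog
  refine ⟨_, IsSelfConcordantBarrier.add_smul_sub_mem_interior (h𝒢.convex_set i) hy₀ hy₁ hs, hlog,
    fun y hy => ?_⟩
  have hconv := (h𝒢.convex i y hy).2 (interior_subset hy₀) hy₁ ha.1.le hs.1 (add_sub_cancel a 1)
  rw [show a • y₀ + (1 - a) • y₁ = y₀ + (1 - a) • (y₁ - y₀) by module, smul_eq_mul,
    smul_eq_mul] at hconv
  have hle := mul_le_mul_of_nonneg_left
    (h𝒢.range i _ (update_mem_profiles hy (interior_subset hy₀))).2 ha.1.le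
  have hnonneg := mul_nonneg ha.1.le (h𝒢.range i _ (update_mem_profiles hy hy₁)).1
  simp only [Game.ownCost] at hconv
  linarith

namespace AdmissibleRun

open Filter

variable {n d : ℕ} {Ω : Type*} {𝒢 : Game n d} {B : ℝ} {ℓ : Fin n → ℝ} {ν κ μ ζ Cp : ℝ}
  {h p : Fin n → Act d → ℝ} {η δ : ℕ → ℝ} {z : Fin n → ℕ → Ω → Sph d}
  {x : Fin n → ℕ → Ω → Act d} {A : Fin n → ℕ → Ω → Act d →L[ℝ] Act d} {t : ℕ}
  (R : AdmissibleRun 𝒢 B ℓ ν κ μ ζ Cp h p η δ z x A)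

include R

theorem exists_comparators (hν : 0 < ν) {x' : Fin n → Act d} (hx' : x' ∈ 𝒢.profiles) :
    ∃ M, ∀ T : ℕ, 1 ≤ T → ∃ u : Fin n → Act d, (∀ i, u i ∈ interior (𝒢.X i)) ∧
      ∑ i, h i (u i) ≤ n * ν * Real.log T + M ∧
      ∀ i, ∀ y ∈ 𝒢.profiles, 𝒢.c i (Function.update y i (u i))
        ≤ 𝒢.c i (Function.update y i (x' i)) + 1 / (T : ℝ) := by
  choose y₀ hy₀ using R.game.nonempty_interior
  refine ⟨∑ i, h i (y₀ i), fun T hT => ?_⟩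
  have hscale : 1 / (T : ℝ) ∈ Set.Ioc (0 : ℝ) 1 :=
    ⟨one_div_pos.2 (Nat.cast_pos.2 hT), div_le_one_of_le₀ (Nat.one_le_cast.2 hT) T.cast_nonneg⟩
  choose u hu hlog hcost using fun i =>
    R.game.exists_comparator (R.barrier i) hν (hy₀ i) (hx' i) hscale
  refine ⟨u, hu, (Finset.sum_le_sum fun i _ => hlog i).trans_eq ?_, hcost⟩
  rw [one_div, Real.log_inv, Finset.sum_sub_distrib, Finset.sum_const, Finset.card_univ,
    Fintype.card_fin, nsmul_eq_mul]
  ring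

variable [MeasurableSpace Ω] {P : Measure Ω} [IsProbabilityMeasure P]

theorem eventually_integral_potential_succ_le (hz : IsUniformSampling P z)
    (hη : ∀ t : ℕ, η t = 1 / (2 * (d : ℝ) * (t : ℝ) ^ (3 / 4 : ℝ)))
    (hδ : ∀ t : ℕ, δ t = 1 / (t : ℝ) ^ (1 / 4 : ℝ)) {θ : ℝ} (hθ : 0 < θ) (hν : 0 < ν)
    (i : Fin n) :
    ∀ᶠ t in atTop, ∀ u ∈ 𝒢.X i,
      ∫ ω, potential h p κ η x i u (t + 1) ω ∂P ≤ ∫ ω, potential h p κ η x i u t ω ∂P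
        + η t * (∫ ω, 𝒢.c i (Function.update (played δ z x A t ω) i u) ∂P + ν * δ t
          + (θ - 1) * ∫ ω, 𝒢.c i (played δ z x A t ω) ∂P) := by
  have hB := R.diameter_pos i
  have hκ := R.reg.κ_pos
  obtain ⟨ε, hε, hεmin⟩ := exists_between
    (lt_min (by positivity : 0 < θ / B ^ 2) (by positivity : 0 < ν / (κ * B ^ 2)))
  have hεθ : ε * B ^ 2 < θ := (lt_div_iff₀ (by positivity)).1 (hεmin.trans_le (min_le_left _ _))
  have hεν : ε * (κ * B ^ 2) < ν :=
    (lt_div_iff₀ (by positivity)).1 (hεmin.trans_le (min_le_right _ _))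
  obtain ⟨ρ, hρ₀, hρ⟩ := exists_norm_hess_sub_le (R.game.compact_set i) (R.reg.contDiffAt i) hε
  have herror : ∀ᶠ t in atTop, δ t * (2 * ℓ i * B ^ 2) < ν - ε * (κ * B ^ 2) := by
    have := (tendsto_radius hδ).mul_const (2 * ℓ i * B ^ 2)
    rw [zero_mul] at this
    exact this.eventually_lt_const (sub_pos.2 hεν)
  filter_upwards [eventually_ge_atTop 1, herror, eventually_isSmallStep (κ := κ) hδ hη
    R.dim_ne_zero R.reg.ζ_pos.le hB.le hε.le hρ₀ hεθ] with t ht herror hst u hu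
  refine R.integral_potential_succ_le hz hε.le i hρ ht hst ?_ hu
  have := mul_le_mul_of_nonneg_left herror.le (radius_pos hδ ht).le
  linarith

theorem integral_SW_mem_Icc (ht : 1 ≤ t) (hz : IsUniformSampling P z) :
    ∫ ω, 𝒢.SW (played δ z x A t ω) ∂P ∈ Set.Icc (0 : ℝ) n := by
  refine ⟨integral_nonneg fun ω => R.game.SW_nonneg (R.played_mem ht ω), ?_⟩
  have := integral_mono (R.integrable_SW_played hz ht) (integrable_const (μ := P) (n : ℝ))
    fun ω => R.game.SW_le (R.played_mem ht ω)
  rwa [integral_const, probReal_univ, one_smul] at this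

theorem exists_sum_integral_potential_le (hz : IsUniformSampling P z) (ht : 1 ≤ t) :
    ∃ M, ∀ u ∈ 𝒢.profiles,
      ∑ i, ∫ ω, potential h p κ η x i (u i) t ω ∂P ≤ ∑ i, h i (u i) + M := by
  choose M hM using fun i => R.exists_potential_le i ht
  refine ⟨∑ i, M i, fun u hu => ?_⟩
  rw [← Finset.sum_add_distrib]
  refine Finset.sum_le_sum fun i _ => ?_
  have := integral_mono (R.integrable_potential hz i ht (u i))
    (integrable_const (μ := P) (h i (u i) + M i)) (hM i (u i) (hu i))
  rwa [integral_const, probReal_univ, one_smul] at this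

theorem eventually_average_SW_le (hz : IsUniformSampling P z)
    (hη : ∀ t : ℕ, η t = 1 / (2 * (d : ℝ) * (t : ℝ) ^ (3 / 4 : ℝ)))
    (hδ : ∀ t : ℕ, δ t = 1 / (t : ℝ) ^ (1 / 4 : ℝ)) {C₁ C₂ : ℝ} (hsmooth : 𝒢.IsSmoothGame C₁ C₂)
    (hn : n ≠ 0) :
    ∀ᶠ T : ℕ in atTop, (1 / (T : ℝ)) * ∑ t ∈ Finset.Icc 1 T, ∫ ω, 𝒢.SW (played δ z x A t ω) ∂P
      ≤ 8 * (C₁ * 𝒢.OPT / (1 - C₂)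
        + n * ν * d * Real.log T / ((1 - C₂) * (T : ℝ) ^ (1 / 4 : ℝ))) := by
  obtain ⟨hC₁, hC₂, x', hx', hsm⟩ := hsmooth
  have hα : 0 < 1 - C₂ := sub_pos.2 hC₂
  have hν := R.ν_pos ⟨0, Nat.pos_of_ne_zero hn⟩
  have hround := eventually_all.2 fun i =>
    R.eventually_integral_potential_succ_le hz hη hδ (half_pos hα) hν i
  obtain ⟨t₀, hround, ht₀⟩ :=
    ((eventually_forall_ge_atTop.2 hround).and (eventually_ge_atTop 1)).exists
  obtain ⟨M, hM⟩ := R.exists_sum_integral_potential_le hz ht₀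
  obtain ⟨M', hM'⟩ := R.exists_comparators hν hx'
  filter_upwards [eventually_ge_atTop t₀, eventually_average_le (M := M' + M) hα
    (mul_nonneg hC₁.le R.game.OPT_nonneg) (Nat.cast_pos.2 (Nat.pos_of_ne_zero hn)) hν
    (Nat.one_le_cast.2 (Nat.one_le_iff_ne_zero.2 R.dim_ne_zero)) ht₀ hη hδ
    fun t ht => R.integral_SW_mem_Icc ht hz] with T hT haverage
  obtain ⟨u, hu, hlog, hcost⟩ := hM' T (ht₀.trans hT)
  have huX := fun i => interior_subset (hu i)
  refine haverage (fun t => ∑ i, ∫ ω, potential h p κ η x i (u i) t ω ∂P) ?_ ?_ fun t ht => ?_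
  · exact Finset.sum_nonneg fun i _ => integral_nonneg fun ω =>
      R.potential_nonneg i (Nat.le_add_left 1 T) (hu i) ω
  · linarith [hM u huX]
  · have := R.integral_SW_le hz hsm huX hcost (ht₀.trans ht) fun i => hround t ht i (u i) (huX i)
    linarith

end AdmissibleRun

end

open Filter in
theorem mainTheorem4_general {n d : ℕ} (hd : d ≠ 0) {𝒢 : Game n d} {B : ℝ} {ℓ : Fin n → ℝ}
    (h𝒢 : 𝒢.IsConvexGame B ℓ) {C₁ C₂ : ℝ} (hsmooth : 𝒢.IsSmoothGame C₁ C₂) {ν κ μ ζ Cp : ℝ}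
    {h p : Fin n → Act d → ℝ} (hb : ∀ i, IsSelfConcordantBarrier ν (𝒢.X i) (h i))
    (hp : IsRegularizer 𝒢 κ μ ζ Cp p) {η δ : ℕ → ℝ}
    (hη : ∀ t : ℕ, η t = 1 / (2 * (d : ℝ) * (t : ℝ) ^ (3 / 4 : ℝ)))
    (hδ : ∀ t : ℕ, δ t = 1 / (t : ℝ) ^ (1 / 4 : ℝ)) {Ω : Type*} [MeasurableSpace Ω]
    {P : Measure Ω} [IsProbabilityMeasure P] {z : Fin n → ℕ → Ω → Sph d}
    {x : Fin n → ℕ → Ω → Act d} {A : Fin n → ℕ → Ω → Act d →L[ℝ] Act d}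
    (hz : IsUniformSampling P z) (hrun : IsAlgorithmRun 𝒢 h p κ η δ z x A) :
    (∀ t : ℕ, 1 ≤ t → Integrable (fun ω => 𝒢.SW (played δ z x A t ω)) P) ∧
      ∀ᶠ T : ℕ in atTop,
        (1 / (T : ℝ)) * ∑ t ∈ Finset.Icc 1 T, ∫ ω, 𝒢.SW (played δ z x A t ω) ∂P
          ≤ 8 * (C₁ * 𝒢.OPT / (1 - C₂)
            + n * ν * d * Real.log T / ((1 - C₂) * (T : ℝ) ^ (1 / 4 : ℝ))) := by
  have R : AdmissibleRun 𝒢 B ℓ ν κ μ ζ Cp h p η δ z x A :=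
    { dim_ne_zero := hd, game := h𝒢, barrier := hb, reg := hp, run := hrun
      η_nonneg := fun t => by rw [hη]; positivity
      δ_pos := fun t ht => radius_pos hδ ht
      δ_le_one := fun t ht => radius_le_one hδ ht }
  refine ⟨fun t ht => R.integrable_SW_played hz ht, ?_⟩
  obtain rfl | hn := eq_or_ne n 0
  · have := div_nonneg (mul_nonneg hsmooth.1.le h𝒢.OPT_nonneg) (sub_pos.2 hsmooth.2.1).le
    exact .of_forall fun T => by simpa [Game.SW] using this
  · exact R.eventually_average_SW_le hz hη hδ hsmooth hn

theorem mainTheorem4 :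
    ∃ K : ℝ, 0 < K ∧
      ∀ (n d : ℕ), 1 ≤ d →
      ∀ (𝒢 : Game n d) (B G : ℝ) (ℓ : Fin n → ℝ), 𝒢.IsMonotoneGame B G ℓ →
      ∀ (C₁ C₂ : ℝ), 𝒢.IsSmoothGame C₁ C₂ →
      ∀ (ν κ μ ζ Cp : ℝ) (h p : Fin n → Act d → ℝ),
        (∀ i, IsSelfConcordantBarrier ν (𝒢.X i) (h i)) →
        IsRegularizer 𝒢 κ μ ζ Cp p →
      ∀ (η δ : ℕ → ℝ),
        (∀ t : ℕ, η t = 1 / (2 * (d : ℝ) * (t : ℝ) ^ (3 / 4 : ℝ))) →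
        (∀ t : ℕ, δ t = 1 / (t : ℝ) ^ (1 / 4 : ℝ)) →
      ∀ (Ω : Type*) [MeasurableSpace Ω] (P : Measure Ω) [IsProbabilityMeasure P]
        (z : Fin n → ℕ → Ω → Sph d) (x : Fin n → ℕ → Ω → Act d)
        (A : Fin n → ℕ → Ω → Act d →L[ℝ] Act d),
        IsUniformSampling P z →
        IsAlgorithmRun 𝒢 h p κ η δ z x A →
        (∀ t : ℕ, 1 ≤ t → Integrable (fun ω => 𝒢.SW (played δ z x A t ω)) P) ∧
        ∃ T₀ : ℕ, ∀ T : ℕ, T₀ ≤ T →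
          (1 / (T : ℝ)) * ∑ t ∈ Finset.Icc 1 T, ∫ ω, 𝒢.SW (played δ z x A t ω) ∂P
            ≤ K * (C₁ * 𝒢.OPT / (1 - C₂)
                + (n : ℝ) * ν * (d : ℝ) * Real.log T / ((1 - C₂) * (T : ℝ) ^ (1 / 4 : ℝ))
                + Real.sqrt n * B * (∑ i, ℓ i) / ((1 - C₂) * (T : ℝ) ^ (1 / 4 : ℝ))) := by
  refine ⟨8, by norm_num, fun n d hd 𝒢 B G ℓ h𝒢 C₁ C₂ hsmooth ν κ μ ζ Cp h p hb hp η δ hη hδ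
    Ω _ P _ z x A hz hrun => ?_⟩
  have hd₀ := Nat.one_le_iff_ne_zero.1 hd
  have := NeZero.mk hd₀
  obtain ⟨hint, hle⟩ := mainTheorem4_general hd₀ h𝒢.isConvexGame hsmooth hb hp hη hδ hz hrun
  refine ⟨hint, Filter.eventually_atTop.1 (hle.mono fun T hT => hT.trans ?_)⟩
  obtain ⟨-, hC₂, x', hx', -⟩ := hsmooth
  gcongr 8 * ?_
  refine le_add_of_nonneg_right (div_nonneg (mul_nonneg ?_ (Finset.sum_nonneg fun i _ =>
    h𝒢.isConvexGame.smooth_nonneg hx' i)) (mul_nonneg (sub_pos.2 hC₂).le (by positivity)))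
  obtain rfl | hn := eq_or_ne n 0
  · simp
  · have := h𝒢.isConvexGame.diameter_pos ⟨0, Nat.pos_of_ne_zero hn⟩
    positivity
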